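/- **Setting.** Let $\Gamma=\partial\Omega\subset\mathbb{R}^3$ be a closed, connected, smooth embedded surface bounding the bounded open set $\Omega$, with signed distance function $\rho$ (negative in $\Omega$), exterior unit normal $\boldsymbol n=\nabla\rho$ and closest point mapping $\boldsymbol p$. Let $\delta_0>0$ be such that every point of $U_{\delta_0}(\Gamma)=\{x:|\rho(x)|<\delta_0\}$ has exactly one closest point on $\Gamma$. A function $v$ on $\Gamma$ is extended by $v^e=v\circ\boldsymbol p$. Fix orders $k_g\ge1$, $k_u\ge 1$, $k_p\ge 0$ and a constant $c>0$. A mesh of size $h>0$ is a triangulated surface $\Gamma_h$ consisting of finitely many triangles $K=F_K(\widehat K)$, where $\widehat K\subset\mathbb{R}^2$ is the reference triangle and $F_K:\widehat K\to K$ is a bijection whose components are polynomials of degree at most $k_g$; two different triangles meet in the empty set, a common vertex or a common edge, and on a common edge their parametrizations agree up to an affine identification of the reference edges. We assume * (quasi-uniformity) $c^{-1}h|\xi|\le|DF_K(\hat x)\xi|\le c\,h|\xi|$ for all $K$, $\hat x\in\widehat K$, $\xi\in\mathbb{R}^2$; * (geometry approximation) $\Gamma_h\subset U_{\delta_0}(\Gamma)$,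 $\boldsymbol p:\Gamma_h\to\Gamma$ is a bijection, $\|\rho\|_{L^\infty(\Gamma_h)}\le c\,h^{k_g+1}$ and $\|\boldsymbol n\circ\boldsymbol p-\boldsymbol n_h\|_{L^\infty(\Gamma_h)}\le c\,h^{k_g}$, where $\boldsymbol n_h$ is the elementwise defined, suitably oriented unit normal to $\Gamma_h$. Let $V_{h,k}$ be the space of continuous functions $v$ on $\Gamma_h$ such that $v|_K\circ F_K$ is a polynomial of degree at most $k$ for every $K$, and let $\boldsymbol V_h=[V_{h,k_u}]^3$ and $Q_h=\{q\in V_{h,k_p}:\int_{\Gamma_h}q=0\}$. Write $(\cdot,\cdot)_{\Gamma_h}$ and $\|\cdot\|_{\Gamma_h}$ for the $L^2(\Gamma_h)$ inner product and norm, $\|\cdot\|_\Gamma$ for the $L^2(\Gamma)$ norm, $\nabla_{\Gamma_h}$ for the elementwise tangential gradient, and $|||(\boldsymbol v,q)|||_h^2=\|\boldsymbol v\|_{\Gamma_h}^2+\|\nabla_{\Gamma_h}q\|_{\Gamma_h}^2$. Let $$A_h((\boldsymbol u,p),(\boldsymbol v,q))=(\boldsymbol u,\boldsymbol v)_{\Gamma_h}+(\nabla_{\Gamma_h}p,\boldsymbol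 v)_{\Gamma_h}-(\boldsymbol u,\nabla_{\Gamma_h}q)_{\Gamma_h}+\tfrac12(\boldsymbol u+\nabla_{\Gamma_h}p,-\boldsymbol v+\nabla_{\Gamma_h}q)_{\Gamma_h},$$ $$L_h((\boldsymbol v,q))=(f^e,q)_{\Gamma_h}+(\boldsymbol g^e,\boldsymbol v)_{\Gamma_h}+\tfrac12(\boldsymbol g^e,-\boldsymbol v+\nabla_{\Gamma_h}q)_{\Gamma_h}.$$ **Lemma.** There are $h_0>0$ and $C>0$, depending only on $\Gamma,\delta_0,k_g,k_u,k_p$ and $c$, such that the following holds for every $h\in(0,h_0]$ and every mesh of size $h$ as above. If $f\in L^2(\Gamma)$ with $\int_\Gamma f=0$, if $\boldsymbol g\in[L^2(\Gamma)]^3$ with $\boldsymbol n\cdot\boldsymbol g=0$ almost everywhere on $\Gamma$, and if $(\boldsymbol u_h,p_h)\in\boldsymbol V_h\times Q_h$ satisfies $A_h((\boldsymbol u_h,p_h),(\boldsymbol v,q))=L_h((\boldsymbol v,q))$ for all $(\boldsymbol v,q)\in\boldsymbol V_h\times Q_h$, then $$|||(\boldsymbol u_h,p_h)|||_h+h^{-1}\|(\boldsymbol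 n\circ\boldsymbol p)\cdot\boldsymbol u_h\|_{\Gamma_h}\le C\left(\|f\|_\Gamma+\|\boldsymbol g\|_\Gamma\right).$$ -/

import Mathlib

open MeasureTheory Set

noncomputable section

namespace SurfaceDarcy

/-- The ambient space `ℝ³` with its Euclidean structure. -/
abbrev E3 : Type := EuclideanSpace ℝ (Fin 3)

/-- The parameter plane `ℝ²` with its Euclidean structure. -/
abbrev E2 : Type := EuclideanSpace ℝ (Fin 2)

/-! ### The exact surface -/

/-- `Γ = ∂Ω` is a closed (compact, without boundary), connected, smooth surface embedded in `ℝ³`,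
given together with the bounded region `Ω` that it encloses: near each point of `Γ` there is a
smooth function `φ` with nonvanishing gradient such that `Ω = {φ < 0}` locally. -/
structure BoundsSmoothSurface (Ω : Set E3) : Prop where
  isOpen : IsOpen Ω
  isBounded : Bornology.IsBounded Ω
  isConnected : IsConnected (frontier Ω)
  smooth : ∀ x ∈ frontier Ω, ∃ U ∈ nhds x, ∃ φ : E3 → ℝ,
    ContDiff ℝ (⊤ : ℕ∞) φ ∧ gradient φ x ≠ 0 ∧ ∀ y ∈ U, (y ∈ Ω ↔ φ y < 0)

open scoped Classical in
/-- The signed distance function `ρ` to `Γ = ∂Ω`, negative inside `Ω`. -/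
def rho (Ω : Set E3) (x : E3) : ℝ :=
  if x ∈ Ω then -Metric.infDist x (frontier Ω) else Metric.infDist x (frontier Ω)

/-- The exterior unit normal `n = ∇ρ`. -/
def normal (Ω : Set E3) (x : E3) : E3 := gradient (rho Ω) x

/-- The open tubular neighbourhood `U_δ(Γ) = {x : |ρ(x)| < δ}`. -/
def tube (Ω : Set E3) (δ : ℝ) : Set E3 := {x | |rho Ω x| < δ}

/-- `y` is a point of `Γ` closest to `x`. -/
def IsClosestPoint (Γ : Set E3) (x y : E3) : Prop :=
  y ∈ Γ ∧ dist x y = Metric.infDist x Γ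

/-- The closest point mapping `p`. It is used only where there is exactly one closest point. -/
def closestPoint (Γ : Set E3) (x : E3) : E3 :=
  Classical.epsilon fun y => IsClosestPoint Γ x y

/-- The extension `vᵉ = v ∘ p` of a function on `Γ = ∂Ω`. -/
def extension {α : Type*} (Ω : Set E3) (v : E3 → α) : E3 → α :=
  fun x => v (closestPoint (frontier Ω) x)

/-- The surface measure on `Γ = ∂Ω`: the two-dimensional Hausdorff measure, normalized so as to
agree with area on planes. -/
def surfaceMeasure (Ω : Set E3) : Measure E3 :=
  (Measure.euclideanHausdorffMeasure 2 : Measure E3).restrict (frontier Ω)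

/-- The `L²(Γ)` norm of a (scalar or vector valued) function that belongs to `L²(Γ)`. -/
def normGamma {α : Type*} [NormedAddCommGroup α] (Ω : Set E3) (v : E3 → α) : ℝ :=
  Real.sqrt (∫ x, ‖v x‖ ^ 2 ∂(surfaceMeasure Ω))

/-! ### The triangulated surface -/

/-- The closed reference triangle with vertices `(0,0)`, `(1,0)`, `(0,1)`. -/
def refTriangle : Set E2 := {x | 0 ≤ x 0 ∧ 0 ≤ x 1 ∧ x 0 + x 1 ≤ 1}

/-- Barycentric coordinates on the reference triangle. -/
def baryCoord (x : E2) : Fin 3 → ℝ := ![1 - x 0 - x 1, x 0, x 1]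

/-- A point `x` of the reference triangle, placed in the geometric realization of an abstract
simplicial complex with vertices labelled by natural numbers: `a` lists the vertices of the
triangle, and the value at a label is the barycentric coordinate at the vertex with that label. -/
def realize (a : Fin 3 → ℕ) (x : E2) : ℕ → ℝ :=
  ∑ i, Pi.single (a i) (baryCoord x i)

/-- The map `ℝ² → ℝ³` whose components are the polynomials `P 0`, `P 1`, `P 2`. -/
def polyMap (P : Fin 3 → MvPolynomial (Fin 2) ℝ) (x : E2) : E3 :=
  WithLp.toLp 2 fun i => MvPolynomial.eval (fun j => x j) (P i)

/-- A parametric triangulated surface of order `kg` in `ℝ³`: finitely many triangles, each with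
three distinct vertices and a polynomial parametrization `F_K` of degree at most `kg` defined on
the reference triangle. Two different triangles do not have the same three vertices. By `glue` the
parametrizations fit together to an injective map on the geometric realization of the abstract
complex: each `F_K` is injective, two triangles meet exactly in their common face (empty, a vertex
or an edge), and along a common edge their parametrizations agree up to the affine identification
of the reference edges. -/
structure Triangulation (kg : ℕ) where
  card : ℕ
  vert : Fin card → Fin 3 → ℕ
  poly : Fin card → Fin 3 → MvPolynomial (Fin 2) ℝ
  vert_injective : ∀ K, Function.Injective (vert K)
  eq_of_range_eq : ∀ K L, range (vert K) = range (vert L) → K = L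
  totalDegree_le : ∀ K i, (poly K i).totalDegree ≤ kg
  glue : ∀ K L, ∀ x ∈ refTriangle, ∀ y ∈ refTriangle,
    polyMap (poly K) x = polyMap (poly L) y ↔ realize (vert K) x = realize (vert L) y

namespace Triangulation

variable {kg : ℕ} (T : Triangulation kg)

/-- The parametrization `F_K`. -/
def F (K : Fin T.card) : E2 → E3 := polyMap (T.poly K)

/-- The derivative `DF_K(x)`. -/
def DF (K : Fin T.card) (x : E2) : E2 →L[ℝ] E3 := fderiv ℝ (T.F K) x

/-- The discrete surface `Γ_h`, the union of the elements `K = F_K(K̂)`. -/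
def surface : Set E3 := ⋃ K, T.F K '' refTriangle

/-- The first fundamental form `DF_Kᵀ DF_K`. -/
def gram (K : Fin T.card) (x : E2) : E2 →L[ℝ] E2 :=
  (ContinuousLinearMap.adjoint (T.DF K x)).comp (T.DF K x)

/-- The area element `√det(DF_Kᵀ DF_K)`. -/
def areaElement (K : Fin T.card) (x : E2) : ℝ := Real.sqrt (T.gram K x).det

/-- Elementwise fields on `Γ_h`, pulled back to the reference triangle. (A function on `Γ_h` may
be double valued on the edges, as gradients of finite element functions are.) -/
abbrev Field (α : Type*) := Fin T.card → E2 → α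

/-- The pull back `v ∘ F_K` of a function on `Γ_h`. -/
def pull {α : Type*} (v : E3 → α) : T.Field α := fun K x => v (T.F K x)

/-- The surface integral `∫_{Γ_h} w = ∑_K ∫_{K̂} w(F_K(x)) √det(DF_Kᵀ DF_K) dx`. -/
def integral (w : T.Field ℝ) : ℝ :=
  ∑ K, ∫ x in refTriangle, w K x * T.areaElement K x

/-- The inner product `(v, w)_{Γ_h}`. -/
def ip {α : Type*} [NormedAddCommGroup α] [InnerProductSpace ℝ α] (v w : T.Field α) : ℝ :=
  T.integral fun K x => inner ℝ (v K x) (w K x)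

/-- The norm `‖v‖_{Γ_h}`. -/
def l2norm {α : Type*} [NormedAddCommGroup α] (v : T.Field α) : ℝ :=
  Real.sqrt (T.integral fun K x => ‖v K x‖ ^ 2)

/-- The tangential gradient `∇_{Γ_h} q` on each element, the tangent vector
`DF_K (DF_Kᵀ DF_K)⁻¹ ∇(q ∘ F_K)`: its inner product with `DF_K ξ` is the derivative of `q ∘ F_K`
in direction `ξ`. -/
def grad (q : E3 → ℝ) : T.Field E3 := fun K x =>
  T.DF K x ((T.gram K x).inverse (gradientWithin (fun y => q (T.F K y)) refTriangle x))

/-- `ν` is a unit vector normal to the element `K` at `F_K(x)`. -/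
def IsUnitNormal (K : Fin T.card) (x : E2) (ν : E3) : Prop :=
  ‖ν‖ = 1 ∧ ∀ ξ : E2, inner ℝ ν (T.DF K x ξ) = 0

/-- Quasi-uniformity with mesh parameter `h` and constant `c`: up to the factor `c`, every
parametrization stretches all directions by `h`. -/
def QuasiUniform (c h : ℝ) : Prop :=
  ∀ K, ∀ x ∈ refTriangle, ∀ ξ : E2,
    c⁻¹ * h * ‖ξ‖ ≤ ‖T.DF K x ξ‖ ∧ ‖T.DF K x ξ‖ ≤ c * h * ‖ξ‖

/-- The geometry approximation property with constant `c`: `Γ_h` lies in the tube `U_δ₀(Γ)`, the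
closest point mapping is a bijection `Γ_h → Γ`, `‖ρ‖_{L^∞(Γ_h)} ≤ c h^{kg+1}`, and
`‖n ∘ p - n_h‖_{L^∞(Γ_h)} ≤ c h^{kg}` for the suitably oriented unit normal `n_h` of `Γ_h`. -/
structure Approximates (Ω : Set E3) (δ₀ c h : ℝ) : Prop where
  subset_tube : T.surface ⊆ tube Ω δ₀
  bijOn : BijOn (closestPoint (frontier Ω)) T.surface (frontier Ω)
  rho_le : ∀ y ∈ T.surface, |rho Ω y| ≤ c * h ^ (kg + 1)
  normal_le : ∀ K, ∀ x ∈ refTriangle, ∃ ν, T.IsUnitNormal K x ν ∧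
    ‖extension Ω (normal Ω) (T.F K x) - ν‖ ≤ c * h ^ kg

/-! ### The finite element method -/

/-- The scalar space `V_{h,k,kg}`: functions, continuous on `Γ_h`, whose pull back to the reference
triangle is on each element a polynomial of degree at most `k`. Only the values on `Γ_h` matter. -/
def scalarSpace (k : ℕ) : Set (E3 → ℝ) :=
  {v | ContinuousOn v T.surface ∧ ∀ K, ∃ P : MvPolynomial (Fin 2) ℝ, P.totalDegree ≤ k ∧
    ∀ x ∈ refTriangle, v (T.F K x) = MvPolynomial.eval (fun j => x j) P}

/-- The velocity space `[V_{h,k,kg}]³`. -/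
def velocitySpace (k : ℕ) : Set (E3 → E3) :=
  {v | ∀ i, (fun x => v x i) ∈ T.scalarSpace k}

/-- The pressure space `{q ∈ V_{h,k,kg} : ∫_{Γ_h} q = 0}`. -/
def pressureSpace (k : ℕ) : Set (E3 → ℝ) :=
  {q | q ∈ T.scalarSpace k ∧ T.integral (T.pull q) = 0}

/-- The stabilized bilinear form `A_h((u,p),(v,q))`. -/
def formA (u : E3 → E3) (p : E3 → ℝ) (v : E3 → E3) (q : E3 → ℝ) : ℝ :=
  T.ip (T.pull u) (T.pull v) + T.ip (T.grad p) (T.pull v) - T.ip (T.pull u) (T.grad q)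
    + 1 / 2 * T.ip (T.pull u + T.grad p) (-T.pull v + T.grad q)

/-- The right hand side `L_h((v,q))` for the data `f`, `g` given on `Γ = ∂Ω`. -/
def formL (Ω : Set E3) (f : E3 → ℝ) (g : E3 → E3) (v : E3 → E3) (q : E3 → ℝ) : ℝ :=
  T.ip (T.pull (extension Ω f)) (T.pull q) + T.ip (T.pull (extension Ω g)) (T.pull v)
    + 1 / 2 * T.ip (T.pull (extension Ω g)) (-T.pull v + T.grad q)

/-- `(u, p)` solves the finite element method with velocities of order `ku` and pressures of order
`kp` for the data `f`, `g`. -/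
structure IsDiscreteSolution (Ω : Set E3) (ku kp : ℕ) (f : E3 → ℝ) (g : E3 → E3)
    (u : E3 → E3) (p : E3 → ℝ) : Prop where
  velocity_mem : u ∈ T.velocitySpace ku
  pressure_mem : p ∈ T.pressureSpace kp
  eq : ∀ v ∈ T.velocitySpace ku, ∀ q ∈ T.pressureSpace kp, T.formA u p v q = T.formL Ω f g v q

/-- The energy norm `|||(v,q)|||_h`. -/
def energyNorm (v : E3 → E3) (q : E3 → ℝ) : ℝ :=
  Real.sqrt (T.l2norm (T.pull v) ^ 2 + T.l2norm (T.grad q) ^ 2)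

end Triangulation

/-- Data of the surface Darcy problem on `Γ = ∂Ω`: `f ∈ L²(Γ)` with `∫_Γ f = 0` and a tangential
vector field `g ∈ [L²(Γ)]³`. -/
structure IsDarcyData (Ω : Set E3) (f : E3 → ℝ) (g : E3 → E3) : Prop where
  memLp_f : MemLp f 2 (surfaceMeasure Ω)
  integral_f : ∫ x, f x ∂(surfaceMeasure Ω) = 0
  memLp_g : MemLp g 2 (surfaceMeasure Ω)
  tangential_g : ∀ᵐ x ∂(surfaceMeasure Ω), inner ℝ (normal Ω x) (g x) = 0

end SurfaceDarcy

end

open SurfaceDarcy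

/-!
Stability of the stabilized finite element method for the surface Darcy problem.

*Energy estimate.* Testing with the discrete solution itself, the bilinear form reduces to
`(‖u‖² + ‖∇p‖²) / 2`, and the right hand side is bounded by the Cauchy-Schwarz inequality, once
`‖p‖ ≤ C ‖∇p‖` is known for discrete pressures of mean zero, with `C` independent of the mesh
(`exists_l2norm_le_l2norm_grad`). This discrete Poincaré inequality is obtained by transport to `Γ`.
The patches `p ∘ F_K` of the exact surface stretch all distances by the factor `h`, up to constants
(`IsFine.lipschitzOnWith_lift`, `IsFine.locally_antilipschitz_lift`), because the closest point
mapping displaces points along the normal by `O(h²)` only and the elements are nearly tangential.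
The Hausdorff measure of `Γ` is therefore comparable with the sum of the images of the area of the
reference triangle, and `p`, transported to `Γ`, is piecewise Lipschitz with upper gradient
comparable to `|∇p|`. The Poincaré inequality for such functions on the compact connected surface
`Γ` (`poincareOn_frontier`) follows from the one on squares: chart domains are joined by chains in
which consecutive ones overlap in positive measure.

*Normal component.* Testing with a vanishing pressure shows that the residual `u + ∇p - gᵉ` is
orthogonal to all discrete velocities. The field `χ n`, with `χ` a finite element function close to
`n · u`, is within `O(h) ‖χ‖` of a discrete velocity. As `gᵉ` is orthogonal to `n` and `∇p` is so up
to `O(h)`, this gives `‖χ‖ = O(h)`. Both approximations come from the superapproximation property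
`exists_superapproximation`: multiplying the Bernstein coefficient with exponent `m` of a finite
element function by `(∑ mᵢ aᵢ) / k`, with `aᵢ` the vertex values of `a`, approximates the product
with `a` up to the oscillation of `a` on the element. The result is continuous across edges since it
is, up to the factor `k`, the derivative of the function along a scaling of the barycentric
coordinates by factors that belong to the vertices (`bernsteinForm_weighted_eq`).
-/

namespace SurfaceDarcy

open Filter Topology
open scoped NNReal ENNReal RealInnerProductSpace

/-! ### The signed distance function near the surface -/

section Surface

variable {Ω : Set E3}

lemma subset_or_disjoint_of_isPreconnected (hΩ : IsOpen Ω) {S : Set E3} (hS : IsPreconnected S)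
    (hd : Disjoint S (frontier Ω)) : S ⊆ Ω ∨ Disjoint S Ω := by
  have hcov : S ⊆ Ω ∪ (closure Ω)ᶜ := by
    intro x hx
    by_cases hxΩ : x ∈ Ω
    · exact Or.inl hxΩ
    · refine Or.inr fun hxc => disjoint_left.1 hd hx ?_
      rw [hΩ.frontier_eq]
      exact ⟨hxc, hxΩ⟩
  have hdisj : Disjoint Ω (closure Ω)ᶜ :=
    disjoint_left.2 fun x hx hx' => hx' (subset_closure hx)
  rcases hS.subset_or_subset hΩ isClosed_closure.isOpen_compl hdisj hcov with h | h
  · exact Or.inl h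
  · exact Or.inr (disjoint_left.2 fun x hx hx' => h hx (subset_closure hx'))

lemma exists_mem_segment_frontier (hΩ : IsOpen Ω) {a b : E3} (ha : a ∈ Ω) (hb : b ∉ Ω) :
    ∃ z ∈ segment ℝ a b, z ∈ frontier Ω := by
  by_contra! h
  rcases subset_or_disjoint_of_isPreconnected hΩ (convex_segment a b).isPreconnected
    (disjoint_left.2 h) with h' | h'
  · exact hb (h' (right_mem_segment ℝ a b))
  · exact disjoint_left.1 h' (left_mem_segment ℝ a b) ha

lemma abs_rho (x : E3) : |rho Ω x| = Metric.infDist x (frontier Ω) := by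
  unfold rho
  split_ifs <;> simp [abs_of_nonneg Metric.infDist_nonneg]

lemma rho_of_mem {x : E3} (hx : x ∈ Ω) : rho Ω x = -Metric.infDist x (frontier Ω) := by
  simp [rho, hx]

lemma rho_of_notMem {x : E3} (hx : x ∉ Ω) : rho Ω x = Metric.infDist x (frontier Ω) := by
  simp [rho, hx]

lemma rho_of_mem_frontier {x : E3} (hx : x ∈ frontier Ω) : rho Ω x = 0 := by
  rw [← abs_eq_zero, abs_rho, Metric.infDist_zero_of_mem hx]

/-- A segment from `Ω` to its complement crosses the surface. -/
lemma infDist_add_infDist_le (hΩ : IsOpen Ω) {a b : E3} (ha : a ∈ Ω) (hb : b ∉ Ω) :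
    Metric.infDist a (frontier Ω) + Metric.infDist b (frontier Ω) ≤ ‖a - b‖ := by
  obtain ⟨z, hz, hzf⟩ := exists_mem_segment_frontier hΩ ha hb
  have h1 := dist_add_dist_of_mem_segment hz
  have h2 := Metric.infDist_le_dist_of_mem (x := a) hzf
  have h3 := Metric.infDist_le_dist_of_mem (x := b) hzf
  rw [dist_comm b z] at h3
  rw [← dist_eq_norm]
  linarith

/-- The signed distance is Lipschitz with constant one, also across the surface. -/
lemma abs_rho_sub_le (hΩ : IsOpen Ω) (a b : E3) : |rho Ω a - rho Ω b| ≤ ‖a - b‖ := by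
  have key : ∀ a b : E3, |Metric.infDist a (frontier Ω) - Metric.infDist b (frontier Ω)|
      ≤ ‖a - b‖ := by
    intro a b
    rw [← dist_eq_norm, ← Real.dist_eq]
    simpa using (Metric.lipschitz_infDist_pt (frontier Ω)).dist_le_mul a b
  by_cases ha : a ∈ Ω <;> by_cases hb : b ∈ Ω
  · rw [rho_of_mem ha, rho_of_mem hb, neg_sub_neg, abs_sub_comm]
    exact key a b
  · rw [rho_of_mem ha, rho_of_notMem hb, ← neg_add', abs_neg,
      abs_of_nonneg (add_nonneg Metric.infDist_nonneg Metric.infDist_nonneg)]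
    exact infDist_add_infDist_le hΩ ha hb
  · rw [rho_of_notMem ha, rho_of_mem hb, sub_neg_eq_add,
      abs_of_nonneg (add_nonneg Metric.infDist_nonneg Metric.infDist_nonneg), add_comm,
      norm_sub_rev]
    exact infDist_add_infDist_le hΩ hb ha
  · rw [rho_of_notMem ha, rho_of_notMem hb]
    exact key a b

lemma BoundsSmoothSurface.isCompact_frontier (hΩ : BoundsSmoothSurface Ω) :
    IsCompact (frontier Ω) :=
  Metric.isCompact_of_isClosed_isBounded isClosed_frontier
    (hΩ.isBounded.closure.subset frontier_subset_closure)

/-- `φ` is a local defining function of `Ω` in the ball of radius `r` about `x`, and is there up to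
a relative error `ε` the linear function with gradient `ν`. -/
structure IsDefiningOn (Ω : Set E3) (x : E3) (φ : E3 → ℝ) (ν : E3) (ε r : ℝ) : Prop where
  pos : 0 < r
  mem_iff : ∀ y ∈ Metric.ball x r, (y ∈ Ω ↔ φ y < 0)
  abs_sub_le : ∀ y ∈ Metric.ball x r, ∀ z ∈ Metric.ball x r,
    |φ y - φ z - ⟪ν, y - z⟫| ≤ ε * ‖y - z‖
  eq_zero : ∀ y ∈ Metric.ball x r, y ∈ frontier Ω → φ y = 0

lemma exists_isDefiningOn (hΩ : IsOpen Ω) {x : E3} {U : Set E3} (hU : U ∈ 𝓝 x)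
    {φ : E3 → ℝ} (hφ : ContDiff ℝ (⊤ : ℕ∞) φ) (hx : gradient φ x ≠ 0)
    (hiff : ∀ y ∈ U, (y ∈ Ω ↔ φ y < 0)) {ε : ℝ} (hε : 0 < ε) :
    ∃ r, IsDefiningOn Ω x (fun y => ‖gradient φ x‖⁻¹ * φ y)
      (‖gradient φ x‖⁻¹ • gradient φ x) ε r := by
  set w := gradient φ x with hw
  have hm : 0 < ‖w‖ := norm_pos_iff.2 hx
  have hs : HasStrictFDerivAt φ (fderiv ℝ φ x) x := hφ.hasStrictFDerivAt (by simp)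
  have hlin : ∀ v, fderiv ℝ φ x v = ⟪w, v⟫ := by
    intro v
    rw [hw, gradient, InnerProductSpace.toDual_symm_apply]
  have hb := hs.isLittleO.bound (mul_pos hε hm)
  rw [nhds_prod_eq] at hb
  obtain ⟨t, ht, hb⟩ := mem_prod_same_iff.1 hb
  obtain ⟨r, hr, hrt⟩ := Metric.mem_nhds_iff.1 (inter_mem ht hU)
  refine ⟨r, hr, fun y hy => ?_, fun y hy z hz => ?_, fun y hy hyf => ?_⟩
  · rw [hiff y (hrt hy).2]
    simp [mul_neg_iff, hm, hm.not_gt]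
  · have : ‖φ y - φ z - fderiv ℝ φ x (y - z)‖ ≤ ε * ‖w‖ * ‖y - z‖ :=
      hb (mk_mem_prod (hrt hy).1 (hrt hz).1)
    rw [hlin, Real.norm_eq_abs] at this
    rw [real_inner_smul_left, ← mul_sub, ← mul_sub, abs_mul, abs_of_pos (inv_pos.2 hm)]
    calc ‖w‖⁻¹ * |φ y - φ z - ⟪w, y - z⟫| ≤ ‖w‖⁻¹ * (ε * ‖w‖ * ‖y - z‖) := by gcongr
      _ = ε * ‖y - z‖ := by field_simp
  · have hyU := (hrt hy).2
    have h1 : 0 ≤ φ y := by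
      by_contra! h
      have : y ∈ Ω := (hiff y hyU).2 h
      rw [hΩ.frontier_eq] at hyf
      exact hyf.2 this
    have h2 : φ y ≤ 0 := by
      by_contra! h
      have hev : ∀ᶠ z in 𝓝 y, 0 < φ z ∧ z ∈ U :=
        (hφ.continuous.continuousAt.eventually_const_lt h).and
          (mem_of_superset (Metric.isOpen_ball.mem_nhds hy) fun z hz => (hrt hz).2)
      have hcl : y ∈ closure Ω := frontier_subset_closure hyf
      obtain ⟨z, hz, hzΩ⟩ := mem_closure_iff_nhds.1 hcl _ hev
      exact absurd ((hiff z hz.2).1 hzΩ) hz.1.not_gt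
    rw [le_antisymm h2 h1, mul_zero]

/-- A defining function measures the signed distance up to first order: the closest point of `Γ`
bounds `φ` by the distance, and the distance is bounded by crossing `Γ` in direction `±ν`. -/
lemma IsDefiningOn.abs_rho_sub_le (hΩ : IsOpen Ω) {x : E3} (hx : x ∈ frontier Ω)
    (hc : IsCompact (frontier Ω)) {φ : E3 → ℝ} {ν : E3} (hν : ‖ν‖ = 1) {ε r : ℝ} (hε : 0 < ε)
    (hε' : ε ≤ 1 / 4) (H : IsDefiningOn Ω x φ ν ε r) {y : E3} (hy : ‖y - x‖ < r / 8) :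
    |rho Ω y - ⟪ν, y - x⟫| ≤ 8 * ε * ‖y - x‖ := by
  rcases eq_or_ne y x with rfl | hne
  · simp [rho_of_mem_frontier hx]
  set d := ‖y - x‖ with hd
  have hd0 : 0 < d := norm_pos_iff.2 (sub_ne_zero.2 hne)
  have hr := H.pos
  have hball : ∀ z : E3, ‖z - y‖ < 7 * d → z ∈ Metric.ball x r := by
    intro z hz
    rw [mem_ball_iff_norm]
    calc ‖z - x‖ ≤ ‖z - y‖ + ‖y - x‖ := norm_sub_le_norm_sub_add_norm_sub _ _ _
      _ < r := by linarith
  have hyb : y ∈ Metric.ball x r := hball y (by simpa using by linarith)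
  have hxb : x ∈ Metric.ball x r := Metric.mem_ball_self hr
  have hin : |⟪ν, y - x⟫| ≤ d := by
    simpa [hν] using abs_real_inner_le_norm ν (y - x)
  have h0 := H.abs_sub_le y hyb x hxb
  rw [H.eq_zero x hxb hx, sub_zero] at h0
  have hφd : |φ y| ≤ 2 * d := by
    rw [abs_le] at *
    constructor <;> nlinarith
  -- the closest point
  obtain ⟨z, hz, hzd⟩ := hc.exists_infDist_eq_dist ⟨x, hx⟩ y
  have hzle : Metric.infDist y (frontier Ω) ≤ d := by
    rw [hd, ← dist_eq_norm]; exact Metric.infDist_le_dist_of_mem hx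
  have hzy : ‖z - y‖ = Metric.infDist y (frontier Ω) := by
    rw [hzd, dist_comm, dist_eq_norm]
  have hlow : |φ y| ≤ Metric.infDist y (frontier Ω) + ε * d := by
    have hzb : z ∈ Metric.ball x r := hball z (by linarith)
    have h1 := H.abs_sub_le y hyb z hzb
    rw [H.eq_zero z hzb hz, sub_zero] at h1
    have h2 : |⟪ν, y - z⟫| ≤ ‖y - z‖ := by simpa [hν] using abs_real_inner_le_norm ν (y - z)
    rw [norm_sub_rev, hzy] at h1 h2
    have : ε * Metric.infDist y (frontier Ω) ≤ ε * d := by gcongr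
    rw [abs_le] at *
    constructor <;> linarith
  -- crossing the surface
  set τ := |φ y| + 5 * ε * d with hτ
  have hτ0 : 0 ≤ τ := by positivity
  have hτ4 : τ < 7 * d := by nlinarith
  have hτε : ε * τ < 5 * ε * d := by
    have : τ < 5 * d := by nlinarith
    nlinarith
  have hcross : ∀ s : ℝ, |s| = τ → |φ (y + s • ν) - φ y - s| ≤ ε * τ ∧ ‖y - (y + s • ν)‖ = τ := by
    intro s hs
    have hn : ‖(y + s • ν) - y‖ = τ := by simp [norm_smul, hν, hs]
    have h1 := H.abs_sub_le _ (hball (y + s • ν) (by rw [hn]; exact hτ4)) y hyb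
    rw [hn] at h1
    refine ⟨?_, by rw [norm_sub_rev, hn]⟩
    simpa [real_inner_smul_right, real_inner_self_eq_norm_sq, hν] using h1
  have hmain : |rho Ω y - φ y| ≤ 5 * ε * d := by
    by_cases hyΩ : y ∈ Ω
    · have hneg : φ y < 0 := (H.mem_iff y hyb).1 hyΩ
      obtain ⟨h1, h2⟩ := hcross τ (abs_of_nonneg hτ0)
      have hnot : y + τ • ν ∉ Ω := by
        rw [H.mem_iff _ (hball _ (by rw [norm_sub_rev, h2]; exact hτ4)), not_lt]
        rw [abs_of_neg hneg] at hτ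
        linarith [(abs_le.1 h1).1]
      have h3 := infDist_add_infDist_le hΩ hyΩ hnot
      have h4 : 0 ≤ Metric.infDist (y + τ • ν) (frontier Ω) := Metric.infDist_nonneg
      rw [abs_of_neg hneg] at hτ hlow
      rw [rho_of_mem hyΩ, abs_le]
      have := mul_pos hε hd0
      constructor <;> linarith
    · have hpos : 0 ≤ φ y := by
        by_contra! h
        exact hyΩ ((H.mem_iff y hyb).2 h)
      obtain ⟨h1, h2⟩ := hcross (-τ) (by rw [abs_neg, abs_of_nonneg hτ0])
      have hin : y + (-τ) • ν ∈ Ω := by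
        rw [H.mem_iff _ (hball _ (by rw [norm_sub_rev, h2]; exact hτ4))]
        rw [abs_of_nonneg hpos] at hτ
        linarith [(abs_le.1 h1).2]
      have h3 := infDist_add_infDist_le hΩ hin hyΩ
      rw [norm_sub_rev, h2] at h3
      have h4 : 0 ≤ Metric.infDist (y + (-τ) • ν) (frontier Ω) := Metric.infDist_nonneg
      rw [abs_of_nonneg hpos] at hτ hlow
      rw [rho_of_notMem hyΩ, abs_le]
      have := mul_pos hε hd0
      constructor <;> linarith
  have := mul_pos hε hd0
  rw [abs_le] at *
  constructor <;> linarith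

lemma hasGradientAt_rho (hΩ : BoundsSmoothSurface Ω) {x : E3} (hx : x ∈ frontier Ω) {U : Set E3}
    (hU : U ∈ 𝓝 x) {φ : E3 → ℝ} (hφ : ContDiff ℝ (⊤ : ℕ∞) φ) (hg : gradient φ x ≠ 0)
    (hiff : ∀ y ∈ U, (y ∈ Ω ↔ φ y < 0)) :
    HasGradientAt (rho Ω) (‖gradient φ x‖⁻¹ • gradient φ x) x := by
  rw [hasGradientAt_iff_hasFDerivAt, hasFDerivAt_iff_isLittleO, Asymptotics.isLittleO_iff]
  intro η hη
  set ε := min (η / 8) (1 / 4) with hε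
  have hε0 : 0 < ε := lt_min (by positivity) (by norm_num)
  obtain ⟨r, H⟩ := exists_isDefiningOn hΩ.isOpen hU hφ hg hiff hε0
  have hr := H.pos
  filter_upwards [Metric.ball_mem_nhds x (show (0 : ℝ) < r / 8 by positivity)] with y hy
  rw [mem_ball_iff_norm] at hy
  have := H.abs_rho_sub_le hΩ.isOpen hx hΩ.isCompact_frontier
    (by rw [norm_smul, norm_inv, norm_norm, inv_mul_cancel₀ (norm_ne_zero_iff.2 hg)])
    hε0 (min_le_right _ _) hy
  rw [rho_of_mem_frontier hx, sub_zero, InnerProductSpace.toDual_apply_apply, Real.norm_eq_abs]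
  refine this.trans ?_
  gcongr
  linarith [min_le_left (η / 8) (1 / 4 : ℝ)]

lemma normal_eq (hΩ : BoundsSmoothSurface Ω) {x : E3} (hx : x ∈ frontier Ω) {U : Set E3}
    (hU : U ∈ 𝓝 x) {φ : E3 → ℝ} (hφ : ContDiff ℝ (⊤ : ℕ∞) φ) (hg : gradient φ x ≠ 0)
    (hiff : ∀ y ∈ U, (y ∈ Ω ↔ φ y < 0)) :
    normal Ω x = ‖gradient φ x‖⁻¹ • gradient φ x :=
  (hasGradientAt_rho hΩ hx hU hφ hg hiff).gradient

lemma hasGradientAt_rho_normal (hΩ : BoundsSmoothSurface Ω) {x : E3} (hx : x ∈ frontier Ω) :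
    HasGradientAt (rho Ω) (normal Ω x) x := by
  obtain ⟨U, hU, φ, hφ, hg, hiff⟩ := hΩ.smooth x hx
  have := hasGradientAt_rho hΩ hx hU hφ hg hiff
  rwa [normal, this.gradient]

lemma norm_normal (hΩ : BoundsSmoothSurface Ω) {x : E3} (hx : x ∈ frontier Ω) :
    ‖normal Ω x‖ = 1 := by
  obtain ⟨U, hU, φ, hφ, hg, hiff⟩ := hΩ.smooth x hx
  rw [normal_eq hΩ hx hU hφ hg hiff, norm_smul, norm_inv, norm_norm,
    inv_mul_cancel₀ (norm_ne_zero_iff.2 hg)]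

lemma exists_isDefiningOn_normal (hΩ : BoundsSmoothSurface Ω) {x : E3} (hx : x ∈ frontier Ω)
    {ε : ℝ} (hε : 0 < ε) : ∃ φ : E3 → ℝ, ∃ r, IsDefiningOn Ω x φ (normal Ω x) ε r := by
  obtain ⟨U, hU, φ, hφ, hg, hiff⟩ := hΩ.smooth x hx
  rw [normal_eq hΩ hx hU hφ hg hiff]
  exact ⟨_, exists_isDefiningOn hΩ.isOpen hU hφ hg hiff hε⟩

/-- The normal field is Lipschitz on the compact surface, being locally `∇φ / |∇φ|`. -/
lemma exists_lipschitzOnWith_normal (hΩ : BoundsSmoothSurface Ω) :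
    ∃ L : ℝ≥0, LipschitzOnWith L (normal Ω) (frontier Ω) := by
  refine LocallyLipschitzOn.exists_lipschitzOnWith_of_compact hΩ.isCompact_frontier ?_
  intro x hx
  obtain ⟨U, hU, φ, hφ, hg, hiff⟩ := hΩ.smooth x hx
  have hgrad : ContDiff ℝ 1 (gradient φ) := by
    have h1 : ContDiff ℝ 1 (fderiv ℝ φ) := hφ.fderiv_right (m := 1) (by norm_cast)
    exact (InnerProductSpace.toDual ℝ E3).symm.toContinuousLinearEquiv.contDiff.comp h1
  have hN : ContDiffAt ℝ 1 (fun z => ‖gradient φ z‖⁻¹ • gradient φ z) x :=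
    ((hgrad.contDiffAt.norm ℝ hg).inv (norm_ne_zero_iff.2 hg)).smul hgrad.contDiffAt
  obtain ⟨K, t, ht, hK⟩ := hN.exists_lipschitzOnWith
  have hne : ∀ᶠ z in 𝓝 x, gradient φ z ≠ 0 :=
    hgrad.continuous.continuousAt.eventually_ne hg
  obtain ⟨V, hVU, hVo, hxV⟩ := mem_nhds_iff.1 hU
  refine ⟨K, t ∩ {z | gradient φ z ≠ 0} ∩ V ∩ frontier Ω, ?_, ?_⟩
  · exact inter_mem (mem_nhdsWithin_of_mem_nhds
      (inter_mem (inter_mem ht hne) (hVo.mem_nhds hxV))) self_mem_nhdsWithin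
  · intro y hy z hz
    have : ∀ y ∈ t ∩ {z | gradient φ z ≠ 0} ∩ V ∩ frontier Ω,
        normal Ω y = ‖gradient φ y‖⁻¹ • gradient φ y := fun y hy =>
      normal_eq hΩ hy.2 (mem_of_superset (hVo.mem_nhds hy.1.2) hVU) hφ hy.1.1.2 hiff
    rw [this y hy, this z hz]
    exact hK hy.1.1.1 hz.1.1.1

/-- The surface is almost flat near each point. -/
lemma exists_abs_inner_normal_sub_le (hΩ : BoundsSmoothSurface Ω) {x : E3} (hx : x ∈ frontier Ω)
    {ε : ℝ} (hε : 0 < ε) : ∃ r > 0, ∀ y ∈ frontier Ω ∩ Metric.ball x r,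
      ∀ z ∈ frontier Ω ∩ Metric.ball x r, |⟪normal Ω x, y - z⟫| ≤ ε * ‖y - z‖ := by
  obtain ⟨φ, r, H⟩ := exists_isDefiningOn_normal hΩ hx hε
  refine ⟨r, H.pos, fun y hy z hz => ?_⟩
  have := H.abs_sub_le y hy.2 z hz.2
  rwa [H.eq_zero y hy.2 hy.1, H.eq_zero z hz.2 hz.1, sub_zero, zero_sub, abs_neg] at this

/-- Every line normal to the tangent plane at `x` meets the surface near `x`. -/
lemma exists_add_smul_normal_mem (hΩ : BoundsSmoothSurface Ω) {x : E3} (hx : x ∈ frontier Ω) :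
    ∃ r > 0, ∀ a, 0 < a → a < r → ∀ v : E3, ⟪normal Ω x, v⟫ = 0 → ‖v‖ ≤ a →
      ∃ s : ℝ, |s| ≤ a ∧ x + v + s • normal Ω x ∈ frontier Ω := by
  obtain ⟨φ, r, H⟩ := exists_isDefiningOn_normal hΩ hx (show (0 : ℝ) < 1 / 4 by norm_num)
  have hr := H.pos
  refine ⟨r / 3, by positivity, fun a ha har v hv hva => ?_⟩
  set n := normal Ω x with hn
  have hn1 : ‖n‖ = 1 := norm_normal hΩ hx
  have hb : ∀ s : ℝ, |s| = a → x + v + s • n ∈ Metric.ball x r ∧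
      |φ (x + v + s • n) - s| ≤ 1 / 4 * (2 * a) := by
    intro s hs
    have h1 : ‖x + v + s • n - x‖ ≤ 2 * a := by
      have : x + v + s • n - x = v + s • n := by abel
      rw [this]
      refine (norm_add_le _ _).trans ?_
      rw [norm_smul, hn1, Real.norm_eq_abs, hs]
      linarith
    have h2 : x + v + s • n ∈ Metric.ball x r := by
      rw [mem_ball_iff_norm]; linarith
    refine ⟨h2, ?_⟩
    have h3 := H.abs_sub_le _ h2 x (Metric.mem_ball_self hr)
    have h4 : ⟪n, x + v + s • n - x⟫ = s := by
      have : x + v + s • n - x = v + s • n := by abel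
      rw [this, inner_add_right, hv, real_inner_smul_right, real_inner_self_eq_norm_sq, hn1]
      ring
    rw [H.eq_zero x (Metric.mem_ball_self hr) hx, sub_zero, h4] at h3
    exact h3.trans (by gcongr)
  have hin : x + v + (-a) • n ∈ Ω := by
    obtain ⟨h1, h2⟩ := hb (-a) (by rw [abs_neg, abs_of_pos ha])
    rw [H.mem_iff _ h1]
    linarith [(abs_le.1 h2).2]
  have hout : x + v + a • n ∉ Ω := by
    obtain ⟨h1, h2⟩ := hb a (abs_of_pos ha)
    rw [H.mem_iff _ h1, not_lt]
    linarith [(abs_le.1 h2).1]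
  obtain ⟨z, hz, hzf⟩ := exists_mem_segment_frontier hΩ.isOpen hin hout
  rw [segment_eq_image] at hz
  obtain ⟨θ, hθ, rfl⟩ := hz
  refine ⟨(2 * θ - 1) * a, ?_, ?_⟩
  · rw [abs_mul, abs_of_pos ha]
    have : |2 * θ - 1| ≤ 1 := abs_le.2 ⟨by linarith [hθ.1], by linarith [hθ.2]⟩
    nlinarith
  · convert hzf using 1
    module

/-! ### The closest point mapping -/

lemma isClosestPoint_closestPoint {δ₀ : ℝ}
    (htube : ∀ x ∈ tube Ω δ₀, ∃! y, IsClosestPoint (frontier Ω) x y) {x : E3}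
    (hx : x ∈ tube Ω δ₀) : IsClosestPoint (frontier Ω) x (closestPoint (frontier Ω) x) :=
  Classical.epsilon_spec (htube x hx).exists

/-- The vector from the closest point `y` to `x` is `ρ(x) n(y)`: along the segment from `y` to `x`
the signed distance grows linearly, so its derivative `n(y) · (x - y)` at `y` is `ρ(x)`, which is
up to sign the length of `x - y`. -/
lemma IsClosestPoint.sub_eq (hΩ : BoundsSmoothSurface Ω) {x y : E3}
    (h : IsClosestPoint (frontier Ω) x y) : x - y = rho Ω x • normal Ω y := by
  obtain ⟨hy, hd⟩ := h
  set v := x - y with hv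
  have hvd : ‖v‖ = Metric.infDist x (frontier Ω) := by rw [hv, ← dist_eq_norm, hd]
  rcases eq_or_ne v 0 with h0 | h0
  · rw [h0, norm_zero] at hvd
    have : rho Ω x = 0 := by rw [← abs_eq_zero, abs_rho, ← hvd]
    rw [h0, this, zero_smul]
  have hvpos : 0 < ‖v‖ := norm_pos_iff.2 h0
  have hinf : ∀ t ∈ Ioc (0 : ℝ) 1, Metric.infDist (y + t • v) (frontier Ω) = t * ‖v‖ := by
    intro t ht
    apply le_antisymm
    · refine (Metric.infDist_le_dist_of_mem hy).trans ?_
      rw [dist_eq_norm, add_sub_cancel_left, norm_smul, Real.norm_of_nonneg ht.1.le]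
    · have h1 := Metric.infDist_le_infDist_add_dist (s := frontier Ω) (x := x) (y := y + t • v)
      have h2 : dist x (y + t • v) = (1 - t) * ‖v‖ := by
        have : x - (y + t • v) = (1 - t) • v := by rw [hv]; module
        rw [dist_eq_norm, this, norm_smul, Real.norm_of_nonneg (by linarith [ht.2])]
      rw [← hvd, h2] at h1
      linarith
  have hrho : ∀ t ∈ Ioc (0 : ℝ) 1, rho Ω (y + t • v) = t * rho Ω x := by
    have hpre : IsPreconnected ((fun t : ℝ => y + t • v) '' Ioc 0 1) :=
      isPreconnected_Ioc.image _ (by fun_prop)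
    have hdisj : Disjoint ((fun t : ℝ => y + t • v) '' Ioc 0 1) (frontier Ω) := by
      rw [disjoint_left]
      rintro _ ⟨t, ht, rfl⟩ hf
      have := hinf t ht
      rw [Metric.infDist_zero_of_mem hf] at this
      exact (mul_pos ht.1 hvpos).ne this
    have hx1 : x = y + (1 : ℝ) • v := by rw [hv]; module
    have h1 : (1 : ℝ) ∈ Ioc (0 : ℝ) 1 := by simp
    intro t ht
    rcases subset_or_disjoint_of_isPreconnected hΩ.isOpen hpre hdisj with hs | hs
    · rw [rho_of_mem (hs ⟨t, ht, rfl⟩), hx1, rho_of_mem (hs ⟨1, h1, rfl⟩), hinf t ht, hinf 1 h1]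
      ring
    · rw [disjoint_left] at hs
      rw [rho_of_notMem (hs ⟨t, ht, rfl⟩), hx1, rho_of_notMem (hs ⟨1, h1, rfl⟩), hinf t ht,
        hinf 1 h1]
      ring
  have hder : HasDerivAt (fun t : ℝ => rho Ω (y + t • v)) ⟪normal Ω y, v⟫ 0 := by
    have h1 : HasFDerivAt (rho Ω) (InnerProductSpace.toDual ℝ E3 (normal Ω y))
        (y + (0 : ℝ) • v) := by
      simpa using (hasGradientAt_rho_normal hΩ hy).hasFDerivAt
    have h2 : HasDerivAt (fun t : ℝ => y + t • v) v 0 := by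
      simpa using ((hasDerivAt_id (0 : ℝ)).smul_const v).const_add y
    have h3 := h1.comp_hasDerivAt 0 h2
    rw [InnerProductSpace.toDual_apply_apply] at h3
    exact h3
  have hval : ⟪normal Ω y, v⟫ = rho Ω x := by
    have h1 : HasDerivWithinAt (fun t : ℝ => rho Ω (y + t • v)) ⟪normal Ω y, v⟫ (Icc 0 1) 0 :=
      hder.hasDerivWithinAt
    have h2 : HasDerivWithinAt (fun t : ℝ => rho Ω (y + t • v)) (rho Ω x) (Icc 0 1) 0 := by
      have h3 : HasDerivWithinAt (fun t : ℝ => t * rho Ω x) (rho Ω x) (Icc 0 1) 0 := by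
        simpa using ((hasDerivAt_id (0 : ℝ)).mul_const (rho Ω x)).hasDerivWithinAt
      refine h3.congr (fun t ht => ?_) ?_
      · rcases ht.1.eq_or_lt with rfl | h0
        · simp [rho_of_mem_frontier hy]
        · exact hrho t ⟨h0, ht.2⟩
      · simp [rho_of_mem_frontier hy]
    exact UniqueDiffWithinAt.eq_deriv _
      (uniqueDiffOn_Icc (zero_lt_one' ℝ) 0 (by simp)) h1 h2
  have hn1 := norm_normal hΩ hy
  -- `|v - ρ n|² = |v|² - 2 ρ (n · v) + ρ² = 0`
  have hz : ‖v - rho Ω x • normal Ω y‖ ^ 2 = 0 := by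
    rw [norm_sub_sq_real, real_inner_smul_right, real_inner_comm, hval, norm_smul, hn1, hvd,
      ← abs_rho, Real.norm_eq_abs]
    simp only [mul_one, sq_abs]
    ring
  exact sub_eq_zero.1 (norm_eq_zero.1 (pow_eq_zero_iff two_ne_zero |>.1 hz))

end Surface

/-! ### Comparison of surface measures under Lipschitz parametrizations -/

section Measure

/-- The factor between the normalized and the unnormalized two-dimensional Hausdorff measure. -/
noncomputable def areaFactor : ℝ≥0 := Measure.addHaarScalarFactor (volume : Measure E2) μH[(2 : ℕ)]

lemma areaFactor_ne_zero : areaFactor ≠ 0 :=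
  Measure.addHaarScalarFactor_volume_hausdorffMeasure_ne_zero 2

lemma euclideanHausdorffMeasure_two_apply {X : Type*} [MetricSpace X] [MeasurableSpace X]
    [BorelSpace X] (s : Set X) :
    (Measure.euclideanHausdorffMeasure 2 : Measure X) s = areaFactor * μH[2] s := by
  rw [Measure.euclideanHausdorffMeasure_def, Measure.smul_apply, ENNReal.smul_def, smul_eq_mul]
  norm_num [areaFactor]

lemma volume_E2_eq (s : Set E2) : volume s = areaFactor * μH[2] s := by
  rw [← euclideanHausdorffMeasure_two_apply, EuclideanSpace.euclideanHausdorffMeasure_eq_volume]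

variable {X : Type*} [MetricSpace X] [MeasurableSpace X] [BorelSpace X]

lemma euclideanHausdorffMeasure_image_le {f : X → E3} {s : Set X} {K : ℝ≥0}
    (hf : LipschitzOnWith K f s) :
    (Measure.euclideanHausdorffMeasure 2 : Measure E3) (f '' s)
      ≤ K ^ 2 * (areaFactor * μH[2] s) := by
  rw [euclideanHausdorffMeasure_two_apply]
  calc (areaFactor : ℝ≥0∞) * μH[2] (f '' s) ≤ areaFactor * ((K : ℝ≥0∞) ^ (2 : ℝ) * μH[2] s) := by
        gcongr
        exact hf.hausdorffMeasure_image_le (by norm_num)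
    _ = _ := by
        rw [ENNReal.rpow_ofNat]
        ring

lemma le_euclideanHausdorffMeasure_image {f : X → E3} {s : Set X} {K : ℝ≥0}
    (hf : ∀ x ∈ s, ∀ y ∈ s, dist x y ≤ K * dist (f x) (f y)) :
    areaFactor * μH[2] s ≤
      K ^ 2 * (Measure.euclideanHausdorffMeasure 2 : Measure E3) (f '' s) := by
  rcases s.eq_empty_or_nonempty with rfl | ⟨x₀, hx₀⟩
  · simp
  have : Nonempty X := ⟨x₀⟩
  have hinj : InjOn f s := by
    intro x hx y hy hxy
    have := hf x hx y hy
    rw [hxy, dist_self, mul_zero] at this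
    exact dist_le_zero.1 this
  have hleft := hinj.leftInvOn_invFunOn
  have hlip : LipschitzOnWith K (Function.invFunOn f s) (f '' s) := by
    refine LipschitzOnWith.of_dist_le_mul ?_
    rintro _ ⟨x, hx, rfl⟩ _ ⟨y, hy, rfl⟩
    rw [hleft hx, hleft hy]
    exact hf x hx y hy
  have h1 := hlip.hausdorffMeasure_image_le (d := 2) (by norm_num)
  rw [hleft.image_image] at h1
  rw [euclideanHausdorffMeasure_two_apply]
  calc (areaFactor : ℝ≥0∞) * μH[2] s
      ≤ areaFactor * ((K : ℝ≥0∞) ^ (2 : ℝ) * μH[2] (f '' s)) := by gcongr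
    _ = _ := by
        rw [ENNReal.rpow_ofNat]
        ring

end Measure

/-! ### Charts -/

section Charts

variable {Ω : Set E3}

/-- The square `[-a, a]²`. -/
def square (a : ℝ) : Set (ℝ × ℝ) := Icc (-a) a ×ˢ Icc (-a) a

/-- `ψ`, restricted to the square `[-a, a]²`, is a bi-Lipschitz parametrization of a neighbourhood
of `x` in `Γ`. Outside the square, `ψ` is extended to a Lipschitz map with values in `Γ`. -/
structure IsChart (Ω : Set E3) (x : E3) (ψ : ℝ × ℝ → E3) (a : ℝ) : Prop where
  pos : 0 < a
  lipschitz : LipschitzWith 2 ψ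
  mem : ∀ z, ψ z ∈ frontier Ω
  dist_le : ∀ z ∈ square a, ∀ z' ∈ square a, dist z z' ≤ dist (ψ z) (ψ z')
  image_mem : ψ '' square a ∈ 𝓝[frontier Ω] x
  map_zero : ψ 0 = x

/-- The surface is a graph over a square in its tangent plane: flatness makes the projection to the
tangent plane injective with Lipschitz inverse, and every normal line meets the surface. -/
lemma exists_isChart (hΩ : BoundsSmoothSurface Ω) {x : E3} (hx : x ∈ frontier Ω) :
    ∃ ψ a, IsChart Ω x ψ a := by
  set n := normal Ω x with hn
  have hn1 : ‖n‖ = 1 := norm_normal hΩ hx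
  obtain ⟨r₁, hr₁, hflat⟩ := exists_abs_inner_normal_sub_le hΩ hx (show (0 : ℝ) < 1 / 2 by norm_num)
  obtain ⟨r₂, hr₂, hline⟩ := exists_add_smul_normal_mem hΩ hx
  obtain ⟨b, hb⟩ : ∃ b : OrthonormalBasis (Fin 3) ℝ E3, b 2 = n := by
    have hv : Orthonormal ℝ (({2} : Set (Fin 3)).domRestrict fun _ => n) := by
      constructor
      · intro i; simpa using hn1
      · intro i j hij
        exact absurd (Subsingleton.elim i j) hij
    obtain ⟨b, hb⟩ := hv.exists_orthonormalBasis_extension_of_card_eq (by simp)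
    exact ⟨b, hb 2 rfl⟩
  have hsq : ∀ d : E3, ‖d‖ ^ 2 = ⟪b 0, d⟫ ^ 2 + ⟪b 1, d⟫ ^ 2 + ⟪n, d⟫ ^ 2 := by
    intro d
    have := b.sum_sq_norm_inner_right d
    simp only [Fin.sum_univ_three, Real.norm_eq_abs, sq_abs, hb] at this
    exact this.symm
  have hbij : ∀ i j, ⟪b i, b j⟫ = if i = j then 1 else 0 :=
    orthonormal_iff_ite.1 b.orthonormal
  set a := min (r₁ / 8) (r₂ / 4) with ha
  have ha0 : 0 < a := lt_min (by positivity) (by positivity)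
  have ha1 : 8 * a ≤ r₁ := by linarith [min_le_left (r₁ / 8) (r₂ / 4)]
  have ha2 : 4 * a ≤ r₂ := by linarith [min_le_right (r₁ / 8) (r₂ / 4)]
  set N := frontier Ω ∩ Metric.ball x r₁ with hN
  have hgraph : ∀ y ∈ N, ∀ y' ∈ N, ∀ D, |⟪b 0, y - y'⟫| ≤ D → |⟪b 1, y - y'⟫| ≤ D →
      ‖y - y'‖ ≤ 2 * D := by
    intro y hy y' hy' D h0 h1
    have h2 := hflat y hy y' hy'
    have h3 := hsq (y - y')
    have hD : 0 ≤ D := (abs_nonneg _).trans h0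
    have e0 := sq_le_sq' (abs_le.1 h0).1 (abs_le.1 h0).2
    have e1 := sq_le_sq' (abs_le.1 h1).1 (abs_le.1 h1).2
    have e2 := sq_le_sq' (abs_le.1 h2).1 (abs_le.1 h2).2
    refine le_of_sq_le_sq ?_ (by positivity)
    nlinarith
  have hex : ∀ z ∈ square a, ∃ y ∈ N, ⟪b 0, y - x⟫ = z.1 ∧ ⟪b 1, y - x⟫ = z.2 := by
    rintro ⟨s, t⟩ ⟨hs, ht⟩
    have hs' : |s| ≤ a := abs_le.2 hs
    have ht' : |t| ≤ a := abs_le.2 ht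
    have hvn : ‖s • b 0 + t • b 1‖ ≤ 2 * a := by
      refine (norm_add_le _ _).trans ?_
      simp only [norm_smul, b.norm_eq_one, Real.norm_eq_abs]
      linarith
    obtain ⟨σ, hσ, hmem⟩ := hline (2 * a) (by positivity) (by linarith) (s • b 0 + t • b 1)
      (by simp [← hn, ← hb, inner_add_right, real_inner_smul_right, hbij]) hvn
    have hsub : x + (s • b 0 + t • b 1) + σ • n - x = s • b 0 + t • b 1 + σ • n := by abel
    refine ⟨_, ⟨hmem, ?_⟩, ?_, ?_⟩
    · rw [mem_ball_iff_norm, hsub]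
      refine (norm_add_le _ _).trans_lt ?_
      rw [norm_smul, hn1, Real.norm_eq_abs]
      linarith
    · rw [hsub]
      simp [← hb, inner_add_right, real_inner_smul_right, hbij]
    · rw [hsub]
      simp [← hb, inner_add_right, real_inner_smul_right, hbij]
  choose! ψ₀ hψN hψ0 hψ1 using hex
  have haa : -a ≤ a := by linarith
  set cl : ℝ × ℝ → ℝ × ℝ := fun z => (projIcc (-a) a haa z.1, projIcc (-a) a haa z.2) with hcl
  have hclmem : ∀ z, cl z ∈ square a := fun z => ⟨(projIcc _ _ haa z.1).2, (projIcc _ _ haa z.2).2⟩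
  have hclid : ∀ z ∈ square a, cl z = z := by
    rintro ⟨s, t⟩ ⟨hs, ht⟩
    simp only [hcl, projIcc_of_mem haa hs, projIcc_of_mem haa ht]
  have hcldist : ∀ z z', dist (cl z) (cl z') ≤ dist z z' := by
    intro z z'
    have hp := LipschitzWith.projIcc haa
    rw [Prod.dist_eq, Prod.dist_eq]
    refine max_le_max ?_ ?_
    · exact (hp.dist_le_mul z.1 z'.1).trans (by simp)
    · exact (hp.dist_le_mul z.2 z'.2).trans (by simp)
  have hdiff : ∀ z ∈ square a, ∀ z' ∈ square a,
      ⟪b 0, ψ₀ z - ψ₀ z'⟫ = z.1 - z'.1 ∧ ⟪b 1, ψ₀ z - ψ₀ z'⟫ = z.2 - z'.2 := by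
    intro z hz z' hz'
    have : ψ₀ z - ψ₀ z' = (ψ₀ z - x) - (ψ₀ z' - x) := by abel
    constructor
    · rw [this, inner_sub_right, hψ0 z hz, hψ0 z' hz']
    · rw [this, inner_sub_right, hψ1 z hz, hψ1 z' hz']
  have hxN : x ∈ N := ⟨hx, Metric.mem_ball_self hr₁⟩
  have huniq : ∀ z ∈ square a, ∀ y ∈ N, ⟪b 0, y - x⟫ = z.1 → ⟪b 1, y - x⟫ = z.2 → ψ₀ z = y := by
    intro z hz y hy h0 h1
    have : ψ₀ z - y = (ψ₀ z - x) - (y - x) := by abel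
    have := hgraph (ψ₀ z) (hψN z hz) y hy 0
      (by rw [this, inner_sub_right, hψ0 z hz, h0, sub_self, abs_zero])
      (by rw [this, inner_sub_right, hψ1 z hz, h1, sub_self, abs_zero])
    rw [mul_zero] at this
    exact sub_eq_zero.1 (norm_le_zero_iff.1 this)
  refine ⟨ψ₀ ∘ cl, a, ha0, ?_, fun z => (hψN _ (hclmem z)).1, ?_, ?_, ?_⟩
  · refine LipschitzWith.of_dist_le_mul fun z z' => ?_
    obtain ⟨h0, h1⟩ := hdiff _ (hclmem z) _ (hclmem z')
    have h2 := hgraph _ (hψN _ (hclmem z)) _ (hψN _ (hclmem z')) (dist (cl z) (cl z'))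
      (by rw [h0, ← Real.dist_eq, Prod.dist_eq]; exact le_max_left _ _)
      (by rw [h1, ← Real.dist_eq, Prod.dist_eq]; exact le_max_right _ _)
    rw [Function.comp_apply, Function.comp_apply, dist_eq_norm]
    refine h2.trans ?_
    have := hcldist z z'
    simpa using this
  · intro z hz z' hz'
    rw [Function.comp_apply, Function.comp_apply, hclid z hz, hclid z' hz']
    obtain ⟨h0, h1⟩ := hdiff z hz z' hz'
    rw [Prod.dist_eq, Real.dist_eq, Real.dist_eq, ← h0, ← h1, dist_eq_norm]
    refine max_le ?_ ?_
    · simpa [b.norm_eq_one] using abs_real_inner_le_norm (b 0) (ψ₀ z - ψ₀ z')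
    · simpa [b.norm_eq_one] using abs_real_inner_le_norm (b 1) (ψ₀ z - ψ₀ z')
  · rw [mem_nhdsWithin_iff_exists_mem_nhds_inter]
    refine ⟨Metric.ball x a, Metric.ball_mem_nhds x ha0, ?_⟩
    rintro y ⟨hy, hyf⟩
    rw [mem_ball_iff_norm] at hy
    have hyN : y ∈ N := ⟨hyf, by rw [mem_ball_iff_norm]; linarith⟩
    have hi : ∀ i, |⟪b i, y - x⟫| ≤ a := fun i =>
      (abs_real_inner_le_norm _ _).trans (by rw [b.norm_eq_one, one_mul]; exact hy.le)
    have hz : (⟪b 0, y - x⟫, ⟪b 1, y - x⟫) ∈ square a := ⟨abs_le.1 (hi 0), abs_le.1 (hi 1)⟩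
    refine ⟨_, hz, ?_⟩
    rw [Function.comp_apply, hclid _ hz]
    exact huniq _ hz y hyN rfl rfl
  · have hz : (0 : ℝ × ℝ) ∈ square a := ⟨by simp [ha0.le], by simp [ha0.le]⟩
    rw [Function.comp_apply, hclid _ hz]
    exact huniq 0 hz x hxN (by simp) (by simp)

namespace IsChart

variable {x : E3} {ψ : ℝ × ℝ → E3} {a : ℝ}

lemma measurableSet_square (a : ℝ) : MeasurableSet (square a) :=
  measurableSet_Icc.prod measurableSet_Icc

lemma surfaceMeasure_restrict_le (H : IsChart Ω x ψ a) :
    (surfaceMeasure Ω).restrict (ψ '' square a) ≤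
      (4 * areaFactor : ℝ≥0∞) • (volume.restrict (square a)).map ψ := by
  refine Measure.le_iff.2 fun A hA => ?_
  have hψ := H.lipschitz.continuous.measurable
  rw [Measure.smul_apply, Measure.map_apply hψ hA, Measure.restrict_apply hA,
    Measure.restrict_apply (hψ hA), smul_eq_mul, ← hausdorffMeasure_prod_real]
  calc surfaceMeasure Ω (A ∩ ψ '' square a)
      ≤ (Measure.euclideanHausdorffMeasure 2 : Measure E3) (A ∩ ψ '' square a) :=
        Measure.restrict_apply_le _ _
    _ = (Measure.euclideanHausdorffMeasure 2 : Measure E3) (ψ '' (ψ ⁻¹' A ∩ square a)) := by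
        rw [image_preimage_inter]
    _ ≤ (2 : ℝ≥0) ^ 2 * (areaFactor * μH[2] (ψ ⁻¹' A ∩ square a)) :=
        euclideanHausdorffMeasure_image_le H.lipschitz.lipschitzOnWith
    _ = _ := by norm_num [mul_assoc]

lemma volume_map_le (H : IsChart Ω x ψ a) :
    (volume.restrict (square a)).map ψ ≤ (areaFactor⁻¹ : ℝ≥0∞) • surfaceMeasure Ω := by
  refine Measure.le_iff.2 fun A hA => ?_
  have hψ := H.lipschitz.continuous.measurable
  rw [Measure.smul_apply, Measure.map_apply hψ hA, Measure.restrict_apply (hψ hA), smul_eq_mul,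
    ← hausdorffMeasure_prod_real]
  have h1 := le_euclideanHausdorffMeasure_image (f := ψ) (s := ψ ⁻¹' A ∩ square a) (K := 1)
    (fun z hz z' hz' => by simpa using H.dist_le z hz.2 z' hz'.2)
  have h2 : (Measure.euclideanHausdorffMeasure 2 : Measure E3) (ψ '' (ψ ⁻¹' A ∩ square a)) ≤
      surfaceMeasure Ω A := by
    rw [surfaceMeasure, Measure.restrict_apply hA]
    refine measure_mono ?_
    rintro _ ⟨z, hz, rfl⟩
    exact ⟨hz.1, H.mem z⟩
  have h0 : (areaFactor : ℝ≥0∞) ≠ 0 := by exact_mod_cast areaFactor_ne_zero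
  calc μH[2] (ψ ⁻¹' A ∩ square a)
      = (areaFactor : ℝ≥0∞)⁻¹ * (areaFactor * μH[2] (ψ ⁻¹' A ∩ square a)) := by
        rw [← mul_assoc, ENNReal.inv_mul_cancel h0 ENNReal.coe_ne_top, one_mul]
    _ ≤ (areaFactor : ℝ≥0∞)⁻¹ * surfaceMeasure Ω A := by
        gcongr
        refine h1.trans ?_
        simpa using h2

end IsChart

lemma surfaceMeasure_pos_of_mem_nhdsWithin (hΩ : BoundsSmoothSurface Ω) {x : E3}
    (hx : x ∈ frontier Ω) {U : Set E3} (hU : U ∈ 𝓝[frontier Ω] x) : 0 < surfaceMeasure Ω U := by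
  obtain ⟨ψ, a, H⟩ := exists_isChart hΩ hx
  obtain ⟨V, hVo, hxV, hVU⟩ := mem_nhdsWithin.1 hU
  have hpos : 0 < (volume.restrict (square a)) (ψ ⁻¹' V) := by
    have hm : ψ ⁻¹' V ∈ 𝓝 (0 : ℝ × ℝ) :=
      H.lipschitz.continuous.continuousAt (hVo.mem_nhds (by rwa [H.map_zero]))
    have hs : square a ∈ 𝓝 (0 : ℝ × ℝ) :=
      prod_mem_nhds (Icc_mem_nhds (by simp [H.pos]) H.pos) (Icc_mem_nhds (by simp [H.pos]) H.pos)
    rw [Measure.restrict_apply (H.lipschitz.continuous.measurable hVo.measurableSet)]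
    exact Measure.measure_pos_of_mem_nhds volume (inter_mem hm hs)
  have h1 := H.volume_map_le V
  rw [Measure.map_apply H.lipschitz.continuous.measurable hVo.measurableSet,
    Measure.smul_apply, smul_eq_mul] at h1
  have h2 : surfaceMeasure Ω V ≠ 0 := by
    intro h
    rw [h, mul_zero] at h1
    exact (hpos.trans_le h1).ne rfl
  have h3 : surfaceMeasure Ω V = surfaceMeasure Ω (V ∩ frontier Ω) := by
    rw [surfaceMeasure, Measure.restrict_apply hVo.measurableSet,
      Measure.restrict_apply (hVo.measurableSet.inter isClosed_frontier.measurableSet), inter_assoc,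
      inter_self]
  exact (pos_iff_ne_zero.2 (h3 ▸ h2)).trans_le (measure_mono hVU)

lemma isFiniteMeasure_surfaceMeasure (hΩ : BoundsSmoothSurface Ω) :
    IsFiniteMeasure (surfaceMeasure Ω) := by
  have key : surfaceMeasure Ω (frontier Ω) < ∞ := by
    refine hΩ.isCompact_frontier.measure_lt_top_of_nhdsWithin fun x hx => ?_
    obtain ⟨ψ, a, H⟩ := exists_isChart hΩ hx
    refine ⟨_, H.image_mem, ?_⟩
    have h1 := H.surfaceMeasure_restrict_le (ψ '' square a)
    rw [Measure.restrict_apply_self] at h1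
    refine h1.trans_lt ?_
    have hc : IsCompact (square a) := isCompact_Icc.prod isCompact_Icc
    have : IsFiniteMeasure (volume.restrict (square a)) := ⟨by
      rw [Measure.restrict_apply_univ]; exact hc.measure_lt_top⟩
    rw [Measure.smul_apply, smul_eq_mul]
    exact ENNReal.mul_lt_top (ENNReal.mul_lt_top (by simp) ENNReal.coe_lt_top)
      (measure_lt_top _ _)
  refine ⟨?_⟩
  rw [surfaceMeasure, Measure.restrict_apply_univ]
  rwa [surfaceMeasure, Measure.restrict_apply_self] at key

end Charts

/-! ### The Poincaré inequality on the surface -/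

section Line

/-- Lipschitz bounds on finitely many closed sets that cover an interval combine to a bound on the
interval, although the sets need not be intervals. -/
lemma abs_sub_le_of_closed_cover {ι : Type*} {E : ι → Set ℝ} (hE : ∀ i, IsClosed (E i))
    {f : ℝ → ℝ} {K : ℝ≥0} (hf : ∀ i, LipschitzOnWith K f (E i)) (s : Finset ι) :
    ∀ {a b : ℝ}, a ≤ b → Icc a b ⊆ ⋃ i ∈ s, E i → |f b - f a| ≤ K * (b - a) := by
  classical
  induction hn : s.card generalizing s with
  | zero =>
    intro a b hab hcov
    rw [Finset.card_eq_zero] at hn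
    subst hn
    simpa using hcov (left_mem_Icc.2 hab)
  | succ n ih =>
    intro a b hab hcov
    obtain ⟨i, his, hai⟩ := mem_iUnion₂.1 (hcov (left_mem_Icc.2 hab))
    have hcpt : IsCompact (E i ∩ Icc a b) := isCompact_Icc.inter_left (hE i)
    -- the last point of `[a, b]` in the piece that contains `a`
    obtain ⟨t, ⟨hti, hat, htb⟩, hmax⟩ := hcpt.exists_isGreatest ⟨a, hai, left_mem_Icc.2 hab⟩
    have h1 : |f t - f a| ≤ K * (t - a) := by
      have := (hf i).dist_le_mul t hti a hai
      rwa [Real.dist_eq, Real.dist_eq, abs_of_nonneg (sub_nonneg.2 hat)] at this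
    rcases htb.eq_or_lt with rfl | htb'
    · exact h1
    have hcl : IsClosed (⋃ j ∈ s.erase i, E j) :=
      (s.erase i).finite_toSet.isClosed_biUnion fun j _ => hE j
    have hsub : Ioc t b ⊆ ⋃ j ∈ s.erase i, E j := by
      intro u hu
      obtain ⟨j, hjs, huj⟩ := mem_iUnion₂.1 (hcov ⟨hat.trans hu.1.le, hu.2⟩)
      refine mem_iUnion₂.2 ⟨j, Finset.mem_erase.2 ⟨?_, hjs⟩, huj⟩
      rintro rfl
      exact hu.1.not_ge (hmax ⟨huj, hat.trans hu.1.le, hu.2⟩)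
    have hsub' : Icc t b ⊆ ⋃ j ∈ s.erase i, E j := by
      rw [← closure_Ioc htb'.ne]
      exact hcl.closure_subset_iff.2 hsub
    have h2 := ih (s.erase i) (by rw [Finset.card_erase_of_mem his, hn]; rfl) htb hsub'
    calc |f b - f a| ≤ |f b - f t| + |f t - f a| := abs_sub_le _ _ _
      _ ≤ K * (b - t) + K * (t - a) := add_le_add h2 h1
      _ = _ := by ring

lemma lipschitzWith_of_closed_cover {ι : Type*} [Fintype ι] {E : ι → Set ℝ}
    (hE : ∀ i, IsClosed (E i)) (hcov : ∀ t, ∃ i, t ∈ E i) {f : ℝ → ℝ} {K : ℝ≥0}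
    (hf : ∀ i, LipschitzOnWith K f (E i)) : LipschitzWith K f := by
  have key : ∀ s t, s ≤ t → dist (f s) (f t) ≤ K * dist s t := by
    intro s t hst
    have := abs_sub_le_of_closed_cover hE hf Finset.univ hst
      (fun u _ => by simpa using hcov u)
    rw [dist_comm, dist_comm s, Real.dist_eq, Real.dist_eq, abs_of_nonneg (sub_nonneg.2 hst)]
    exact this
  refine LipschitzWith.of_dist_le_mul fun s t => ?_
  rcases le_total s t with h | h
  · exact key s t h
  · rw [dist_comm, dist_comm s]
    exact key t s h

lemma sq_lintegral_le {α : Type*} [MeasurableSpace α] (μ : Measure α) {f : α → ℝ≥0∞}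
    (hf : AEMeasurable f μ) : (∫⁻ x, f x ∂μ) ^ 2 ≤ μ univ * ∫⁻ x, f x ^ 2 ∂μ := by
  have h := ENNReal.lintegral_mul_le_Lp_mul_Lq μ Real.HolderConjugate.two_two hf
    (aemeasurable_const (b := (1 : ℝ≥0∞)))
  simp only [Pi.mul_apply, mul_one, lintegral_const, ENNReal.rpow_ofNat, one_pow, one_mul] at h
  calc (∫⁻ x, f x ∂μ) ^ 2
      ≤ ((∫⁻ x, f x ^ 2 ∂μ) ^ (1 / 2 : ℝ) * (μ univ) ^ (1 / 2 : ℝ)) ^ 2 := by gcongr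
    _ = _ := by
        rw [mul_pow, ← ENNReal.rpow_natCast, ← ENNReal.rpow_mul, ← ENNReal.rpow_natCast,
          ← ENNReal.rpow_mul]
        norm_num [mul_comm]

/-- Fundamental theorem of calculus and Cauchy-Schwarz inequality on a line. -/
lemma enorm_sub_sq_le_of_lipschitzWith {f : ℝ → ℝ} {K : ℝ≥0} (hf : LipschitzWith K f) {a s t : ℝ}
    (hs : s ∈ Icc (-a) a) (ht : t ∈ Icc (-a) a) :
    ‖f s - f t‖ₑ ^ 2 ≤ ENNReal.ofReal (2 * a) * ∫⁻ σ in Icc (-a) a, ‖deriv f σ‖ₑ ^ 2 := by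
  have hac := (hf.lipschitzOnWith (s := uIcc t s)).absolutelyContinuousOnInterval
  have h1 : ‖f s - f t‖ₑ ≤ ∫⁻ σ in Icc (-a) a, ‖deriv f σ‖ₑ := by
    rw [← hac.integral_deriv_eq_sub]
    have h2 : ‖∫ x in t..s, deriv f x‖ₑ = ‖∫ x in uIoc t s, deriv f x‖ₑ := by
      rw [← ofReal_norm, ← ofReal_norm, intervalIntegral.norm_intervalIntegral_eq]
    rw [h2]
    refine (enorm_integral_le_lintegral_enorm _).trans ?_
    refine lintegral_mono_set ?_
    exact uIoc_subset_uIcc.trans (uIcc_subset_Icc ht hs)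
  calc ‖f s - f t‖ₑ ^ 2 ≤ (∫⁻ σ in Icc (-a) a, ‖deriv f σ‖ₑ) ^ 2 := by gcongr
    _ ≤ _ := by
        refine (sq_lintegral_le _ (measurable_deriv f).enorm.aemeasurable).trans_eq ?_
        rw [Measure.restrict_apply_univ, Real.volume_Icc]
        congr 2
        ring

end Line

lemma enorm_sub_sq_le (a b c : ℝ) : ‖a - c‖ₑ ^ 2 ≤ 2 * ‖a - b‖ₑ ^ 2 + 2 * ‖b - c‖ₑ ^ 2 := by
  have h : ∀ x : ℝ, ‖x‖ₑ ^ 2 = ENNReal.ofReal (x ^ 2) := fun x => by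
    rw [← ofReal_norm, ← ENNReal.ofReal_pow (norm_nonneg _), Real.norm_eq_abs, sq_abs]
  have h2 : (2 : ℝ≥0∞) = ENNReal.ofReal 2 := by simp
  rw [h, h, h, h2, ← ENNReal.ofReal_mul (by norm_num), ← ENNReal.ofReal_mul (by norm_num),
    ← ENNReal.ofReal_add (by positivity) (by positivity)]
  refine ENNReal.ofReal_le_ofReal ?_
  nlinarith [sq_nonneg (a - b - (b - c))]

/-- The Poincaré inequality on a square for a function that is Lipschitz along the two coordinate
directions: connect two points by a horizontal and a vertical segment. -/
lemma poincare_square {W : ℝ × ℝ → ℝ} (hW : Continuous W) {K : ℝ≥0}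
    (h₁ : ∀ t, LipschitzWith K fun s => W (s, t)) (h₂ : ∀ s, LipschitzWith K fun t => W (s, t))
    (a : ℝ) :
    ∫⁻ z in square a, ∫⁻ z' in square a, ‖W z - W z'‖ₑ ^ 2 ≤
      2 * ENNReal.ofReal (2 * a) ^ 4 *
        ∫⁻ z in square a, (‖deriv (fun s => W (s, z.2)) z.1‖ₑ ^ 2
          + ‖deriv (fun t => W (z.1, t)) z.2‖ₑ ^ 2) := by
  set I : Measure ℝ := volume.restrict (Icc (-a) a) with hI
  set ℓ := ENNReal.ofReal (2 * a) with hℓ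
  have hIu : I univ = ℓ := by
    rw [hI, Measure.restrict_apply_univ, Real.volume_Icc, hℓ]
    congr 1
    ring
  have hprod : (volume.restrict (square a) : Measure (ℝ × ℝ)) = I.prod I := by
    rw [hI, square, Measure.prod_restrict]
    rfl
  have hm1 : Measurable fun z : ℝ × ℝ => ‖deriv (fun s => W (s, z.2)) z.1‖ₑ ^ 2 := by
    have := measurable_deriv_with_param (f := fun t s => W (s, t)) (by
      exact hW.comp (continuous_snd.prodMk continuous_fst))
    exact (this.comp measurable_swap).enorm.pow_const 2
  have hm2 : Measurable fun z : ℝ × ℝ => ‖deriv (fun t => W (z.1, t)) z.2‖ₑ ^ 2 :=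
    (measurable_deriv_with_param (f := fun s t => W (s, t)) hW).enorm.pow_const 2
  set A : ℝ → ℝ≥0∞ := fun t => ∫⁻ σ, ‖deriv (fun s => W (s, t)) σ‖ₑ ^ 2 ∂I with hA
  set B : ℝ → ℝ≥0∞ := fun s => ∫⁻ σ, ‖deriv (fun t => W (s, t)) σ‖ₑ ^ 2 ∂I with hB
  have hAm : Measurable A := Measurable.lintegral_prod_left hm1
  have hBm : Measurable B := Measurable.lintegral_prod_right hm2
  have hpt : ∀ z ∈ square a, ∀ z' ∈ square a, ‖W z - W z'‖ₑ ^ 2 ≤ 2 * ℓ * (A z.2 + B z'.1) := by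
    rintro ⟨s, t⟩ ⟨hs, ht⟩ ⟨s', t'⟩ ⟨hs', ht'⟩
    calc ‖W (s, t) - W (s', t')‖ₑ ^ 2
        ≤ 2 * ‖W (s, t) - W (s', t)‖ₑ ^ 2 + 2 * ‖W (s', t) - W (s', t')‖ₑ ^ 2 :=
          enorm_sub_sq_le _ _ _
      _ ≤ 2 * (ℓ * A t) + 2 * (ℓ * B s') := by
          gcongr
          · exact enorm_sub_sq_le_of_lipschitzWith (h₁ t) hs hs'
          · exact enorm_sub_sq_le_of_lipschitzWith (h₂ s') ht ht'
      _ = _ := by ring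
  have hms := IsChart.measurableSet_square a
  calc ∫⁻ z in square a, ∫⁻ z' in square a, ‖W z - W z'‖ₑ ^ 2
      ≤ ∫⁻ z in square a, ∫⁻ z' in square a, 2 * ℓ * (A z.2 + B z'.1) := by
        refine setLIntegral_mono' hms fun z hz => setLIntegral_mono' hms fun z' hz' => ?_
        exact hpt z hz z' hz'
    _ = 2 * ℓ ^ 4 * (∫⁻ t, A t ∂I + ∫⁻ s, B s ∂I) := by
        rw [hprod]
        have e1 : ∀ z : ℝ × ℝ, ∫⁻ z', 2 * ℓ * (A z.2 + B z'.1) ∂(I.prod I) =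
            2 * ℓ * (A z.2 * ℓ ^ 2 + ℓ * ∫⁻ s, B s ∂I) := by
          intro z
          rw [lintegral_const_mul _ (by fun_prop), lintegral_add_left (by fun_prop),
            lintegral_const, lintegral_prod _ (by fun_prop)]
          simp only [lintegral_const, hIu]
          rw [lintegral_mul_const _ hBm, ← univ_prod_univ, Measure.prod_prod, hIu]
          ring
        simp only [e1]
        rw [lintegral_const_mul _ (by fun_prop), lintegral_add_left (by fun_prop),
          lintegral_const, lintegral_mul_const _ (by fun_prop), lintegral_prod _ (by fun_prop)]
        simp only [lintegral_const, hIu]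
        rw [← univ_prod_univ, Measure.prod_prod, hIu]
        ring
    _ = _ := by
        rw [lintegral_add_left hm1, hprod, lintegral_prod_symm _ hm1.aemeasurable,
          lintegral_prod _ hm2.aemeasurable]

section Poincare

variable {Ω : Set E3}

/-- The continuous function `w` is Lipschitz on each of finitely many closed pieces that cover
`Γ`, and `g` bounds almost everywhere the pointwise Lipschitz constant of `w` on `Γ`. -/
structure HasUpperGradient (Ω : Set E3) (w g : E3 → ℝ) : Prop where
  continuous : Continuous w
  measurable : Measurable g
  nonneg : ∀ y, 0 ≤ g y
  exists_cover : ∃ (N : ℕ) (A : Fin N → Set E3) (M : ℝ≥0), (∀ i, IsClosed (A i)) ∧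
    frontier Ω ⊆ ⋃ i, A i ∧ ∀ i, LipschitzOnWith M w (A i)
  eventually_le : ∀ᵐ y ∂(surfaceMeasure Ω), ∀ ε > 0, ∀ᶠ z in 𝓝[frontier Ω] y,
    |w z - w y| ≤ (g y + ε) * ‖z - y‖

/-- The Poincaré inequality for pairs of points in `U × V`, with a constant that does not depend on
the function. -/
def PoincareOn (Ω U V : Set E3) : Prop :=
  ∃ C : ℝ≥0, ∀ w g, HasUpperGradient Ω w g →
    ∫⁻ x in U, ∫⁻ y in V, ‖w x - w y‖ₑ ^ 2 ∂(surfaceMeasure Ω) ∂(surfaceMeasure Ω)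
      ≤ C * ∫⁻ y, ‖g y‖ₑ ^ 2 ∂(surfaceMeasure Ω)

/-- The upper gradient bounds the derivatives of `w` in the coordinates of a chart, up to the
Lipschitz constant `2` of the chart. -/
lemma IsChart.enorm_deriv_le {x : E3} {ψ : ℝ × ℝ → E3} {a : ℝ} (H : IsChart Ω x ψ a) {w g : E3 → ℝ}
    {z : ℝ × ℝ} (hg : 0 ≤ g (ψ z))
    (hz : ∀ ε > 0, ∀ᶠ y in 𝓝[frontier Ω] (ψ z), |w y - w (ψ z)| ≤ (g (ψ z) + ε) * ‖y - ψ z‖)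
    {γ : ℝ → ℝ × ℝ} (hγ : Isometry γ) {t : ℝ} (ht : γ t = z) :
    ‖deriv (fun s => w (ψ (γ s))) t‖ₑ ≤ 2 * ‖g (ψ z)‖ₑ := by
  have key : ‖deriv (fun s => w (ψ (γ s))) t‖ ≤ 2 * g (ψ z) := by
    refine le_of_forall_pos_le_add fun ε hε => ?_
    refine norm_deriv_le_of_lip' (by positivity) ?_
    have hcont : Tendsto (fun s => ψ (γ s)) (𝓝 t) (𝓝[frontier Ω] (ψ z)) := by
      refine tendsto_nhdsWithin_iff.2 ⟨?_, Eventually.of_forall fun s => H.mem _⟩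
      rw [← ht]
      exact (H.lipschitz.continuous.comp hγ.continuous).continuousAt
    filter_upwards [hcont.eventually (hz (ε / 2) (by positivity))] with s hs
    rw [ht, Real.norm_eq_abs]
    refine hs.trans ?_
    have h1 : ‖ψ (γ s) - ψ z‖ ≤ 2 * ‖s - t‖ := by
      rw [← dist_eq_norm, ← dist_eq_norm, ← ht]
      refine (H.lipschitz.dist_le_mul _ _).trans_eq ?_
      rw [hγ.dist_eq]
      rfl
    calc (g (ψ z) + ε / 2) * ‖ψ (γ s) - ψ z‖ ≤ (g (ψ z) + ε / 2) * (2 * ‖s - t‖) := by gcongr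
      _ = _ := by ring
  rw [← ofReal_norm, ← ofReal_norm, Real.norm_of_nonneg hg]
  have h2 : (2 : ℝ≥0∞) = ENNReal.ofReal 2 := by simp
  rw [h2, ← ENNReal.ofReal_mul (by norm_num)]
  exact ENNReal.ofReal_le_ofReal key

lemma IsChart.lipschitzWith_comp {x : E3} {ψ : ℝ × ℝ → E3} {a : ℝ} (H : IsChart Ω x ψ a)
    {w : E3 → ℝ} {N : ℕ} {A : Fin N → Set E3} {M : ℝ≥0} (hA : ∀ i, IsClosed (A i))
    (hcov : frontier Ω ⊆ ⋃ i, A i) (hw : ∀ i, LipschitzOnWith M w (A i)) {γ : ℝ → ℝ × ℝ}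
    (hγ : Isometry γ) : LipschitzWith (M * 2) fun s => w (ψ (γ s)) := by
  have hl : LipschitzWith 2 fun s => ψ (γ s) := by
    have := H.lipschitz.comp hγ.lipschitz
    rwa [mul_one] at this
  refine lipschitzWith_of_closed_cover (E := fun i => (fun s => ψ (γ s)) ⁻¹' A i)
    (fun i => (hA i).preimage hl.continuous) (fun t => ?_) fun i => ?_
  · simpa using hcov (H.mem (γ t))
  · exact (hw i).comp hl.lipschitzOnWith fun s hs => hs

lemma isometry_prodMk_right (t : ℝ) : Isometry fun s : ℝ => (s, t) :=
  Isometry.of_dist_eq fun s s' => by simp [Prod.dist_eq]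

lemma isometry_prodMk_left (s : ℝ) : Isometry fun t : ℝ => (s, t) :=
  Isometry.of_dist_eq fun t t' => by simp [Prod.dist_eq]

lemma IsChart.poincareOn {x : E3} {ψ : ℝ × ℝ → E3} {a : ℝ} (H : IsChart Ω x ψ a) :
    PoincareOn Ω (ψ '' square a) (ψ '' square a) := by
  set κ : ℝ≥0∞ := 4 * areaFactor with hκ
  refine ⟨(κ * κ * (2 * ENNReal.ofReal (2 * a) ^ 4 * (8 * (areaFactor : ℝ≥0∞)⁻¹))).toNNReal,
    fun w g hwg => ?_⟩
  have h0 : (areaFactor : ℝ≥0∞) ≠ 0 := by exact_mod_cast areaFactor_ne_zero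
  rw [ENNReal.coe_toNNReal (by finiteness)]
  set ν := surfaceMeasure Ω with hν
  set S : Measure (ℝ × ℝ) := volume.restrict (square a) with hS
  have hψ := H.lipschitz.continuous
  have hle : ν.restrict (ψ '' square a) ≤ κ • S.map ψ := H.surfaceMeasure_restrict_le
  obtain ⟨N, A, M, hA, hcov, hM⟩ := hwg.exists_cover
  have step1 : ∀ F : E3 → ℝ≥0∞, ∫⁻ y in ψ '' square a, F y ∂ν ≤ κ * ∫⁻ z, F (ψ z) ∂S := by
    intro F
    calc ∫⁻ y in ψ '' square a, F y ∂ν ≤ ∫⁻ y, F y ∂(κ • S.map ψ) := lintegral_mono' hle le_rfl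
      _ = κ * ∫⁻ y, F y ∂(S.map ψ) := by rw [lintegral_smul_measure, smul_eq_mul]
      _ ≤ κ * ∫⁻ z, F (ψ z) ∂S := by gcongr; exact lintegral_map_le _ _
  have hae : ∀ᵐ z ∂S, ∀ ε > 0, ∀ᶠ y in 𝓝[frontier Ω] (ψ z),
      |w y - w (ψ z)| ≤ (g (ψ z) + ε) * ‖y - ψ z‖ := by
    have hac : S.map ψ ≪ ν := Measure.absolutelyContinuous_of_le_smul H.volume_map_le
    exact ae_of_ae_map hψ.aemeasurable (hac.ae_le hwg.eventually_le)
  calc ∫⁻ x in ψ '' square a, ∫⁻ y in ψ '' square a, ‖w x - w y‖ₑ ^ 2 ∂ν ∂ν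
      ≤ ∫⁻ x in ψ '' square a, (κ * ∫⁻ z', ‖w x - w (ψ z')‖ₑ ^ 2 ∂S) ∂ν :=
        lintegral_mono fun x => step1 _
    _ ≤ κ * ∫⁻ z, (κ * ∫⁻ z', ‖w (ψ z) - w (ψ z')‖ₑ ^ 2 ∂S) ∂S := step1 _
    _ = κ * κ * ∫⁻ z, ∫⁻ z', ‖w (ψ z) - w (ψ z')‖ₑ ^ 2 ∂S ∂S := by
        rw [lintegral_const_mul' κ _ (by finiteness), ← mul_assoc]
    _ ≤ κ * κ * (2 * ENNReal.ofReal (2 * a) ^ 4 *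
        ∫⁻ z, (‖deriv (fun s => w (ψ (s, z.2))) z.1‖ₑ ^ 2
          + ‖deriv (fun t => w (ψ (z.1, t))) z.2‖ₑ ^ 2) ∂S) := by
        gcongr
        exact poincare_square (W := fun z => w (ψ z)) (hwg.continuous.comp hψ)
          (fun t => H.lipschitzWith_comp hA hcov hM (isometry_prodMk_right t))
          (fun s => H.lipschitzWith_comp hA hcov hM (isometry_prodMk_left s)) a
    _ ≤ κ * κ * (2 * ENNReal.ofReal (2 * a) ^ 4 * ∫⁻ z, 8 * ‖g (ψ z)‖ₑ ^ 2 ∂S) := by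
        gcongr κ * κ * (2 * ENNReal.ofReal (2 * a) ^ 4 * ?_)
        refine lintegral_mono_ae ?_
        filter_upwards [hae] with z hz
        have h1 := H.enorm_deriv_le (hwg.nonneg _) hz (isometry_prodMk_right z.2) rfl
        have h2 := H.enorm_deriv_le (hwg.nonneg _) hz (isometry_prodMk_left z.1) rfl
        calc _ ≤ (2 * ‖g (ψ z)‖ₑ) ^ 2 + (2 * ‖g (ψ z)‖ₑ) ^ 2 := by gcongr
          _ = _ := by ring
    _ ≤ κ * κ * (2 * ENNReal.ofReal (2 * a) ^ 4 *
        (8 * ((areaFactor : ℝ≥0∞)⁻¹ * ∫⁻ y, ‖g y‖ₑ ^ 2 ∂ν))) := by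
        gcongr κ * κ * (2 * ENNReal.ofReal (2 * a) ^ 4 * ?_)
        have hgm : Measurable fun y => ‖g y‖ₑ ^ 2 := hwg.measurable.enorm.pow_const 2
        rw [lintegral_const_mul' _ _ (by finiteness), ← lintegral_map hgm hψ.measurable]
        gcongr
        refine (lintegral_mono' H.volume_map_le le_rfl).trans_eq ?_
        rw [lintegral_smul_measure, smul_eq_mul]
    _ = _ := by ring

lemma HasUpperGradient.measurable_enorm_sub {w g : E3 → ℝ} (h : HasUpperGradient Ω w g) :
    Measurable fun q : E3 × E3 => ‖w q.1 - w q.2‖ₑ ^ 2 := by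
  have := h.continuous.measurable
  fun_prop

lemma PoincareOn.mono {U V U' V' : Set E3} (h : PoincareOn Ω U V) (hU : U' ⊆ U) (hV : V' ⊆ V) :
    PoincareOn Ω U' V' := by
  obtain ⟨C, hC⟩ := h
  refine ⟨C, fun w g hwg => le_trans ?_ (hC w g hwg)⟩
  exact lintegral_mono' (Measure.restrict_mono hU le_rfl) fun x =>
    lintegral_mono' (Measure.restrict_mono hV le_rfl) le_rfl

lemma PoincareOn.symm [IsFiniteMeasure (surfaceMeasure Ω)] {U V : Set E3}
    (h : PoincareOn Ω U V) : PoincareOn Ω V U := by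
  obtain ⟨C, hC⟩ := h
  refine ⟨C, fun w g hwg => le_of_eq_of_le ?_ (hC w g hwg)⟩
  rw [lintegral_lintegral_swap]
  · simp only [enorm_sub_rev]
  · exact hwg.measurable_enorm_sub.aemeasurable

/-- Chaining through a set of positive measure: insert an intermediate point and average over it. -/
lemma PoincareOn.trans [IsFiniteMeasure (surfaceMeasure Ω)] {U B V : Set E3}
    (hB : surfaceMeasure Ω B ≠ 0) (h₁ : PoincareOn Ω U B) (h₂ : PoincareOn Ω B V) :
    PoincareOn Ω U V := by
  obtain ⟨C₁, hC₁⟩ := h₁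
  obtain ⟨C₂, hC₂⟩ := h₂
  set ν := surfaceMeasure Ω with hν
  have hBt : ν B ≠ ∞ := measure_ne_top _ _
  refine ⟨((ν B)⁻¹ * (2 * ν V * C₁ + 2 * ν U * C₂)).toNNReal, fun w g hwg => ?_⟩
  have hinv : (ν B)⁻¹ ≠ ∞ := ENNReal.inv_ne_top.2 hB
  rw [ENNReal.coe_toNNReal (by finiteness)]
  have hw := hwg.continuous.measurable
  set G := ∫⁻ y, ‖g y‖ₑ ^ 2 ∂ν with hG
  have h1 := hC₁ w g hwg
  have h2 := hC₂ w g hwg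
  have key : ν B * ∫⁻ x in U, ∫⁻ y in V, ‖w x - w y‖ₑ ^ 2 ∂ν ∂ν ≤
      (2 * ν V * C₁ + 2 * ν U * C₂) * G := by
    calc ν B * ∫⁻ x in U, ∫⁻ y in V, ‖w x - w y‖ₑ ^ 2 ∂ν ∂ν
        = ∫⁻ b in B, ∫⁻ x in U, ∫⁻ y in V, ‖w x - w y‖ₑ ^ 2 ∂ν ∂ν ∂ν := by
          rw [lintegral_const, Measure.restrict_apply_univ, mul_comm]
      _ ≤ ∫⁻ b in B, ∫⁻ x in U, ∫⁻ y in V,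
            (2 * ‖w x - w b‖ₑ ^ 2 + 2 * ‖w b - w y‖ₑ ^ 2) ∂ν ∂ν ∂ν := by
          gcongr with b x y
          exact enorm_sub_sq_le _ _ _
      _ = ∫⁻ b in B, (2 * ν V * ∫⁻ x in U, ‖w x - w b‖ₑ ^ 2 ∂ν +
            2 * ν U * ∫⁻ y in V, ‖w b - w y‖ₑ ^ 2 ∂ν) ∂ν := by
          refine lintegral_congr fun b => ?_
          have e : ∀ x, ∫⁻ y in V, (2 * ‖w x - w b‖ₑ ^ 2 + 2 * ‖w b - w y‖ₑ ^ 2) ∂ν =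
              2 * ν V * ‖w x - w b‖ₑ ^ 2 + 2 * ∫⁻ y in V, ‖w b - w y‖ₑ ^ 2 ∂ν := by
            intro x
            rw [lintegral_add_left (by fun_prop), lintegral_const, Measure.restrict_apply_univ,
              lintegral_const_mul _ (by fun_prop)]
            ring
          simp only [e]
          rw [lintegral_add_left (by fun_prop), lintegral_const, Measure.restrict_apply_univ,
            lintegral_const_mul _ (by fun_prop)]
          ring
      _ = 2 * ν V * ∫⁻ b in B, ∫⁻ x in U, ‖w x - w b‖ₑ ^ 2 ∂ν ∂ν +
            2 * ν U * ∫⁻ b in B, ∫⁻ y in V, ‖w b - w y‖ₑ ^ 2 ∂ν ∂ν := by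
          have m1 : Measurable fun b => ∫⁻ x in U, ‖w x - w b‖ₑ ^ 2 ∂ν :=
            Measurable.lintegral_prod_left hwg.measurable_enorm_sub
          have m2 : Measurable fun b => ∫⁻ y in V, ‖w b - w y‖ₑ ^ 2 ∂ν :=
            Measurable.lintegral_prod_right hwg.measurable_enorm_sub
          rw [lintegral_add_left (by fun_prop), lintegral_const_mul _ m1,
            lintegral_const_mul _ m2]
      _ ≤ 2 * ν V * (C₁ * G) + 2 * ν U * (C₂ * G) := by
          gcongr
          rw [lintegral_lintegral_swap]
          · exact h1
          · exact (hwg.measurable_enorm_sub.comp measurable_swap).aemeasurable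
      _ = _ := by ring
  calc ∫⁻ x in U, ∫⁻ y in V, ‖w x - w y‖ₑ ^ 2 ∂ν ∂ν
      = (ν B)⁻¹ * (ν B * ∫⁻ x in U, ∫⁻ y in V, ‖w x - w y‖ₑ ^ 2 ∂ν ∂ν) := by
        rw [← mul_assoc, ENNReal.inv_mul_cancel hB hBt, one_mul]
    _ ≤ (ν B)⁻¹ * ((2 * ν V * C₁ + 2 * ν U * C₂) * G) := by gcongr
    _ = _ := by ring

lemma PoincareOn.union_left {U U' V : Set E3} (h : PoincareOn Ω U V) (h' : PoincareOn Ω U' V) :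
    PoincareOn Ω (U ∪ U') V := by
  obtain ⟨C, hC⟩ := h
  obtain ⟨C', hC'⟩ := h'
  refine ⟨C + C', fun w g hwg => (lintegral_union_le _ _ _).trans ?_⟩
  rw [ENNReal.coe_add, add_mul]
  exact add_le_add (hC w g hwg) (hC' w g hwg)

lemma poincareOn_empty (V : Set E3) : PoincareOn Ω ∅ V := ⟨0, fun w g _ => by simp⟩

/-- **Poincaré inequality** on the connected compact surface. Local inequalities in charts are
chained along overlapping neighbourhoods. -/
theorem poincareOn_frontier (hΩ : BoundsSmoothSurface Ω) :
    PoincareOn Ω (frontier Ω) (frontier Ω) := by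
  have := isFiniteMeasure_surfaceMeasure hΩ
  have hlocal : ∀ x ∈ frontier Ω, ∀ y ∈ frontier Ω, ∃ U ∈ 𝓝[frontier Ω] x,
      ∃ V ∈ 𝓝[frontier Ω] y, PoincareOn Ω U V := by
    intro x hx y hy
    refine hΩ.isConnected.isPreconnected.induction₂' (fun x y => ∃ U ∈ 𝓝[frontier Ω] x,
      ∃ V ∈ 𝓝[frontier Ω] y, PoincareOn Ω U V) ?_ ?_ hx hy
    · intro x hx
      obtain ⟨ψ, a, H⟩ := exists_isChart hΩ hx
      have hmem := H.image_mem
      filter_upwards [eventually_mem_nhdsWithin, eventually_nhdsWithin_of_eventually_nhds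
        (eventually_eventually_nhds.2 (mem_nhdsWithin_iff_eventually.1 hmem))] with y hy hy'
      have hmem' : ψ '' square a ∈ 𝓝[frontier Ω] y := mem_nhdsWithin_iff_eventually.2 hy'
      exact ⟨⟨_, hmem, _, hmem', H.poincareOn⟩, ⟨_, hmem', _, hmem, H.poincareOn⟩⟩
    · rintro x y z hx hy hz ⟨U, hU, V, hV, h1⟩ ⟨V', hV', W, hW, h2⟩
      refine ⟨U, hU, W, hW, PoincareOn.trans (B := V ∩ V') ?_ (h1.mono le_rfl inter_subset_left)
        (h2.mono inter_subset_right le_rfl)⟩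
      exact (surfaceMeasure_pos_of_mem_nhdsWithin hΩ hy (inter_mem hV hV')).ne'
  have hone : ∀ x ∈ frontier Ω, ∃ U ∈ 𝓝[frontier Ω] x, PoincareOn Ω U (frontier Ω) := by
    intro x hx
    have key : ∃ U ∈ 𝓝[frontier Ω] x, PoincareOn Ω (frontier Ω) U := by
      refine hΩ.isCompact_frontier.induction_on
        (p := fun V => ∃ U ∈ 𝓝[frontier Ω] x, PoincareOn Ω V U) ?_ ?_ ?_ ?_
      · exact ⟨univ, univ_mem, poincareOn_empty _⟩
      · rintro s t hst ⟨U, hU, h⟩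
        exact ⟨U, hU, h.mono hst le_rfl⟩
      · rintro s t ⟨U, hU, h⟩ ⟨U', hU', h'⟩
        exact ⟨U ∩ U', inter_mem hU hU', (h.mono le_rfl inter_subset_left).union_left
          (h'.mono le_rfl inter_subset_right)⟩
      · intro y hy
        obtain ⟨U, hU, V, hV, h⟩ := hlocal x hx y hy
        exact ⟨V, hV, U, hU, h.symm⟩
    obtain ⟨U, hU, h⟩ := key
    exact ⟨U, hU, h.symm⟩
  refine hΩ.isCompact_frontier.induction_on (p := fun U => PoincareOn Ω U (frontier Ω))
    (poincareOn_empty _) (fun s t hst h => h.mono hst le_rfl) (fun s t h h' => h.union_left h')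
    fun x hx => ?_
  obtain ⟨U, hU, h⟩ := hone x hx
  exact ⟨U, hU, h⟩

/-- Subtracting a suitable constant from `w`, the `L²(Γ)` norm is bounded by that of the upper
gradient. -/
theorem exists_lintegral_sub_const_le (hΩ : BoundsSmoothSurface Ω) :
    ∃ C : ℝ≥0, ∀ w g, HasUpperGradient Ω w g → ∃ m : ℝ,
      ∫⁻ y, ‖w y - m‖ₑ ^ 2 ∂(surfaceMeasure Ω) ≤ C * ∫⁻ y, ‖g y‖ₑ ^ 2 ∂(surfaceMeasure Ω) := by
  have := isFiniteMeasure_surfaceMeasure hΩ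
  obtain ⟨C, hC⟩ := poincareOn_frontier hΩ
  set ν := surfaceMeasure Ω with hν
  obtain ⟨x₀, hx₀⟩ := hΩ.isConnected.nonempty
  have hpos : ν ≠ 0 := by
    intro h
    have := surfaceMeasure_pos_of_mem_nhdsWithin hΩ hx₀ univ_mem
    rw [← hν, h] at this
    simp at this
  have hu0 : ν univ ≠ 0 := by simpa using hpos
  have hinv : (ν univ)⁻¹ ≠ ∞ := ENNReal.inv_ne_top.2 hu0
  refine ⟨((ν univ)⁻¹ * C).toNNReal, fun w g hwg => ?_⟩
  rw [ENNReal.coe_toNNReal (by finiteness)]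
  have hres : ν.restrict (frontier Ω) = ν := by
    rw [hν, surfaceMeasure, Measure.restrict_restrict isClosed_frontier.measurableSet, inter_self]
  have h1 := hC w g hwg
  rw [hres] at h1
  have hm : Measurable fun x => ∫⁻ y, ‖w x - w y‖ₑ ^ 2 ∂ν :=
    Measurable.lintegral_prod_right hwg.measurable_enorm_sub
  obtain ⟨x, hx⟩ := exists_le_laverage hpos hm.aemeasurable
  refine ⟨w x, ?_⟩
  calc ∫⁻ y, ‖w y - w x‖ₑ ^ 2 ∂ν = ∫⁻ y, ‖w x - w y‖ₑ ^ 2 ∂ν := by simp only [enorm_sub_rev]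
    _ ≤ (ν univ)⁻¹ * ∫⁻ x, ∫⁻ y, ‖w x - w y‖ₑ ^ 2 ∂ν ∂ν := by
        rw [laverage_eq, ENNReal.div_eq_inv_mul] at hx
        exact hx
    _ ≤ (ν univ)⁻¹ * (C * ∫⁻ y, ‖g y‖ₑ ^ 2 ∂ν) := by gcongr
    _ = _ := by ring

end Poincare

/-! ### The reference triangle -/

section RefTriangle

lemma convex_refTriangle : Convex ℝ refTriangle := by
  intro x hx y hy a b ha hb hab
  obtain ⟨hx0, hx1, hx2⟩ := hx
  obtain ⟨hy0, hy1, hy2⟩ := hy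
  refine ⟨?_, ?_, ?_⟩ <;> simp only [PiLp.add_apply, PiLp.smul_apply, smul_eq_mul]
  · positivity
  · positivity
  · nlinarith

lemma isClosed_refTriangle : IsClosed refTriangle := by
  have h0 : Continuous fun x : E2 => x 0 := by fun_prop
  have h1 : Continuous fun x : E2 => x 1 := by fun_prop
  exact (isClosed_le continuous_const h0).inter
    ((isClosed_le continuous_const h1).inter (isClosed_le (h0.add h1) continuous_const))

lemma norm_sub_le_of_mem_refTriangle {x y : E2} (hx : x ∈ refTriangle) (hy : y ∈ refTriangle) :
    ‖x - y‖ ≤ 2 := by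
  obtain ⟨hx0, hx1, hx2⟩ := hx
  obtain ⟨hy0, hy1, hy2⟩ := hy
  rw [EuclideanSpace.norm_eq, Fin.sum_univ_two]
  refine Real.sqrt_le_iff.2 ⟨by norm_num, ?_⟩
  simp only [PiLp.sub_apply, Real.norm_eq_abs, sq_abs]
  nlinarith

lemma zero_mem_refTriangle : (0 : E2) ∈ refTriangle := by simp [refTriangle]

lemma isCompact_refTriangle : IsCompact refTriangle := by
  refine Metric.isCompact_of_isClosed_isBounded isClosed_refTriangle ?_
  refine (Metric.isBounded_closedBall (x := (0 : E2)) (r := 2)).subset fun x hx => ?_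
  rw [mem_closedBall_iff_norm]
  exact norm_sub_le_of_mem_refTriangle hx zero_mem_refTriangle

lemma measurableSet_refTriangle : MeasurableSet refTriangle := isClosed_refTriangle.measurableSet

lemma sum_baryCoord (x : E2) : ∑ i, baryCoord x i = 1 := by
  simp only [baryCoord, Fin.sum_univ_three, Matrix.cons_val]
  ring

lemma baryCoord_nonneg {x : E2} (hx : x ∈ refTriangle) (i : Fin 3) : 0 ≤ baryCoord x i := by
  obtain ⟨h0, h1, h2⟩ := hx
  fin_cases i <;> simp [baryCoord] <;> linarith

lemma baryCoord_pos {x : E2} (hx : x ∈ interior refTriangle) (i : Fin 3) : 0 < baryCoord x i := by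
  have key : ∀ v : E2, ∃ t : ℝ, 0 < t ∧ x + t • v ∈ refTriangle := by
    intro v
    have hc : Continuous fun t : ℝ => x + t • v := by fun_prop
    have h1 : ∀ᶠ t in 𝓝 (0 : ℝ), x + t • v ∈ refTriangle := by
      refine hc.continuousAt.eventually_mem ?_
      simpa using mem_interior_iff_mem_nhds.1 hx
    obtain ⟨t, ht, ht0⟩ := ((h1.filter_mono nhdsWithin_le_nhds).and
      (self_mem_nhdsWithin : Ioi (0 : ℝ) ∈ 𝓝[>] 0)).exists
    exact ⟨t, ht0, ht⟩
  fin_cases i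
  · obtain ⟨t, ht, -, -, h⟩ := key (!₂[1, 0])
    simp [baryCoord] at h ⊢
    linarith
  · obtain ⟨t, ht, h, -, -⟩ := key (!₂[-1, 0])
    simp [baryCoord] at h ⊢
    linarith
  · obtain ⟨t, ht, -, h, -⟩ := key (!₂[0, -1])
    simp [baryCoord] at h ⊢
    linarith

lemma interior_refTriangle_nonempty : (interior refTriangle).Nonempty := by
  refine ⟨!₂[1 / 3, 1 / 3], ?_⟩
  have h0 : Continuous fun x : E2 => x 0 := by fun_prop
  have h1 : Continuous fun x : E2 => x 1 := by fun_prop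
  have ho : IsOpen {x : E2 | 0 < x 0 ∧ 0 < x 1 ∧ x 0 + x 1 < 1} :=
    (isOpen_lt continuous_const h0).inter
      ((isOpen_lt continuous_const h1).inter (isOpen_lt (h0.add h1) continuous_const))
  refine interior_maximal (fun x hx => ?_) ho ?_
  · exact ⟨hx.1.le, hx.2.1.le, hx.2.2.le⟩
  · norm_num

lemma uniqueDiffOn_refTriangle : UniqueDiffOn ℝ refTriangle :=
  uniqueDiffOn_convex convex_refTriangle interior_refTriangle_nonempty

lemma restrict_interior_refTriangle :
    (volume.restrict (interior refTriangle) : Measure E2) = volume.restrict refTriangle := by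
  refine Measure.restrict_congr_set ?_
  refine eventuallyLE_antisymm_iff.2 ⟨?_, ?_⟩
  · exact LE.le.eventuallyLE (interior_subset : interior refTriangle ⊆ refTriangle)
  · rw [ae_le_set]
    refine measure_mono_null ?_ (convex_refTriangle.addHaar_frontier volume)
    intro x hx
    exact ⟨subset_closure hx.1, hx.2⟩

instance isFiniteMeasure_refTriangle :
    IsFiniteMeasure (volume.restrict refTriangle : Measure E2) :=
  ⟨by rw [Measure.restrict_apply_univ]; exact isCompact_refTriangle.measure_lt_top⟩

end RefTriangle

/-! ### Combinatorics of the mesh -/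

section Realize

lemma realize_apply {a : Fin 3 → ℕ} (ha : Function.Injective a) (x : E2) (i : Fin 3) :
    realize a x (a i) = baryCoord x i := by
  rw [realize, Finset.sum_apply, Finset.sum_eq_single i]
  · simp
  · intro j _ hj
    exact Pi.single_eq_of_ne (ha.ne hj.symm) _
  · simp

lemma realize_apply_of_notMem (a : Fin 3 → ℕ) (x : E2) {m : ℕ} (hm : m ∉ range a) :
    realize a x m = 0 := by
  rw [realize, Finset.sum_apply]
  refine Finset.sum_eq_zero fun j _ => Pi.single_eq_of_ne ?_ _
  rintro rfl
  exact hm ⟨j, rfl⟩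

lemma baryCoord_injective : Function.Injective baryCoord := by
  intro x y h
  ext i
  fin_cases i
  · exact congrFun h 1
  · exact congrFun h 2

lemma realize_injective {a : Fin 3 → ℕ} (ha : Function.Injective a) :
    Function.Injective (realize a) := by
  intro x y h
  refine baryCoord_injective (funext fun i => ?_)
  rw [← realize_apply ha, ← realize_apply ha, h]

end Realize

/-! ### Element parametrizations -/

section Polynomial

lemma contDiff_eval (P : MvPolynomial (Fin 2) ℝ) {n : WithTop ℕ∞} :
    ContDiff ℝ n fun x : E2 => MvPolynomial.eval (fun j => x j) P := by
  induction P using MvPolynomial.induction_on with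
  | C a => simpa using contDiff_const
  | add p q hp hq => simpa using hp.add hq
  | mul_X p i hp =>
    simp only [map_mul, MvPolynomial.eval_X]
    exact hp.mul (by fun_prop)

lemma contDiff_polyMap (P : Fin 3 → MvPolynomial (Fin 2) ℝ) {n : WithTop ℕ∞} :
    ContDiff ℝ n (polyMap P) :=
  contDiff_euclidean.2 fun i => contDiff_eval (P i)

end Polynomial

namespace Triangulation

variable {kg : ℕ} (T : Triangulation kg)

lemma contDiff_F (K : Fin T.card) {n : WithTop ℕ∞} : ContDiff ℝ n (T.F K) := contDiff_polyMap _

lemma hasFDerivAt_F (K : Fin T.card) (x : E2) : HasFDerivAt (T.F K) (T.DF K x) x :=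
  ((T.contDiff_F K (n := 1)).differentiable (by simp) x).hasFDerivAt

lemma hasStrictFDerivAt_F (K : Fin T.card) (x : E2) : HasStrictFDerivAt (T.F K) (T.DF K x) x :=
  (T.contDiff_F K (n := 1)).hasStrictFDerivAt (by simp)

lemma continuous_F (K : Fin T.card) : Continuous (T.F K) := (T.contDiff_F K (n := 1)).continuous

lemma continuous_DF (K : Fin T.card) : Continuous (T.DF K) :=
  (T.contDiff_F K (n := 1)).continuous_fderiv (by simp)

lemma injOn_F (K : Fin T.card) : InjOn (T.F K) refTriangle := fun x hx y hy h =>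
  realize_injective (T.vert_injective K) ((T.glue K K x hx y hy).1 h)

lemma F_mem_surface (K : Fin T.card) {x : E2} (hx : x ∈ refTriangle) : T.F K x ∈ T.surface :=
  mem_iUnion.2 ⟨K, mem_image_of_mem _ hx⟩

/-- An interior point of an element belongs to no other element. -/
lemma eq_of_F_eq {K L : Fin T.card} {x y : E2} (hx : x ∈ interior refTriangle)
    (hy : y ∈ refTriangle) (h : T.F K x = T.F L y) : K = L := by
  have hr := (T.glue K L x (interior_subset hx) y hy).1 h
  have hsub : range (T.vert K) ⊆ range (T.vert L) := by
    rintro _ ⟨i, rfl⟩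
    by_contra hn
    have h1 := realize_apply (T.vert_injective K) x i
    rw [hr, realize_apply_of_notMem _ _ hn] at h1
    exact (baryCoord_pos hx i).ne h1
  refine T.eq_of_range_eq K L (eq_of_subset_of_ncard_le hsub ?_ (finite_range _))
  rw [ncard_range_of_injective (T.vert_injective K), ncard_range_of_injective (T.vert_injective L)]

/-- Continuity of a function on a union of finitely many compact patches can be checked in the
parameters. -/
lemma continuousOn_iUnion_image {α : Type*} [TopologicalSpace α] {N : ℕ} {f : Fin N → E2 → E3}
    (hf : ∀ K, ContinuousOn (f K) refTriangle) {v : E3 → α}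
    (hv : ∀ K, ContinuousOn (fun x => v (f K x)) refTriangle) :
    ContinuousOn v (⋃ K, f K '' refTriangle) := by
  have key : ∀ K, ContinuousOn v (f K '' refTriangle) := by
    intro K
    rw [continuousOn_iff_isClosed]
    intro t ht
    obtain ⟨u, hu, hut⟩ := continuousOn_iff_isClosed.1 (hv K) t ht
    refine ⟨f K '' (u ∩ refTriangle), ((isCompact_refTriangle.inter_left hu).image_of_continuousOn
      ((hf K).mono inter_subset_right)).isClosed, ?_⟩
    rw [← hut]
    ext y
    constructor
    · rintro ⟨h1, x, hx, rfl⟩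
      exact ⟨⟨x, ⟨h1, hx⟩, rfl⟩, x, hx, rfl⟩
    · rintro ⟨⟨x, ⟨h1, hx⟩, rfl⟩, -⟩
      exact ⟨h1, x, hx, rfl⟩
  exact (locallyFinite_of_finite _).continuousOn_iUnion
    (fun K => (isCompact_refTriangle.image_of_continuousOn (hf K)).isClosed) key

section Quasi

variable {T} {c h : ℝ}

lemma QuasiUniform.norm_F_sub_le (hQ : T.QuasiUniform c h) (hc : 0 < c) (hh : 0 < h)
    (K : Fin T.card) {x y : E2}
    (hx : x ∈ refTriangle) (hy : y ∈ refTriangle) : ‖T.F K x - T.F K y‖ ≤ c * h * ‖x - y‖ := by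
  refine convex_refTriangle.norm_image_sub_le_of_norm_hasFDerivWithin_le
    (fun z _ => (T.hasFDerivAt_F K z).hasFDerivWithinAt) (fun z hz => ?_) hy hx
  exact ContinuousLinearMap.opNorm_le_bound _ (by positivity) fun ξ => (hQ K z hz ξ).2

end Quasi

section Gram

variable {T} {c h : ℝ}

lemma inner_gram (K : Fin T.card) (x ξ η : E2) :
    ⟪T.gram K x ξ, η⟫ = ⟪T.DF K x ξ, T.DF K x η⟫ := by
  rw [gram, ContinuousLinearMap.comp_apply, ContinuousLinearMap.adjoint_inner_left]

lemma det_gram (K : Fin T.card) (x : E2) :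
    (T.gram K x).det = ‖T.DF K x !₂[1, 0]‖ ^ 2 * ‖T.DF K x !₂[0, 1]‖ ^ 2 -
      ⟪T.DF K x !₂[1, 0], T.DF K x !₂[0, 1]⟫ ^ 2 := by
  have hb0 : EuclideanSpace.basisFun (Fin 2) ℝ 0 = !₂[1, 0] := by
    ext i; fin_cases i <;> simp
  have hb1 : EuclideanSpace.basisFun (Fin 2) ℝ 1 = !₂[0, 1] := by
    ext i; fin_cases i <;> simp
  have hdet : (T.gram K x).det = (LinearMap.toMatrix (EuclideanSpace.basisFun (Fin 2) ℝ).toBasis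
      (EuclideanSpace.basisFun (Fin 2) ℝ).toBasis (T.gram K x).toLinearMap).det := by
    rw [LinearMap.det_toMatrix]
  have hentry : ∀ i j, LinearMap.toMatrix (EuclideanSpace.basisFun (Fin 2) ℝ).toBasis
      (EuclideanSpace.basisFun (Fin 2) ℝ).toBasis (T.gram K x).toLinearMap i j =
      ⟪T.DF K x (EuclideanSpace.basisFun (Fin 2) ℝ j),
        T.DF K x (EuclideanSpace.basisFun (Fin 2) ℝ i)⟫ := by
    intro i j
    rw [LinearMap.toMatrix_apply, ← inner_gram, real_inner_comm]
    simp [OrthonormalBasis.repr_apply_apply]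
  rw [hdet, Matrix.det_fin_two, hentry, hentry, hentry, hentry, hb0, hb1,
    real_inner_self_eq_norm_sq, real_inner_self_eq_norm_sq,
    real_inner_comm (T.DF K x !₂[1, 0]) (T.DF K x !₂[0, 1])]
  ring

lemma QuasiUniform.areaElement_bounds (hQ : T.QuasiUniform c h) (hc : 0 < c) (hh : 0 < h)
    (K : Fin T.card) {x : E2} (hx : x ∈ refTriangle) :
    (c⁻¹ * h) ^ 2 ≤ T.areaElement K x ∧ T.areaElement K x ≤ (c * h) ^ 2 := by
  set u := T.DF K x !₂[1, 0] with hu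
  set v := T.DF K x !₂[0, 1] with hv
  have hn0 : ‖(!₂[1, 0] : E2)‖ = 1 := by simp [EuclideanSpace.norm_eq]
  have hn1 : ‖(!₂[0, 1] : E2)‖ = 1 := by simp [EuclideanSpace.norm_eq]
  obtain ⟨hu1, hu2⟩ := hQ K x hx !₂[1, 0]
  obtain ⟨hv1, hv2⟩ := hQ K x hx !₂[0, 1]
  rw [hn0, mul_one, ← hu] at hu1 hu2
  rw [hn1, mul_one, ← hv] at hv1 hv2
  have ha : 0 < c⁻¹ * h := by positivity
  have hupos : 0 < ‖u‖ ^ 2 := by have := ha.trans_le hu1; positivity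
  rw [areaElement, det_gram, ← hu, ← hv]
  constructor
  · refine Real.le_sqrt_of_sq_le ?_
    -- the component of `v` orthogonal to `u`
    set t := -(⟪u, v⟫ / ‖u‖ ^ 2) with ht
    have h1 := (hQ K x hx (!₂[0, 1] + t • !₂[1, 0])).1
    rw [map_add, map_smul, ← hu, ← hv] at h1
    have h2 : 1 ≤ ‖(!₂[0, 1] + t • !₂[1, 0] : E2)‖ := by
      rw [EuclideanSpace.norm_eq]
      refine Real.le_sqrt_of_sq_le ?_
      simp [Fin.sum_univ_two]
      positivity
    have h3 : c⁻¹ * h ≤ ‖v + t • u‖ := by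
      refine le_trans ?_ h1
      nlinarith
    have h4 : ‖v + t • u‖ ^ 2 = ‖v‖ ^ 2 - ⟪u, v⟫ ^ 2 / ‖u‖ ^ 2 := by
      rw [norm_add_sq_real, real_inner_smul_right, norm_smul, Real.norm_eq_abs, mul_pow, sq_abs,
        real_inner_comm, ht]
      field_simp
      ring
    have h5 : (c⁻¹ * h) ^ 2 ≤ ‖v‖ ^ 2 - ⟪u, v⟫ ^ 2 / ‖u‖ ^ 2 := by rw [← h4]; gcongr
    have h6 : (c⁻¹ * h) ^ 2 ≤ ‖u‖ ^ 2 := by gcongr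
    calc ((c⁻¹ * h) ^ 2) ^ 2 = (c⁻¹ * h) ^ 2 * (c⁻¹ * h) ^ 2 := by ring
      _ ≤ ‖u‖ ^ 2 * (‖v‖ ^ 2 - ⟪u, v⟫ ^ 2 / ‖u‖ ^ 2) := by gcongr
      _ = _ := by rw [mul_sub, mul_div_cancel₀ _ hupos.ne']
  · refine Real.sqrt_le_iff.2 ⟨by positivity, ?_⟩
    have h5 : ‖u‖ ^ 2 ≤ (c * h) ^ 2 := by gcongr
    have h6 : ‖v‖ ^ 2 ≤ (c * h) ^ 2 := by gcongr
    have h7 : ‖u‖ ^ 2 * ‖v‖ ^ 2 ≤ (c * h) ^ 2 * (c * h) ^ 2 := by gcongr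
    nlinarith [sq_nonneg ⟪u, v⟫]

lemma continuous_gram (K : Fin T.card) : Continuous (T.gram K) := by
  have := T.continuous_DF K
  unfold gram
  exact ((ContinuousLinearMap.adjoint (𝕜 := ℝ) (E := E2) (F := E3)).continuous.comp this).clm_comp
    this

lemma continuous_areaElement (K : Fin T.card) : Continuous (T.areaElement K) := by
  have := T.continuous_DF K
  have e : T.areaElement K = fun x => Real.sqrt (‖T.DF K x !₂[1, 0]‖ ^ 2 *
      ‖T.DF K x !₂[0, 1]‖ ^ 2 - ⟪T.DF K x !₂[1, 0], T.DF K x !₂[0, 1]⟫ ^ 2) := by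
    ext x
    rw [areaElement, det_gram]
  rw [e]
  fun_prop

lemma areaElement_nonneg (K : Fin T.card) (x : E2) : 0 ≤ T.areaElement K x := Real.sqrt_nonneg _

lemma QuasiUniform.isInvertible_gram (hQ : T.QuasiUniform c h) (hc : 0 < c) (hh : 0 < h)
    (K : Fin T.card) {x : E2} (hx : x ∈ refTriangle) : (T.gram K x).IsInvertible := by
  have hinj : Function.Injective (T.gram K x).toLinearMap := by
    rw [← LinearMap.ker_eq_bot, LinearMap.ker_eq_bot']
    intro ξ hξ
    have h1 : ‖T.DF K x ξ‖ ^ 2 = 0 := by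
      rw [← real_inner_self_eq_norm_sq, ← inner_gram]
      have : T.gram K x ξ = 0 := hξ
      rw [this, inner_zero_left]
    have h2 := (hQ K x hx ξ).1
    rw [pow_eq_zero_iff two_ne_zero] at h1
    rw [h1] at h2
    have : 0 < c⁻¹ * h := by positivity
    have h3 : ‖ξ‖ ≤ 0 := by
      by_contra! h4
      exact absurd h2 (not_le.2 (mul_pos this h4))
    exact norm_le_zero_iff.1 h3
  refine ⟨(LinearEquiv.ofInjectiveEndo (T.gram K x).toLinearMap hinj).toContinuousLinearEquiv, ?_⟩
  ext ξ : 1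
  rfl

lemma gram_inverse_apply (hinv : ∀ K, ∀ x ∈ refTriangle, (T.gram K x).IsInvertible)
    (K : Fin T.card) {x : E2} (hx : x ∈ refTriangle) (ξ : E2) :
    T.gram K x ((T.gram K x).inverse ξ) = ξ := by
  obtain ⟨e, he⟩ := hinv K x hx
  rw [← he, ContinuousLinearMap.inverse_equiv]
  simp

end Gram

end Triangulation

/-! ### The closest point mapping on the discrete surface -/

/-- A set with a locally expanding injective parametrization is bounded below in area. -/
lemma volume_le_of_locally_antilipschitz {f : E2 → E3} {B : Set E2} (hB : MeasurableSet B)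
    (hf : ContinuousOn f B) (hinj : InjOn f B) {K : ℝ≥0}
    (hloc : ∀ x ∈ B, ∃ U ∈ 𝓝 x, ∀ y ∈ U ∩ B, ∀ z ∈ U ∩ B, dist y z ≤ K * dist (f y) (f z)) :
    volume B ≤ K ^ 2 * (Measure.euclideanHausdorffMeasure 2 : Measure E3) (f '' B) := by
  rcases B.eq_empty_or_nonempty with rfl | hne
  · simp
  have hloc' : ∀ x ∈ B, ∃ U, IsOpen U ∧ x ∈ U ∧
      ∀ y ∈ U ∩ B, ∀ z ∈ U ∩ B, dist y z ≤ K * dist (f y) (f z) := by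
    intro x hx
    obtain ⟨U, hU, h⟩ := hloc x hx
    obtain ⟨V, hVU, hVo, hxV⟩ := mem_nhds_iff.1 hU
    exact ⟨V, hVo, hxV, fun y hy z hz => h y ⟨hVU hy.1, hy.2⟩ z ⟨hVU hz.1, hz.2⟩⟩
  choose! U hUo hxU hU using hloc'
  obtain ⟨t, htB, htc, hcov⟩ := TopologicalSpace.countable_cover_nhdsWithin (f := U) (s := B)
    fun x hx => mem_nhdsWithin_of_mem_nhds ((hUo x hx).mem_nhds (hxU x hx))
  have htne : t.Nonempty := by
    obtain ⟨x, hx⟩ := hne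
    obtain ⟨y, hy, -⟩ := mem_iUnion₂.1 (hcov hx)
    exact ⟨y, hy⟩
  obtain ⟨e, rfl⟩ := htc.exists_eq_range htne
  have heB : ∀ n, e n ∈ B := fun n => htB ⟨n, rfl⟩
  set D : ℕ → Set E2 := disjointed fun n => U (e n) with hD
  have hDU : ∀ n, D n ⊆ U (e n) := fun n => disjointed_subset _ n
  have hDm : ∀ n, MeasurableSet (D n ∩ B) := fun n =>
    (MeasurableSet.disjointed (fun n => (hUo _ (heB n)).measurableSet) n).inter hB
  have hDd : Pairwise (Function.onFun Disjoint fun n => D n ∩ B) := fun i j hij =>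
    (disjoint_disjointed _ hij).mono inter_subset_left inter_subset_left
  have hunion : ⋃ n, D n ∩ B = B := by
    rw [← iUnion_inter, iUnion_disjointed, inter_eq_right]
    rwa [biUnion_range] at hcov
  have himd : Pairwise (Function.onFun Disjoint fun n => f '' (D n ∩ B)) := fun i j hij =>
    (hDd hij).image hinj inter_subset_right inter_subset_right
  calc volume B = ∑' n, volume (D n ∩ B) := by
        rw [← measure_iUnion hDd hDm, hunion]
    _ ≤ ∑' n, K ^ 2 * (Measure.euclideanHausdorffMeasure 2 : Measure E3) (f '' (D n ∩ B)) := by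
        refine ENNReal.tsum_le_tsum fun n => ?_
        rw [volume_E2_eq]
        exact le_euclideanHausdorffMeasure_image fun x hx y hy =>
          hU _ (heB n) x ⟨hDU n hx.1, hx.2⟩ y ⟨hDU n hy.1, hy.2⟩
    _ = K ^ 2 * (Measure.euclideanHausdorffMeasure 2 : Measure E3) (f '' B) := by
        rw [ENNReal.tsum_mul_left, ← measure_iUnion himd fun n =>
          (hDm n).image_of_continuousOn_injOn (hf.mono inter_subset_right)
            (hinj.mono inter_subset_right), ← image_iUnion, hunion]

lemma _root_.HasStrictFDerivAt.exists_norm_sub_le {E F : Type*} [NormedAddCommGroup E]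
    [NormedSpace ℝ E] [NormedAddCommGroup F] [NormedSpace ℝ F] {f : E → F} {f' : E →L[ℝ] F} {x : E}
    (hf : HasStrictFDerivAt f f' x) {ε : ℝ} (hε : 0 < ε) :
    ∃ V ∈ 𝓝 x, ∀ y ∈ V, ∀ z ∈ V, ‖f y - f z - f' (y - z)‖ ≤ ε * ‖y - z‖ := by
  have hb := hf.isLittleO.bound hε
  rw [nhds_prod_eq] at hb
  obtain ⟨V, hV, hb⟩ := mem_prod_same_iff.1 hb
  exact ⟨V, hV, fun y hy z hz => hb (mk_mem_prod hy hz)⟩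

/-- Subtracting a multiple of a unit vector `n` that is almost orthogonal to `w` does not make `w`
much shorter. -/
lemma norm_le_of_eq_sub_smul {n w d e k : E3} {s t : ℝ} (hn : ‖n‖ = 1)
    (hd : d = w + e - s • k - t • n) (hw : |⟪n, w⟫| ≤ 1 / 8 * ‖w‖) :
    7 / 8 * ‖w‖ ≤ ‖d‖ + ‖e‖ + |s| * ‖k‖ := by
  -- `P` is the orthogonal projection along `n`
  set P : E3 →L[ℝ] E3 := ContinuousLinearMap.id ℝ E3 - (innerSL ℝ n).smulRight n with hP
  have hPv : ∀ v, P v = v - ⟪n, v⟫ • n := fun v => rfl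
  have hPle : ∀ v, ‖P v‖ ≤ ‖v‖ := by
    intro v
    have : ‖P v‖ ^ 2 = ‖v‖ ^ 2 - ⟪n, v⟫ ^ 2 := by
      rw [hPv, norm_sub_sq_real, real_inner_smul_right, norm_smul, hn, real_inner_comm,
        Real.norm_eq_abs, mul_one, sq_abs]
      ring
    refine le_of_sq_le_sq ?_ (norm_nonneg _)
    rw [this]
    linarith [sq_nonneg ⟪n, v⟫]
  have hPn : P n = 0 := by
    rw [hPv, real_inner_self_eq_norm_sq, hn]
    simp
  have h1 : 7 / 8 * ‖w‖ ≤ ‖P w‖ := by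
    have h2 : w = P w + ⟪n, w⟫ • n := by rw [hPv]; abel
    have h3 : ‖w‖ ≤ ‖P w‖ + ‖⟪n, w⟫ • n‖ := by
      conv_lhs => rw [h2]
      exact norm_add_le _ _
    rw [norm_smul, hn, mul_one, Real.norm_eq_abs] at h3
    linarith
  have h2 : P w = P d - P e + s • P k := by
    rw [hd, map_sub, map_sub, map_add, map_smul, map_smul, hPn]
    module
  calc 7 / 8 * ‖w‖ ≤ ‖P d - P e + s • P k‖ := h2 ▸ h1
    _ ≤ ‖P d‖ + ‖P e‖ + ‖s • P k‖ := (norm_add_le _ _).trans (by gcongr; exact norm_sub_le _ _)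
    _ ≤ ‖d‖ + ‖e‖ + |s| * ‖k‖ := by
      rw [norm_smul, Real.norm_eq_abs]
      gcongr <;> exact hPle _

namespace Triangulation

variable {kg : ℕ}

/-- The parametrization `p ∘ F_K` of a patch of the exact surface. -/
noncomputable def lift (T : Triangulation kg) (Ω : Set E3) (K : Fin T.card) (x : E2) : E3 :=
  closestPoint (frontier Ω) (T.F K x)

/-- A triangulation that satisfies the assumptions on the mesh, with mesh size so small that the
discrete and the exact normal differ only slightly over each element. The number `L` is a Lipschitz
constant of the exact normal. -/
structure IsFine (T : Triangulation kg) (Ω : Set E3) (δ₀ c h : ℝ) (L : ℝ≥0) : Prop where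
  surf : BoundsSmoothSurface Ω
  unique : ∀ x ∈ tube Ω δ₀, ∃! y, IsClosestPoint (frontier Ω) x y
  lipschitz : LipschitzOnWith L (normal Ω) (frontier Ω)
  c_pos : 0 < c
  h_pos : 0 < h
  h_le_one : h ≤ 1
  small : (4 * c * L + c) * h ≤ 1 / 8
  one_le : 1 ≤ kg
  quasi : T.QuasiUniform c h
  approx : T.Approximates Ω δ₀ c h

namespace IsFine

variable {T : Triangulation kg} {Ω : Set E3} {δ₀ c h : ℝ} {L : ℝ≥0}

lemma pow_le (H : T.IsFine Ω δ₀ c h L) : h ^ kg ≤ h := by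
  simpa using pow_le_pow_of_le_one H.h_pos.le H.h_le_one H.one_le

lemma mul_sq_le (H : T.IsFine Ω δ₀ c h L) : c * h ^ 2 * L ≤ 1 / 32 := by
  have h1 := H.small
  have h2 := H.h_le_one
  have h3 := H.h_pos
  have h4 := H.c_pos
  have h5 : (0 : ℝ) ≤ L := L.2
  have h6 : c * L * h * h ≤ c * L * h * 1 := by gcongr
  have h7 : 0 < c * h := by positivity
  nlinarith

lemma abs_rho_le (H : T.IsFine Ω δ₀ c h L) {a : E3} (ha : a ∈ T.surface) :
    |rho Ω a| ≤ c * h ^ 2 := by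
  refine (H.approx.rho_le a ha).trans ?_
  have := H.c_pos
  gcongr ?_ * ?_
  exact pow_le_pow_of_le_one H.h_pos.le H.h_le_one (by linarith [H.one_le])

lemma closestPoint_mem (H : T.IsFine Ω δ₀ c h L) {a : E3} (ha : a ∈ T.surface) :
    closestPoint (frontier Ω) a ∈ frontier Ω := H.approx.bijOn.mapsTo ha

lemma sub_closestPoint (H : T.IsFine Ω δ₀ c h L) {a : E3} (ha : a ∈ T.surface) :
    a - closestPoint (frontier Ω) a = rho Ω a • normal Ω (closestPoint (frontier Ω) a) :=
  (isClosestPoint_closestPoint H.unique (H.approx.subset_tube ha)).sub_eq H.surf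

lemma norm_normal_sub_le (H : T.IsFine Ω δ₀ c h L) {y z : E3} (hy : y ∈ frontier Ω)
    (hz : z ∈ frontier Ω) : ‖normal Ω y - normal Ω z‖ ≤ L * ‖y - z‖ := by
  rw [← dist_eq_norm, ← dist_eq_norm]
  exact H.lipschitz.dist_le_mul y hy z hz

lemma norm_closestPoint_sub_le (H : T.IsFine Ω δ₀ c h L) {a b : E3} (ha : a ∈ T.surface)
    (hb : b ∈ T.surface) :
    ‖closestPoint (frontier Ω) a - closestPoint (frontier Ω) b‖ ≤ 4 * ‖a - b‖ := by
  set pa := closestPoint (frontier Ω) a with hpa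
  set pb := closestPoint (frontier Ω) b with hpb
  have ha1 := H.sub_closestPoint ha
  have hb1 := H.sub_closestPoint hb
  rw [← hpa] at ha1
  rw [← hpb] at hb1
  have hab := H.closestPoint_mem ha
  have hbb := H.closestPoint_mem hb
  have e : pa - pb = (a - b) - rho Ω a • (normal Ω pa - normal Ω pb)
      - (rho Ω a - rho Ω b) • normal Ω pb := by
    have e1 : pa = a - rho Ω a • normal Ω pa := by rw [← ha1]; abel
    have e2 : pb = b - rho Ω b • normal Ω pb := by rw [← hb1]; abel
    calc pa - pb = (a - rho Ω a • normal Ω pa) - (b - rho Ω b • normal Ω pb) := by rw [← e1, ← e2]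
      _ = _ := by module
  have hc := H.c_pos
  have h1 : ‖pa - pb‖ ≤ ‖a - b‖ + c * h ^ 2 * (L * ‖pa - pb‖) + ‖a - b‖ := by
    calc ‖pa - pb‖ ≤ ‖a - b‖ + ‖rho Ω a • (normal Ω pa - normal Ω pb)‖
          + ‖(rho Ω a - rho Ω b) • normal Ω pb‖ := by
          rw [e]
          exact (norm_sub_le _ _).trans (by gcongr; exact norm_sub_le _ _)
      _ ≤ _ := by
          rw [norm_smul, norm_smul, norm_normal H.surf hbb, mul_one, Real.norm_eq_abs,
            Real.norm_eq_abs]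
          gcongr
          · exact H.abs_rho_le ha
          · exact H.norm_normal_sub_le hab hbb
          · exact abs_rho_sub_le H.surf.isOpen a b
  have h2 := H.mul_sq_le
  have h3 : c * h ^ 2 * L * ‖pa - pb‖ ≤ 1 / 32 * ‖pa - pb‖ := by gcongr
  linarith [norm_nonneg (a - b), norm_nonneg (pa - pb)]

lemma lift_mem (H : T.IsFine Ω δ₀ c h L) (K : Fin T.card) {x : E2} (hx : x ∈ refTriangle) :
    T.lift Ω K x ∈ frontier Ω := H.closestPoint_mem (T.F_mem_surface K hx)

lemma lipschitzOnWith_lift (H : T.IsFine Ω δ₀ c h L) (K : Fin T.card) :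
    LipschitzOnWith (4 * c * h).toNNReal (T.lift Ω K) refTriangle := by
  have := H.c_pos
  have := H.h_pos
  refine LipschitzOnWith.of_dist_le_mul fun x hx y hy => ?_
  rw [dist_eq_norm, dist_eq_norm, Real.coe_toNNReal _ (by positivity)]
  calc _ ≤ 4 * ‖T.F K x - T.F K y‖ :=
        H.norm_closestPoint_sub_le (T.F_mem_surface K hx) (T.F_mem_surface K hy)
    _ ≤ 4 * (c * h * ‖x - y‖) := by
        gcongr
        exact H.quasi.norm_F_sub_le H.c_pos H.h_pos K hx hy
    _ = _ := by ring

lemma continuousOn_lift (H : T.IsFine Ω δ₀ c h L) (K : Fin T.card) :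
    ContinuousOn (T.lift Ω K) refTriangle := (H.lipschitzOnWith_lift K).continuousOn

lemma injOn_lift (H : T.IsFine Ω δ₀ c h L) (K : Fin T.card) : InjOn (T.lift Ω K) refTriangle :=
  fun _ hx _ hy hxy => T.injOn_F K hx hy
    (H.approx.bijOn.injOn (T.F_mem_surface K hx) (T.F_mem_surface K hy) hxy)

lemma eq_of_lift_eq (H : T.IsFine Ω δ₀ c h L) {K K' : Fin T.card} {x y : E2}
    (hx : x ∈ interior refTriangle) (hy : y ∈ refTriangle) (hxy : T.lift Ω K x = T.lift Ω K' y) :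
    K = K' :=
  T.eq_of_F_eq hx hy (H.approx.bijOn.injOn (T.F_mem_surface K (interior_subset hx))
    (T.F_mem_surface K' hy) hxy)

lemma exists_lift_eq (H : T.IsFine Ω δ₀ c h L) {y : E3} (hy : y ∈ frontier Ω) :
    ∃ K, ∃ x ∈ refTriangle, T.lift Ω K x = y := by
  obtain ⟨a, ha, rfl⟩ := H.approx.bijOn.surjOn hy
  obtain ⟨K, x, hx, rfl⟩ := mem_iUnion.1 ha
  exact ⟨K, x, hx, rfl⟩

lemma norm_normal_lift_sub_le (H : T.IsFine Ω δ₀ c h L) (K : Fin T.card) {x y : E2}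
    (hx : x ∈ refTriangle) (hy : y ∈ refTriangle) :
    ‖normal Ω (T.lift Ω K x) - normal Ω (T.lift Ω K y)‖ ≤ 8 * c * L * h := by
  have := H.c_pos
  have := H.h_pos
  calc _ ≤ L * ‖T.lift Ω K x - T.lift Ω K y‖ :=
        H.norm_normal_sub_le (H.lift_mem K hx) (H.lift_mem K hy)
    _ ≤ L * (4 * c * h * 2) := by
        gcongr
        have h1 := (H.lipschitzOnWith_lift K).dist_le_mul x hx y hy
        rw [Real.coe_toNNReal _ (by positivity), dist_eq_norm, dist_eq_norm] at h1
        refine h1.trans ?_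
        gcongr
        exact norm_sub_le_of_mem_refTriangle hx hy
    _ = _ := by ring

/-- The patch parametrizations `p ∘ F_K` expand by at least `h / (2 c)` between points where `F_K`
is almost linear: they differ from `F_K` by a displacement along the exact normal, which is almost
orthogonal to the element. -/
lemma norm_sub_le_norm_lift_sub (H : T.IsFine Ω δ₀ c h L) (K : Fin T.card) {x y z : E2}
    (hx : x ∈ refTriangle) (hy : y ∈ refTriangle) (hz : z ∈ refTriangle)
    (hlin : ‖T.F K y - T.F K z - T.DF K x (y - z)‖ ≤ c⁻¹ * h / 8 * ‖y - z‖)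
    (hnear : ‖normal Ω (T.lift Ω K z) - normal Ω (T.lift Ω K x)‖ ≤ 4 * c * L * h) :
    ‖y - z‖ ≤ 2 * c / h * ‖T.lift Ω K y - T.lift Ω K z‖ := by
  have hc := H.c_pos
  have hh := H.h_pos
  have hyS := T.F_mem_surface K hy
  have hzS := T.F_mem_surface K hz
  have hGyf := H.lift_mem K hy
  have hGzf := H.lift_mem K hz
  have hn1 := norm_normal H.surf hGzf
  obtain ⟨ν, ⟨hν1, hνD⟩, hνn⟩ := H.approx.normal_le K x hx
  have hνn' : ‖normal Ω (T.lift Ω K x) - ν‖ ≤ c * h :=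
    hνn.trans (mul_le_mul_of_nonneg_left H.pow_le hc.le)
  have hnormal : |⟪normal Ω (T.lift Ω K z), T.DF K x (y - z)⟫| ≤ 1 / 8 * ‖T.DF K x (y - z)‖ := by
    have e : ⟪normal Ω (T.lift Ω K z), T.DF K x (y - z)⟫ =
        ⟪normal Ω (T.lift Ω K z) - normal Ω (T.lift Ω K x), T.DF K x (y - z)⟫
        + ⟪normal Ω (T.lift Ω K x) - ν, T.DF K x (y - z)⟫ := by
      rw [← inner_add_left, sub_add_sub_cancel, inner_sub_left, hνD, sub_zero]
    rw [e]
    calc _ ≤ ‖normal Ω (T.lift Ω K z) - normal Ω (T.lift Ω K x)‖ * ‖T.DF K x (y - z)‖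
          + ‖normal Ω (T.lift Ω K x) - ν‖ * ‖T.DF K x (y - z)‖ :=
          (abs_add_le _ _).trans
            (add_le_add (abs_real_inner_le_norm _ _) (abs_real_inner_le_norm _ _))
      _ ≤ (4 * c * L * h) * ‖T.DF K x (y - z)‖ + (c * h) * ‖T.DF K x (y - z)‖ :=
          add_le_add (mul_le_mul_of_nonneg_right hnear (norm_nonneg _))
            (mul_le_mul_of_nonneg_right hνn' (norm_nonneg _))
      _ = ((4 * c * L + c) * h) * ‖T.DF K x (y - z)‖ := by ring
      _ ≤ _ := mul_le_mul_of_nonneg_right H.small (norm_nonneg _)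
  have hdec : T.lift Ω K y - T.lift Ω K z = T.DF K x (y - z) +
      (T.F K y - T.F K z - T.DF K x (y - z))
      - rho Ω (T.F K y) • (normal Ω (T.lift Ω K y) - normal Ω (T.lift Ω K z))
      - (rho Ω (T.F K y) - rho Ω (T.F K z)) • normal Ω (T.lift Ω K z) := by
    have e1 : T.F K y - T.lift Ω K y = rho Ω (T.F K y) • normal Ω (T.lift Ω K y) :=
      H.sub_closestPoint hyS
    have e2 : T.F K z - T.lift Ω K z = rho Ω (T.F K z) • normal Ω (T.lift Ω K z) :=
      H.sub_closestPoint hzS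
    rw [smul_sub, sub_smul, ← e1, ← e2]
    abel
  have h1 := norm_le_of_eq_sub_smul hn1 hdec hnormal
  have h2 : |rho Ω (T.F K y)| * ‖normal Ω (T.lift Ω K y) - normal Ω (T.lift Ω K z)‖ ≤
      c * h ^ 2 * (L * ‖T.lift Ω K y - T.lift Ω K z‖) :=
    mul_le_mul (H.abs_rho_le hyS) (H.norm_normal_sub_le hGyf hGzf) (norm_nonneg _) (by positivity)
  have h3 : c * h ^ 2 * L * ‖T.lift Ω K y - T.lift Ω K z‖ ≤
      1 / 32 * ‖T.lift Ω K y - T.lift Ω K z‖ :=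
    mul_le_mul_of_nonneg_right H.mul_sq_le (norm_nonneg _)
  have h4 := (H.quasi K x hx (y - z)).1
  have h5 : c⁻¹ * h * ‖y - z‖ ≤ 2 * ‖T.lift Ω K y - T.lift Ω K z‖ := by
    linarith [norm_nonneg (T.lift Ω K y - T.lift Ω K z)]
  calc ‖y - z‖ = c / h * (c⁻¹ * h * ‖y - z‖) := by field_simp
    _ ≤ c / h * (2 * ‖T.lift Ω K y - T.lift Ω K z‖) := by gcongr
    _ = _ := by ring

/-- The patch parametrizations are locally expanding, with a factor `h / (2 c)` that is
independent of the point. -/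
lemma locally_antilipschitz_lift (H : T.IsFine Ω δ₀ c h L) (K : Fin T.card) {x : E2}
    (hx : x ∈ refTriangle) : ∃ U ∈ 𝓝 x, ∀ y ∈ U ∩ refTriangle, ∀ z ∈ U ∩ refTriangle,
      dist y z ≤ (2 * c / h).toNNReal * dist (T.lift Ω K y) (T.lift Ω K z) := by
  have hc := H.c_pos
  have hh := H.h_pos
  obtain ⟨V, hV, hb⟩ := (T.hasStrictFDerivAt_F K x).exists_norm_sub_le
    (show 0 < c⁻¹ * h / 8 by positivity)
  refine ⟨V ∩ Metric.ball x 1, inter_mem hV (Metric.ball_mem_nhds x one_pos), ?_⟩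
  rintro y ⟨⟨hyV, -⟩, hy⟩ z ⟨⟨hzV, hzx⟩, hz⟩
  have hpos : 0 ≤ 2 * c / h := by positivity
  rw [Real.coe_toNNReal _ hpos, dist_eq_norm, dist_eq_norm]
  refine H.norm_sub_le_norm_lift_sub K hx hy hz (hb y hyV z hzV) ?_
  rw [mem_ball_iff_norm] at hzx
  have h1 := (H.lipschitzOnWith_lift K).dist_le_mul z hz x hx
  have hpos' : 0 ≤ 4 * c * h := by positivity
  rw [Real.coe_toNNReal _ hpos', dist_eq_norm, dist_eq_norm] at h1
  have h2 : ‖T.lift Ω K z - T.lift Ω K x‖ ≤ 4 * c * h := by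
    refine h1.trans ?_
    calc 4 * c * h * ‖z - x‖ ≤ 4 * c * h * 1 := mul_le_mul_of_nonneg_left hzx.le hpos'
      _ = 4 * c * h := mul_one _
  calc _ ≤ L * ‖T.lift Ω K z - T.lift Ω K x‖ :=
        H.norm_normal_sub_le (H.lift_mem K hz) (H.lift_mem K hx)
    _ ≤ L * (4 * c * h) := mul_le_mul_of_nonneg_left h2 L.2
    _ = _ := by ring

/-- The sum of the push-forwards of the area of the reference triangle under the patch
parametrizations. -/
noncomputable def _root_.SurfaceDarcy.Triangulation.meshMeasure (T : Triangulation kg)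
    (Ω : Set E3) : Measure E3 :=
  ∑ K, (volume.restrict refTriangle).map (T.lift Ω K)

lemma aemeasurable_lift (H : T.IsFine Ω δ₀ c h L) (K : Fin T.card) :
    AEMeasurable (T.lift Ω K) (volume.restrict refTriangle) :=
  (H.continuousOn_lift K).aemeasurable measurableSet_refTriangle

lemma map_lift_apply (H : T.IsFine Ω δ₀ c h L) (K : Fin T.card) {A : Set E3}
    (hA : MeasurableSet A) :
    (volume.restrict refTriangle).map (T.lift Ω K) A =
      volume (interior refTriangle ∩ T.lift Ω K ⁻¹' A) := by
  rw [Measure.map_apply_of_aemeasurable (H.aemeasurable_lift K) hA,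
    ← restrict_interior_refTriangle, Measure.restrict_apply' isOpen_interior.measurableSet,
    inter_comm]

/-- The images of the open elements are disjoint, so the expansion of the patch parametrizations
bounds the sum of their push-forward measures. -/
lemma meshMeasure_le (H : T.IsFine Ω δ₀ c h L) :
    T.meshMeasure Ω ≤ ((2 * c / h).toNNReal ^ 2 : ℝ≥0∞) • surfaceMeasure Ω := by
  refine Measure.le_iff.2 fun A hA => ?_
  set B : Fin T.card → Set E2 := fun K => interior refTriangle ∩ T.lift Ω K ⁻¹' A with hB
  have hBi : ∀ K, B K ⊆ interior refTriangle := fun K => inter_subset_left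
  have hBr : ∀ K, B K ⊆ refTriangle := fun K => (hBi K).trans interior_subset
  have hBm : ∀ K, MeasurableSet (B K) := by
    intro K
    have h1 := (continuousOn_iff_continuous_domRestrict.1
      ((H.continuousOn_lift K).mono interior_subset)).measurable hA
    have h2 := isOpen_interior.measurableSet.subtype_image h1
    convert h2 using 1
    ext x
    simp [hB, and_comm]
  have hdisj : Pairwise (Function.onFun Disjoint fun K => T.lift Ω K '' B K) := by
    intro K K' hKK'
    refine disjoint_left.2 ?_
    rintro _ ⟨x, hx, rfl⟩ ⟨y, hy, hxy⟩
    exact hKK' (H.eq_of_lift_eq (hBi K hx) (hBr K' hy) hxy.symm)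
  have him : ∀ K, MeasurableSet (T.lift Ω K '' B K) := fun K =>
    (hBm K).image_of_continuousOn_injOn ((H.continuousOn_lift K).mono (hBr K))
      ((H.injOn_lift K).mono (hBr K))
  rw [meshMeasure, Measure.finsetSum_apply, Measure.smul_apply, smul_eq_mul]
  calc ∑ K, (volume.restrict refTriangle).map (T.lift Ω K) A = ∑ K, volume (B K) :=
        Finset.sum_congr rfl fun K _ => H.map_lift_apply K hA
    _ ≤ ∑ K, ((2 * c / h).toNNReal ^ 2 : ℝ≥0∞) *
          (Measure.euclideanHausdorffMeasure 2 : Measure E3) (T.lift Ω K '' B K) := by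
        refine Finset.sum_le_sum fun K _ => ?_
        refine volume_le_of_locally_antilipschitz (hBm K) ((H.continuousOn_lift K).mono (hBr K))
          ((H.injOn_lift K).mono (hBr K)) fun x hx => ?_
        obtain ⟨U, hU, hanti⟩ := H.locally_antilipschitz_lift K (hBr K hx)
        exact ⟨U, hU, fun y hy z hz => hanti y ⟨hy.1, hBr K hy.2⟩ z ⟨hz.1, hBr K hz.2⟩⟩
    _ = ((2 * c / h).toNNReal ^ 2 : ℝ≥0∞) *
          (Measure.euclideanHausdorffMeasure 2 : Measure E3) (⋃ K, T.lift Ω K '' B K) := by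
        rw [← Finset.mul_sum, measure_iUnion hdisj him, tsum_fintype]
    _ ≤ _ := by
        refine mul_le_mul' le_rfl ?_
        rw [surfaceMeasure, Measure.restrict_apply hA]
        refine measure_mono (iUnion_subset fun K => ?_)
        rintro _ ⟨x, hx, rfl⟩
        exact ⟨hx.2, H.lift_mem K (hBr K hx)⟩

/-- The images of the elements cover the surface, and the patch parametrizations are Lipschitz. -/
lemma surfaceMeasure_le (H : T.IsFine Ω δ₀ c h L) :
    surfaceMeasure Ω ≤ ((4 * c * h).toNNReal ^ 2 : ℝ≥0∞) • T.meshMeasure Ω := by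
  refine Measure.le_iff.2 fun A hA => ?_
  rw [meshMeasure, Measure.smul_apply, Measure.finsetSum_apply, smul_eq_mul, surfaceMeasure,
    Measure.restrict_apply hA]
  calc (Measure.euclideanHausdorffMeasure 2 : Measure E3) (A ∩ frontier Ω)
      ≤ (Measure.euclideanHausdorffMeasure 2 : Measure E3)
          (⋃ K, T.lift Ω K '' (refTriangle ∩ T.lift Ω K ⁻¹' A)) := by
        refine measure_mono ?_
        rintro y ⟨hyA, hy⟩
        obtain ⟨K, x, hx, rfl⟩ := H.exists_lift_eq hy
        exact mem_iUnion.2 ⟨K, x, ⟨hx, hyA⟩, rfl⟩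
    _ ≤ ∑ K, (Measure.euclideanHausdorffMeasure 2 : Measure E3)
          (T.lift Ω K '' (refTriangle ∩ T.lift Ω K ⁻¹' A)) := measure_iUnion_fintype_le _ _
    _ ≤ ∑ K, ((4 * c * h).toNNReal ^ 2 : ℝ≥0∞) *
          (volume.restrict refTriangle).map (T.lift Ω K) A := by
        refine Finset.sum_le_sum fun K _ => ?_
        rw [Measure.map_apply_of_aemeasurable (H.aemeasurable_lift K) hA,
          Measure.restrict_apply' measurableSet_refTriangle, inter_comm refTriangle, volume_E2_eq]
        exact euclideanHausdorffMeasure_image_le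
          ((H.lipschitzOnWith_lift K).mono inter_subset_right)
    _ = _ := by rw [← Finset.mul_sum]

lemma lintegral_meshMeasure (H : T.IsFine Ω δ₀ c h L) {F : E3 → ℝ≥0∞} (hF : Measurable F) :
    ∫⁻ y, F y ∂(T.meshMeasure Ω) = ∑ K, ∫⁻ x in refTriangle, F (T.lift Ω K x) := by
  rw [meshMeasure, lintegral_finsetSum_measure]
  exact Finset.sum_congr rfl fun K _ => lintegral_map' hF.aemeasurable (H.aemeasurable_lift K)

end IsFine

end Triangulation

namespace Triangulation

variable {kg : ℕ} {T : Triangulation kg}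

/-! ### The Lebesgue space of elementwise fields -/

section L2

variable {α : Type*} [NormedAddCommGroup α]

/-- The field is square integrable on each element. -/
def IsL2 (v : T.Field α) : Prop := ∀ K, MemLp (v K) 2 (volume.restrict refTriangle)

lemma IsL2.of_continuousOn {v : T.Field α} (hv : ∀ K, ContinuousOn (v K) refTriangle) :
    IsL2 v := by
  intro K
  obtain ⟨C, hC⟩ := isCompact_refTriangle.exists_bound_of_continuousOn (hv K)
  refine MemLp.of_bound ((hv K).aestronglyMeasurable_of_isCompact isCompact_refTriangle
    measurableSet_refTriangle) C ?_
  exact (ae_restrict_iff' measurableSet_refTriangle).2 (Eventually.of_forall hC)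

lemma IsL2.add {v w : T.Field α} (hv : IsL2 v) (hw : IsL2 w) : IsL2 (v + w) :=
  fun K => (hv K).add (hw K)

lemma IsL2.sub {v w : T.Field α} (hv : IsL2 v) (hw : IsL2 w) : IsL2 (v - w) :=
  fun K => (hv K).sub (hw K)

lemma IsL2.neg {v : T.Field α} (hv : IsL2 v) : IsL2 (-v) := fun K => (hv K).neg

lemma integrableOn_mul_areaElement {K : Fin T.card} {w : E2 → ℝ}
    (hw : IntegrableOn w refTriangle) :
    IntegrableOn (fun x => w x * T.areaElement K x) refTriangle := by
  have hc := (continuous_areaElement (T := T) K).continuousOn (s := refTriangle)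
  exact hw.mul_continuousOn hc isCompact_refTriangle

lemma integral_add {v w : T.Field ℝ} (hv : ∀ K, IntegrableOn (v K) refTriangle)
    (hw : ∀ K, IntegrableOn (w K) refTriangle) :
    T.integral (fun K x => v K x + w K x) = T.integral v + T.integral w := by
  rw [integral, integral, integral, ← Finset.sum_add_distrib]
  refine Finset.sum_congr rfl fun K _ => ?_
  rw [← MeasureTheory.integral_add (integrableOn_mul_areaElement (hv K))
    (integrableOn_mul_areaElement (hw K))]
  simp only [add_mul]

lemma integral_const_mul (t : ℝ) (v : T.Field ℝ) :
    T.integral (fun K x => t * v K x) = t * T.integral v := by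
  rw [integral, integral, Finset.mul_sum]
  refine Finset.sum_congr rfl fun K _ => ?_
  rw [← MeasureTheory.integral_const_mul]
  simp only [mul_assoc]

lemma integral_mono_ae {v w : T.Field ℝ} (hv : ∀ K, IntegrableOn (v K) refTriangle)
    (hw : ∀ K, IntegrableOn (w K) refTriangle)
    (h : ∀ K, ∀ᵐ x ∂(volume.restrict refTriangle), v K x ≤ w K x) :
    T.integral v ≤ T.integral w := by
  refine Finset.sum_le_sum fun K _ => ?_
  refine MeasureTheory.integral_mono_ae (integrableOn_mul_areaElement (hv K))
    (integrableOn_mul_areaElement (hw K)) ?_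
  filter_upwards [h K] with x hx
  exact mul_le_mul_of_nonneg_right hx (areaElement_nonneg K x)

lemma integral_congr_ae {v w : T.Field ℝ}
    (h : ∀ K, ∀ᵐ x ∂(volume.restrict refTriangle), v K x = w K x) :
    T.integral v = T.integral w := by
  refine Finset.sum_congr rfl fun K _ => ?_
  refine MeasureTheory.integral_congr_ae ?_
  filter_upwards [h K] with x hx
  rw [hx]

lemma integral_nonneg {v : T.Field ℝ} (h : ∀ K x, 0 ≤ v K x) : 0 ≤ T.integral v :=
  Finset.sum_nonneg fun K _ => MeasureTheory.integral_nonneg fun x =>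
    mul_nonneg (h K x) (areaElement_nonneg K x)

lemma IsL2.integrableOn_norm_sq {v : T.Field α} (hv : IsL2 v) (K : Fin T.card) :
    IntegrableOn (fun x => ‖v K x‖ ^ 2) refTriangle :=
  (hv K).integrable_norm_pow two_ne_zero

lemma l2norm_nonneg (v : T.Field α) : 0 ≤ T.l2norm v := Real.sqrt_nonneg _

lemma l2norm_sq (v : T.Field α) : T.l2norm v ^ 2 = T.integral fun K x => ‖v K x‖ ^ 2 :=
  Real.sq_sqrt (integral_nonneg fun _ _ => by positivity)

lemma l2norm_le_of_ae {β : Type*} [NormedAddCommGroup β] {v : T.Field α} {w : T.Field β}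
    (hv : IsL2 v) (hw : IsL2 w) {M : ℝ} (hM : 0 ≤ M)
    (h : ∀ K, ∀ᵐ x ∂(volume.restrict refTriangle), ‖v K x‖ ≤ M * ‖w K x‖) :
    T.l2norm v ≤ M * T.l2norm w := by
  refine le_of_sq_le_sq ?_ (mul_nonneg hM (l2norm_nonneg w))
  rw [mul_pow, l2norm_sq, l2norm_sq, ← integral_const_mul]
  refine integral_mono_ae hv.integrableOn_norm_sq (fun K => (hw.integrableOn_norm_sq K).const_mul _)
    fun K => ?_
  filter_upwards [h K] with x hx
  rw [← mul_pow]
  gcongr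

lemma l2norm_le {β : Type*} [NormedAddCommGroup β] {v : T.Field α} {w : T.Field β}
    (hv : IsL2 v) (hw : IsL2 w) {M : ℝ} (hM : 0 ≤ M)
    (h : ∀ K, ∀ x ∈ refTriangle, ‖v K x‖ ≤ M * ‖w K x‖) :
    T.l2norm v ≤ M * T.l2norm w :=
  l2norm_le_of_ae hv hw hM fun K =>
    (ae_restrict_iff' measurableSet_refTriangle).2 (Eventually.of_forall (h K))

lemma l2norm_neg (v : T.Field α) : T.l2norm (-v) = T.l2norm v := by
  simp [l2norm]

section Inner

variable [InnerProductSpace ℝ α]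

lemma IsL2.integrableOn_inner {v w : T.Field α} (hv : IsL2 v) (hw : IsL2 w) (K : Fin T.card) :
    IntegrableOn (fun x => ⟪v K x, w K x⟫) refTriangle :=
  ((hv K).norm.integrable_mul (hw K).norm).mono' ((hv K).1.inner (hw K).1)
    (Eventually.of_forall fun x => by
      rw [Real.norm_eq_abs]
      exact abs_real_inner_le_norm _ _)

lemma ip_self (v : T.Field α) : T.ip v v = T.l2norm v ^ 2 := by
  rw [l2norm_sq, ip]
  simp only [real_inner_self_eq_norm_sq]

lemma ip_comm (v w : T.Field α) : T.ip v w = T.ip w v := by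
  simp only [ip, real_inner_comm]

lemma ip_add_left {u v w : T.Field α} (hu : IsL2 u) (hv : IsL2 v) (hw : IsL2 w) :
    T.ip (u + v) w = T.ip u w + T.ip v w := by
  simp only [ip, Pi.add_apply, inner_add_left]
  exact integral_add (hu.integrableOn_inner hw) (hv.integrableOn_inner hw)

lemma ip_smul_left (t : ℝ) (v w : T.Field α) : T.ip (t • v) w = t * T.ip v w := by
  simp only [ip, Pi.smul_apply, real_inner_smul_left]
  exact integral_const_mul t _

lemma ip_neg_left (v w : T.Field α) : T.ip (-v) w = -T.ip v w := by
  have := ip_smul_left (-1) v w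
  simpa using this

lemma ip_sub_left {u v w : T.Field α} (hu : IsL2 u) (hv : IsL2 v) (hw : IsL2 w) :
    T.ip (u - v) w = T.ip u w - T.ip v w := by
  rw [sub_eq_add_neg, ip_add_left hu hv.neg hw, ip_neg_left, sub_eq_add_neg]

lemma ip_add_right {u v w : T.Field α} (hu : IsL2 u) (hv : IsL2 v) (hw : IsL2 w) :
    T.ip w (u + v) = T.ip w u + T.ip w v := by
  rw [ip_comm, ip_add_left hu hv hw, ip_comm u, ip_comm v]

lemma ip_sub_right {u v w : T.Field α} (hu : IsL2 u) (hv : IsL2 v) (hw : IsL2 w) :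
    T.ip w (u - v) = T.ip w u - T.ip w v := by
  rw [ip_comm, ip_sub_left hu hv hw, ip_comm u, ip_comm v]

lemma ip_neg_right (v w : T.Field α) : T.ip v (-w) = -T.ip v w := by
  rw [ip_comm, ip_neg_left, ip_comm]

lemma l2norm_add_sq {v w : T.Field α} (hv : IsL2 v) (hw : IsL2 w) :
    T.l2norm (v + w) ^ 2 = T.l2norm v ^ 2 + 2 * T.ip v w + T.l2norm w ^ 2 := by
  rw [← ip_self, ip_add_left hv hw (hv.add hw), ip_add_right hv hw hv, ip_add_right hv hw hw,
    ip_comm w v, ip_self, ip_self]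
  ring

lemma abs_ip_le {v w : T.Field α} (hv : IsL2 v) (hw : IsL2 w) :
    |T.ip v w| ≤ T.l2norm v * T.l2norm w := by
  have hsmul : ∀ t : ℝ, IsL2 (t • w) := fun t K => (hw K).const_smul t
  have h1 : ∀ t : ℝ, 0 ≤ T.l2norm w ^ 2 * (t * t) + 2 * T.ip v w * t + T.l2norm v ^ 2 := by
    intro t
    have h2 := l2norm_add_sq hv (hsmul t)
    have h3 : T.l2norm (t • w) ^ 2 = t * (t * T.l2norm w ^ 2) := by
      rw [← ip_self, ip_smul_left, ip_comm, ip_smul_left, ip_self]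
    rw [h3, ip_comm, ip_smul_left, ip_comm] at h2
    have := sq_nonneg (T.l2norm (v + t • w))
    linarith
  have h2 := discrim_le_zero h1
  rw [discrim] at h2
  refine abs_le_of_sq_le_sq ?_ (mul_nonneg (l2norm_nonneg v) (l2norm_nonneg w))
  rw [mul_pow]
  linarith

lemma l2norm_add_le {v w : T.Field α} (hv : IsL2 v) (hw : IsL2 w) :
    T.l2norm (v + w) ≤ T.l2norm v + T.l2norm w := by
  refine le_of_sq_le_sq ?_ (add_nonneg (l2norm_nonneg v) (l2norm_nonneg w))
  rw [l2norm_add_sq hv hw]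
  linarith [(abs_le.1 (abs_ip_le hv hw)).2]

lemma l2norm_sub_le {v w : T.Field α} (hv : IsL2 v) (hw : IsL2 w) :
    T.l2norm (v - w) ≤ T.l2norm v + T.l2norm w := by
  rw [sub_eq_add_neg, ← l2norm_neg w]
  exact l2norm_add_le hv hw.neg

end Inner

/-- The square of the `L²` norm with respect to the area of the reference triangle. -/
noncomputable def refNormSq (v : T.Field α) : ℝ := ∑ K, ∫ x in refTriangle, ‖v K x‖ ^ 2

lemma refNormSq_nonneg (v : T.Field α) : 0 ≤ refNormSq v :=
  Finset.sum_nonneg fun K _ => MeasureTheory.integral_nonneg fun x => by positivity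

lemma QuasiUniform.refNormSq_bounds {c h : ℝ} (hQ : T.QuasiUniform c h) (hc : 0 < c) (hh : 0 < h)
    {v : T.Field α} (hv : IsL2 v) :
    (c⁻¹ * h) ^ 2 * refNormSq v ≤ T.l2norm v ^ 2 ∧ T.l2norm v ^ 2 ≤ (c * h) ^ 2 * refNormSq v := by
  rw [l2norm_sq, refNormSq, integral, Finset.mul_sum, Finset.mul_sum]
  constructor <;> refine Finset.sum_le_sum fun K _ => ?_
  · rw [← MeasureTheory.integral_const_mul]
    refine setIntegral_mono_on ((hv.integrableOn_norm_sq K).const_mul _)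
      (integrableOn_mul_areaElement (hv.integrableOn_norm_sq K)) measurableSet_refTriangle
      fun x hx => ?_
    rw [mul_comm]
    exact mul_le_mul_of_nonneg_left (hQ.areaElement_bounds hc hh K hx).1 (by positivity)
  · rw [← MeasureTheory.integral_const_mul]
    refine setIntegral_mono_on (integrableOn_mul_areaElement (hv.integrableOn_norm_sq K))
      ((hv.integrableOn_norm_sq K).const_mul _) measurableSet_refTriangle fun x hx => ?_
    rw [mul_comm ((c * h) ^ 2)]
    exact mul_le_mul_of_nonneg_left (hQ.areaElement_bounds hc hh K hx).2 (by positivity)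

lemma IsL2.ofReal_refNormSq {v : T.Field α} (hv : IsL2 v) :
    ENNReal.ofReal (refNormSq v) = ∑ K, ∫⁻ x in refTriangle, ‖v K x‖ₑ ^ 2 := by
  rw [refNormSq, ENNReal.ofReal_sum_of_nonneg fun K _ =>
    MeasureTheory.integral_nonneg fun x => by positivity]
  refine Finset.sum_congr rfl fun K _ => ?_
  rw [ofReal_integral_eq_lintegral_ofReal (hv.integrableOn_norm_sq K)
    (Eventually.of_forall fun x => by positivity)]
  refine lintegral_congr fun x => ?_
  rw [ENNReal.ofReal_pow (norm_nonneg _), ofReal_norm]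

end L2

/-! ### The finite element spaces -/

section Spaces

variable {k : ℕ}

lemma scalarSpace_continuousOn_pull {v : E3 → ℝ} (hv : v ∈ T.scalarSpace k) (K : Fin T.card) :
    ContinuousOn (T.pull v K) refTriangle := by
  obtain ⟨P, -, hP⟩ := hv.2 K
  exact (contDiff_eval (n := 0) P).continuous.continuousOn.congr hP

lemma scalarSpace_isL2 {v : E3 → ℝ} (hv : v ∈ T.scalarSpace k) : IsL2 (T.pull v) :=
  IsL2.of_continuousOn (scalarSpace_continuousOn_pull hv)

lemma velocitySpace_continuousOn_pull {v : E3 → E3} (hv : v ∈ T.velocitySpace k)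
    (K : Fin T.card) : ContinuousOn (T.pull v K) refTriangle := by
  have h : ContinuousOn (fun x => WithLp.ofLp (T.pull v K x)) refTriangle :=
    continuousOn_pi.2 fun i => scalarSpace_continuousOn_pull (hv i) K
  exact (PiLp.continuous_toLp 2 _).comp_continuousOn h

lemma velocitySpace_isL2 {v : E3 → E3} (hv : v ∈ T.velocitySpace k) : IsL2 (T.pull v) :=
  IsL2.of_continuousOn (velocitySpace_continuousOn_pull hv)

lemma scalarSpace_add {v w : E3 → ℝ} (hv : v ∈ T.scalarSpace k) (hw : w ∈ T.scalarSpace k) :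
    (fun x => v x + w x) ∈ T.scalarSpace k := by
  refine ⟨hv.1.add hw.1, fun K => ?_⟩
  obtain ⟨P, hPd, hP⟩ := hv.2 K
  obtain ⟨Q, hQd, hQ⟩ := hw.2 K
  refine ⟨P + Q, (MvPolynomial.totalDegree_add _ _).trans (max_le hPd hQd), fun x hx => ?_⟩
  rw [map_add, ← hP x hx, ← hQ x hx]

lemma zero_mem_scalarSpace : (fun _ => (0 : ℝ)) ∈ T.scalarSpace k :=
  ⟨continuousOn_const, fun _ => ⟨0, by simp, fun x _ => by simp⟩⟩

lemma zero_mem_pressureSpace : (fun _ => (0 : ℝ)) ∈ T.pressureSpace k :=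
  ⟨zero_mem_scalarSpace, by simp [integral, pull]⟩

lemma gradientWithin_pull {q : E3 → ℝ} {K : Fin T.card} {P : MvPolynomial (Fin 2) ℝ}
    (hP : ∀ x ∈ refTriangle, q (T.F K x) = MvPolynomial.eval (fun j => x j) P) {x : E2}
    (hx : x ∈ refTriangle) : gradientWithin (fun y => q (T.F K y)) refTriangle x =
      gradient (fun y : E2 => MvPolynomial.eval (fun j => y j) P) x := by
  rw [gradientWithin, gradient, fderivWithin_congr hP (hP x hx),
    ((contDiff_eval (n := 1) P).differentiable (by simp) x).fderivWithin
      (uniqueDiffOn_refTriangle x hx)]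

/-- The defining property of the tangential gradient. -/
lemma inner_grad (hinv : ∀ K, ∀ x ∈ refTriangle, (T.gram K x).IsInvertible) {q : E3 → ℝ}
    {K : Fin T.card} {P : MvPolynomial (Fin 2) ℝ}
    (hP : ∀ x ∈ refTriangle, q (T.F K x) = MvPolynomial.eval (fun j => x j) P) {x : E2}
    (hx : x ∈ refTriangle) (ξ : E2) : ⟪T.grad q K x, T.DF K x ξ⟫ =
      fderiv ℝ (fun y : E2 => MvPolynomial.eval (fun j => y j) P) x ξ := by
  rw [grad, ← inner_gram, gram_inverse_apply hinv K hx, gradientWithin_pull hP hx, gradient,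
    InnerProductSpace.toDual_symm_apply]

lemma grad_continuousOn (hinv : ∀ K, ∀ x ∈ refTriangle, (T.gram K x).IsInvertible) {q : E3 → ℝ}
    (hq : q ∈ T.scalarSpace k) (K : Fin T.card) : ContinuousOn (T.grad q K) refTriangle := by
  obtain ⟨P, -, hP⟩ := hq.2 K
  have h1 : ContinuousOn (fun x => gradientWithin (fun y => q (T.F K y)) refTriangle x)
      refTriangle := by
    have h2 : Continuous (gradient (fun y : E2 => MvPolynomial.eval (fun j => y j) P)) :=
      (InnerProductSpace.toDual ℝ E2).symm.continuous.comp
        ((contDiff_eval (n := 1) P).continuous_fderiv (by simp))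
    exact h2.continuousOn.congr fun x hx => gradientWithin_pull hP hx
  have h2 : ContinuousOn (fun x => (T.gram K x).inverse) refTriangle := fun x hx =>
    ((hinv K x hx).contDiffAt_map_inverse (n := 0)).continuousAt.comp_continuousWithinAt
      (continuous_gram K).continuousWithinAt
  exact (T.continuous_DF K).continuousOn.clm_apply (h2.clm_apply h1)

lemma grad_isL2 (hinv : ∀ K, ∀ x ∈ refTriangle, (T.gram K x).IsInvertible) {q : E3 → ℝ}
    (hq : q ∈ T.scalarSpace k) : IsL2 (T.grad q) :=
  IsL2.of_continuousOn (grad_continuousOn hinv hq)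

lemma grad_zero : T.grad (fun _ => 0) = 0 := by
  funext K x
  simp [grad, gradientWithin]

end Spaces

end Triangulation

/-! ### Extensions from the exact surface and the discrete Poincaré inequality -/

/-- An injective continuous map on a compact set that is locally expanding is expanding. -/
lemma _root_.IsCompact.exists_dist_le_mul_dist {X Y : Type*} [MetricSpace X] [MetricSpace Y]
    {S : Set X} (hS : IsCompact S) {f : X → Y} (hf : ContinuousOn f S) (hinj : InjOn f S)
    {M₀ : ℝ≥0} (hloc : ∀ x ∈ S, ∃ U ∈ 𝓝 x, ∀ y ∈ U ∩ S, ∀ z ∈ U ∩ S,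
      dist y z ≤ M₀ * dist (f y) (f z)) :
    ∃ M : ℝ≥0, ∀ x ∈ S, ∀ y ∈ S, dist x y ≤ M * dist (f x) (f y) := by
  have key : ∃ M : ℝ≥0, ∀ q ∈ S ×ˢ S, dist q.1 q.2 ≤ M * dist (f q.1) (f q.2) := by
    refine (hS.prod hS).induction_on
      (p := fun A => ∃ M : ℝ≥0, ∀ q ∈ A, dist q.1 q.2 ≤ M * dist (f q.1) (f q.2))
      ⟨0, by simp⟩ ?_ ?_ ?_
    · rintro s t hst ⟨M, hM⟩
      exact ⟨M, fun q hq => hM q (hst hq)⟩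
    · rintro s t ⟨M, hM⟩ ⟨M', hM'⟩
      refine ⟨max M M', ?_⟩
      rintro q (hq | hq)
      · refine (hM q hq).trans ?_
        gcongr
        exact le_max_left _ _
      · refine (hM' q hq).trans ?_
        gcongr
        exact le_max_right _ _
    · rintro ⟨x, y⟩ ⟨hx, hy⟩
      rcases eq_or_ne x y with rfl | hxy
      · obtain ⟨U, hU, h⟩ := hloc x hx
        refine ⟨(U ∩ S) ×ˢ (U ∩ S), ?_, M₀, fun q hq => h q.1 hq.1 q.2 hq.2⟩
        rw [nhdsWithin_prod_eq]
        exact prod_mem_prod (inter_comm U S ▸ inter_mem_nhdsWithin S hU)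
          (inter_comm U S ▸ inter_mem_nhdsWithin S hU)
      · have hd : 0 < dist (f x) (f y) := dist_pos.2 (hinj.ne hx hy hxy)
        have hc1 : ContinuousWithinAt (fun q : X × X => dist (f q.1) (f q.2)) (S ×ˢ S) (x, y) :=
          ((hf x hx).comp continuousWithinAt_fst fun q hq => hq.1).dist
            ((hf y hy).comp continuousWithinAt_snd fun q hq => hq.2)
        have hc2 : ContinuousWithinAt (fun q : X × X => dist q.1 q.2) (S ×ˢ S) (x, y) :=
          continuous_dist.continuousWithinAt
        have e1 := hc1.eventually_const_lt (half_lt_self hd)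
        have e2 := hc2.eventually_lt_const (lt_add_one (dist x y))
        refine ⟨_, e1.and e2, ((dist x y + 1) / (dist (f x) (f y) / 2)).toNNReal, ?_⟩
        rintro q ⟨h1, h2⟩
        rw [Real.coe_toNNReal _ (by positivity), div_mul_eq_mul_div, le_div_iff₀ (by positivity)]
        exact mul_le_mul h2.le h1.le (by positivity) (by positivity)
  obtain ⟨M, hM⟩ := key
  exact ⟨M, fun x hx y hy => hM (x, y) ⟨hx, hy⟩⟩

lemma exists_lipschitzOnWith_eval (P : MvPolynomial (Fin 2) ℝ) :
    ∃ M : ℝ≥0, LipschitzOnWith M (fun x : E2 => MvPolynomial.eval (fun j => x j) P) refTriangle :=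
  (contDiff_eval (n := 1) P).contDiffOn.exists_lipschitzOnWith (by simp) convex_refTriangle
    isCompact_refTriangle

namespace Triangulation.IsFine

variable {kg : ℕ} {T : Triangulation kg} {Ω : Set E3} {δ₀ c h : ℝ} {L : ℝ≥0}

lemma isInvertible_gram (H : T.IsFine Ω δ₀ c h L) :
    ∀ K, ∀ x ∈ refTriangle, (T.gram K x).IsInvertible :=
  fun K _ hx => H.quasi.isInvertible_gram H.c_pos H.h_pos K hx

lemma map_lift_le (H : T.IsFine Ω δ₀ c h L) (K : Fin T.card) :
    (volume.restrict refTriangle).map (T.lift Ω K) ≤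
      ((2 * c / h).toNNReal ^ 2 : ℝ≥0∞) • surfaceMeasure Ω := by
  refine le_trans ?_ H.meshMeasure_le
  rw [meshMeasure]
  exact Finset.single_le_sum (f := fun K => (volume.restrict refTriangle).map (T.lift Ω K))
    (fun _ _ => Measure.zero_le _) (Finset.mem_univ K)

/-- Properties that hold almost everywhere on the exact surface hold almost everywhere on each
element. -/
lemma ae_lift (H : T.IsFine Ω δ₀ c h L) {p : E3 → Prop} (hp : ∀ᵐ y ∂(surfaceMeasure Ω), p y)
    (K : Fin T.card) : ∀ᵐ x ∂(volume.restrict refTriangle), p (T.lift Ω K x) :=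
  ae_of_ae_map (H.aemeasurable_lift K)
    ((Measure.absolutelyContinuous_of_le_smul (H.map_lift_le K)).ae_le hp)

section Extension

variable {α : Type*} [NormedAddCommGroup α]

lemma isL2_extension (H : T.IsFine Ω δ₀ c h L) {f : E3 → α} (hf : MemLp f 2 (surfaceMeasure Ω)) :
    IsL2 (T.pull (extension Ω f)) := by
  intro K
  have h1 : MemLp f 2 ((volume.restrict refTriangle).map (T.lift Ω K)) :=
    hf.of_measure_le_smul (by finiteness) (H.map_lift_le K)
  exact (memLp_map_measure_iff h1.1 (H.aemeasurable_lift K)).1 h1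

lemma l2norm_extension_le (H : T.IsFine Ω δ₀ c h L) {f : E3 → α}
    (hf : MemLp f 2 (surfaceMeasure Ω)) :
    T.l2norm (T.pull (extension Ω f)) ≤ 2 * c ^ 2 * normGamma Ω f := by
  have hc := H.c_pos
  have hh := H.h_pos
  refine le_of_sq_le_sq ?_ (by unfold normGamma; positivity)
  have hint : Integrable (fun y => ‖f y‖ ^ 2) (surfaceMeasure Ω) :=
    hf.integrable_norm_pow two_ne_zero
  have hne : ((2 * c / h).toNNReal ^ 2 : ℝ≥0∞) ≠ ∞ := by finiteness
  have hmap : ∀ K, Integrable (fun y => ‖f y‖ ^ 2)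
      ((volume.restrict refTriangle).map (T.lift Ω K)) := fun K =>
    (hint.smul_measure hne).mono_measure (H.map_lift_le K)
  have h1 : refNormSq (T.pull (extension Ω f)) = ∫ y, ‖f y‖ ^ 2 ∂(T.meshMeasure Ω) := by
    rw [meshMeasure, integral_finsetSum_measure fun K _ => hmap K]
    refine Finset.sum_congr rfl fun K _ => ?_
    rw [integral_map (H.aemeasurable_lift K) (hmap K).1]
    rfl
  have h2 : refNormSq (T.pull (extension Ω f)) ≤
      (2 * c / h) ^ 2 * ∫ y, ‖f y‖ ^ 2 ∂(surfaceMeasure Ω) := by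
    rw [h1]
    refine (integral_mono_measure H.meshMeasure_le (Eventually.of_forall fun y => by positivity)
      (hint.smul_measure hne)).trans_eq ?_
    rw [integral_smul_measure, smul_eq_mul, ENNReal.toReal_pow, ENNReal.coe_toReal,
      Real.coe_toNNReal _ (by positivity)]
  calc T.l2norm (T.pull (extension Ω f)) ^ 2
      ≤ (c * h) ^ 2 * refNormSq (T.pull (extension Ω f)) :=
        (H.quasi.refNormSq_bounds hc hh (H.isL2_extension hf)).2
    _ ≤ (c * h) ^ 2 * ((2 * c / h) ^ 2 * ∫ y, ‖f y‖ ^ 2 ∂(surfaceMeasure Ω)) := by gcongr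
    _ = (2 * c ^ 2 * normGamma Ω f) ^ 2 := by
        rw [normGamma, mul_pow (2 * c ^ 2),
          Real.sq_sqrt (MeasureTheory.integral_nonneg fun y => by positivity)]
        field_simp

end Extension

/-- The images of relative neighbourhoods of interior points of an element are neighbourhoods in
the exact surface, since the closest point mapping is a homeomorphism of compact surfaces. -/
lemma image_lift_mem_nhdsWithin (H : T.IsFine Ω δ₀ c h L) (K : Fin T.card) {x : E2}
    (hx : x ∈ interior refTriangle) {V : Set E2} (hV : V ∈ 𝓝 x) :
    T.lift Ω K '' (V ∩ refTriangle) ∈ 𝓝[frontier Ω] (T.lift Ω K x) := by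
  obtain ⟨W, hWV, hWo, hxW⟩ := mem_nhds_iff.1 hV
  set Z : Set E3 := (⋃ K' : {K' // K' ≠ K}, T.lift Ω K' '' refTriangle) ∪
    T.lift Ω K '' (refTriangle \ W) with hZ
  have hZc : IsClosed Z := by
    refine IsClosed.union (isClosed_iUnion_of_finite fun K' => ?_) ?_
    · exact (isCompact_refTriangle.image_of_continuousOn (H.continuousOn_lift _)).isClosed
    · exact ((isCompact_refTriangle.diff hWo).image_of_continuousOn
        ((H.continuousOn_lift K).mono sdiff_subset)).isClosed
  have hxZ : T.lift Ω K x ∉ Z := by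
    rintro (hmem | ⟨y, hy, hyx⟩)
    · obtain ⟨⟨K', hK'⟩, y, hy, hyx⟩ := mem_iUnion.1 hmem
      exact hK' (H.eq_of_lift_eq hx hy hyx.symm).symm
    · have := H.injOn_lift K hy.1 (interior_subset hx) hyx
      exact hy.2 (this ▸ hxW)
  refine mem_nhdsWithin.2 ⟨Zᶜ, hZc.isOpen_compl, hxZ, ?_⟩
  rintro z ⟨hzZ, hz⟩
  obtain ⟨K', y, hy, rfl⟩ := H.exists_lift_eq hz
  rcases eq_or_ne K' K with rfl | hne
  · refine ⟨y, ⟨hWV ?_, hy⟩, rfl⟩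
    by_contra hyW
    exact hzZ (Or.inr ⟨y, ⟨hy, hyW⟩, rfl⟩)
  · exact (hzZ (Or.inl (mem_iUnion.2 ⟨⟨K', hne⟩, y, hy, rfl⟩))).elim

lemma ae_exists_lift_eq (H : T.IsFine Ω δ₀ c h L) :
    ∀ᵐ y ∂(surfaceMeasure Ω), ∃ K, ∃ x ∈ interior refTriangle, T.lift Ω K x = y := by
  set A : Set E3 := ⋃ K, T.lift Ω K '' interior refTriangle with hA
  have hAm : MeasurableSet A := MeasurableSet.iUnion fun K =>
    isOpen_interior.measurableSet.image_of_continuousOn_injOn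
      ((H.continuousOn_lift K).mono interior_subset) ((H.injOn_lift K).mono interior_subset)
  have h0 : T.meshMeasure Ω Aᶜ = 0 := by
    rw [meshMeasure, Measure.finsetSum_apply]
    refine Finset.sum_eq_zero fun K _ => ?_
    rw [H.map_lift_apply K hAm.compl]
    convert measure_empty (μ := (volume : Measure E2)) using 2
    ext x
    simp only [mem_inter_iff, mem_preimage, mem_compl_iff, mem_empty_iff_false, iff_false, not_and,
      not_not]
    exact fun hx => mem_iUnion.2 ⟨K, x, hx, rfl⟩
  have h1 : surfaceMeasure Ω Aᶜ = 0 := by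
    have := H.surfaceMeasure_le Aᶜ
    rw [Measure.smul_apply, h0, smul_zero] at this
    exact le_antisymm this zero_le
  rw [ae_iff]
  convert h1 using 2
  ext y
  simp [hA]

/-- The tangential gradient controls the finite element function near interior points of an
element. -/
lemma eventually_abs_sub_le (H : T.IsFine Ω δ₀ c h L) {k : ℕ} {q : E3 → ℝ}
    (hq : q ∈ T.scalarSpace k) (K : Fin T.card) {x : E2} (hx : x ∈ refTriangle) {ε : ℝ}
    (hε : 0 < ε) : ∀ᶠ y in 𝓝 x, y ∈ refTriangle →
      |q (T.F K y) - q (T.F K x)| ≤ (c * h * ‖T.grad q K x‖ + ε) * ‖y - x‖ := by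
  obtain ⟨P, -, hP⟩ := hq.2 K
  have hd : HasFDerivAt (fun y : E2 => MvPolynomial.eval (fun j => y j) P) _ x :=
    ((contDiff_eval (n := 1) P).differentiable (by simp) x).hasFDerivAt
  have hb := hd.isLittleO.bound hε
  filter_upwards [hb] with y hy hyr
  rw [hP y hyr, hP x hx]
  have h1 : |fderiv ℝ (fun y : E2 => MvPolynomial.eval (fun j => y j) P) x (y - x)| ≤
      ‖T.grad q K x‖ * (c * h * ‖y - x‖) := by
    rw [← inner_grad H.isInvertible_gram hP hx]
    refine (abs_real_inner_le_norm _ _).trans ?_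
    gcongr
    exact (H.quasi K x hx (y - x)).2
  rw [Real.norm_eq_abs] at hy
  have h2 := abs_sub_abs_le_abs_sub
    (MvPolynomial.eval (fun j => y j) P - MvPolynomial.eval (fun j => x j) P)
    (fderiv ℝ (fun y : E2 => MvPolynomial.eval (fun j => y j) P) x (y - x))
  linarith

/-- A finite element function, transported to the exact surface by the closest point mapping, has
an upper gradient given by the discrete tangential gradient. -/
lemma exists_hasUpperGradient (H : T.IsFine Ω δ₀ c h L) {k : ℕ} {q : E3 → ℝ}
    (hq : q ∈ T.scalarSpace k) : ∃ w g : E3 → ℝ, HasUpperGradient Ω w g ∧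
      (∀ K, ∀ x ∈ refTriangle, w (T.lift Ω K x) = q (T.F K x)) ∧
      ∀ K, ∀ x ∈ interior refTriangle, g (T.lift Ω K x) = 2 * c ^ 2 * ‖T.grad q K x‖ := by
  have hc := H.c_pos
  have hh := H.h_pos
  have hcover : ⋃ K, T.lift Ω K '' refTriangle = frontier Ω := by
    refine Subset.antisymm (iUnion_subset fun K => ?_) fun y hy => ?_
    · rintro _ ⟨x, hx, rfl⟩
      exact H.lift_mem K hx
    · obtain ⟨K, x, hx, rfl⟩ := H.exists_lift_eq hy
      exact mem_iUnion.2 ⟨K, x, hx, rfl⟩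
  -- transport of `q`, and its continuous extension
  set w₀ : E3 → ℝ := q ∘ Function.invFunOn (closestPoint (frontier Ω)) T.surface with hw₀
  have hw₀l : ∀ K, ∀ x ∈ refTriangle, w₀ (T.lift Ω K x) = q (T.F K x) := by
    intro K x hx
    simp only [hw₀, Function.comp_apply, lift]
    rw [H.approx.bijOn.injOn.leftInvOn_invFunOn (T.F_mem_surface K hx)]
  have hw₀c : ContinuousOn w₀ (frontier Ω) := by
    rw [← hcover]
    refine continuousOn_iUnion_image H.continuousOn_lift fun K => ?_
    exact (scalarSpace_continuousOn_pull hq K).congr (hw₀l K)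
  obtain ⟨w, hw⟩ := ContinuousMap.exists_restrict_eq isClosed_frontier
    ⟨(frontier Ω).domRestrict w₀, continuousOn_iff_continuous_domRestrict.1 hw₀c⟩
  have hww₀ : ∀ y ∈ frontier Ω, w y = w₀ y := fun y hy =>
    congrArg (fun f : C(frontier Ω, ℝ) => f ⟨y, hy⟩) hw
  have hwl : ∀ K, ∀ x ∈ refTriangle, w (T.lift Ω K x) = q (T.F K x) := fun K x hx => by
    rw [hww₀ _ (H.lift_mem K hx), hw₀l K x hx]
  -- the upper gradient
  have hemb : ∀ K, MeasurableEmbedding ((interior refTriangle).domRestrict (T.lift Ω K)) :=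
    fun K => ((H.continuousOn_lift K).mono interior_subset).measurableEmbedding
      isOpen_interior.measurableSet ((H.injOn_lift K).mono interior_subset)
  set g₀ : Fin T.card → E3 → ℝ := fun K =>
    Function.extend ((interior refTriangle).domRestrict (T.lift Ω K))
      (fun x => ‖T.grad q K x‖) (fun _ => 0) with hg₀
  have hg₀m : ∀ K, Measurable (g₀ K) := fun K =>
    (hemb K).measurable_extend ((continuousOn_iff_continuous_domRestrict.1
      ((grad_continuousOn H.isInvertible_gram hq K).mono interior_subset)).norm.measurable)
      measurable_const
  have hg₀n : ∀ K y, 0 ≤ g₀ K y := by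
    intro K y
    by_cases hy : ∃ x, (interior refTriangle).domRestrict (T.lift Ω K) x = y
    · obtain ⟨x, rfl⟩ := hy
      simp only [hg₀, (hemb K).injective.extend_apply]
      positivity
    · simp only [hg₀, Function.extend_apply' _ _ _ hy]
      exact le_rfl
  have hg₀l : ∀ K, ∀ x ∈ interior refTriangle, ∑ K', g₀ K' (T.lift Ω K x) = ‖T.grad q K x‖ := by
    intro K x hx
    rw [Finset.sum_eq_single K]
    · exact (hemb K).injective.extend_apply (fun x => ‖T.grad q K x‖) (fun _ => 0) ⟨x, hx⟩
    · intro K' _ hne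
      refine Function.extend_apply' _ _ _ ?_
      rintro ⟨⟨y, hy⟩, hyx⟩
      exact hne (H.eq_of_lift_eq hy (interior_subset hx) hyx)
    · simp
  refine ⟨w, fun y => 2 * c ^ 2 * ∑ K, g₀ K y, ⟨w.continuous, ?_, ?_, ?_, ?_⟩, hwl, ?_⟩
  · exact (Finset.measurable_sum _ fun K _ => hg₀m K).const_mul _
  · exact fun y => mul_nonneg (by positivity) (Finset.sum_nonneg fun K _ => hg₀n K y)
  · have hM : ∀ K, ∃ M : ℝ≥0, LipschitzOnWith M w (T.lift Ω K '' refTriangle) := by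
      intro K
      obtain ⟨M₁, hM₁⟩ := isCompact_refTriangle.exists_dist_le_mul_dist (H.continuousOn_lift K)
        (H.injOn_lift K) fun x hx => H.locally_antilipschitz_lift K hx
      obtain ⟨P, -, hP⟩ := hq.2 K
      obtain ⟨M₂, hM₂⟩ := exists_lipschitzOnWith_eval P
      refine ⟨M₂ * M₁, LipschitzOnWith.of_dist_le_mul ?_⟩
      rintro _ ⟨x, hx, rfl⟩ _ ⟨y, hy, rfl⟩
      rw [hwl K x hx, hwl K y hy, hP x hx, hP y hy]
      calc _ ≤ M₂ * dist x y := hM₂.dist_le_mul x hx y hy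
        _ ≤ M₂ * (M₁ * dist (T.lift Ω K x) (T.lift Ω K y)) := by
            gcongr
            exact hM₁ x hx y hy
        _ = _ := by rw [NNReal.coe_mul, mul_assoc]
    choose M hM using hM
    refine ⟨T.card, fun K => T.lift Ω K '' refTriangle, ∑ K, M K, fun K => ?_, hcover.ge,
      fun K => (hM K).weaken ?_⟩
    · exact (isCompact_refTriangle.image_of_continuousOn (H.continuousOn_lift K)).isClosed
    · exact Finset.single_le_sum (f := M) (fun _ _ => zero_le) (Finset.mem_univ K)
  · filter_upwards [H.ae_exists_lift_eq] with y hy ε hε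
    obtain ⟨K, x, hx, rfl⟩ := hy
    have hxr := interior_subset hx
    obtain ⟨U, hU, hanti⟩ := H.locally_antilipschitz_lift K hxr
    have hε' : 0 < ε / (2 * c / h) := by positivity
    have hmem := H.image_lift_mem_nhdsWithin K hx
      (inter_mem hU (H.eventually_abs_sub_le hq K hxr hε'))
    filter_upwards [hmem] with z hz
    obtain ⟨y, ⟨⟨hyU, hyq⟩, hyr⟩, rfl⟩ := hz
    have h1 := hanti y ⟨hyU, hyr⟩ x ⟨mem_of_mem_nhds hU, hxr⟩
    have hpos : 0 ≤ 2 * c / h := by positivity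
    rw [Real.coe_toNNReal _ hpos, dist_eq_norm, dist_eq_norm] at h1
    rw [hwl K y hyr, hwl K x hxr, hg₀l K x hx]
    calc |q (T.F K y) - q (T.F K x)|
        ≤ (c * h * ‖T.grad q K x‖ + ε / (2 * c / h)) * ‖y - x‖ := hyq hyr
      _ ≤ (c * h * ‖T.grad q K x‖ + ε / (2 * c / h)) *
          (2 * c / h * ‖T.lift Ω K y - T.lift Ω K x‖) := by gcongr
      _ = _ := by field_simp
  · intro K x hx
    simp only [hg₀l K x hx]

lemma isL2_const (m : ℝ) : IsL2 (T := T) fun _ _ => m :=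
  IsL2.of_continuousOn fun _ => continuousOn_const

/-- Among all constants, a function with mean value zero is closest to zero. -/
lemma _root_.SurfaceDarcy.Triangulation.l2norm_le_l2norm_sub_const {q : T.Field ℝ} (hq : IsL2 q)
    (h0 : T.integral q = 0) (m : ℝ) : T.l2norm q ≤ T.l2norm (q - fun _ _ => m) := by
  have h1 := l2norm_add_sq hq ((isL2_const (T := T) m).neg)
  have h2 : T.ip q (-fun _ _ => m) = 0 := by
    rw [ip_neg_right, neg_eq_zero]
    have : T.ip q (fun _ _ => m) = m * T.integral q := by
      rw [← integral_const_mul]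
      simp [ip]
    rw [this, h0, mul_zero]
  rw [← sub_eq_add_neg, h2] at h1
  refine le_of_sq_le_sq ?_ (l2norm_nonneg _)
  rw [h1]
  linarith [sq_nonneg (T.l2norm (-fun _ _ => m : T.Field ℝ))]

end Triangulation.IsFine

open Triangulation in
/-- **Discrete Poincaré inequality**, uniformly in the mesh: transport to the exact surface. -/
theorem exists_l2norm_le_l2norm_grad {Ω : Set E3} (hΩ : BoundsSmoothSurface Ω) {c : ℝ}
    (hc : 0 < c) : ∃ C : ℝ, 0 ≤ C ∧ ∀ (kg kp : ℕ) (T : Triangulation kg) (δ₀ h : ℝ) (L : ℝ≥0),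
      T.IsFine Ω δ₀ c h L → ∀ q ∈ T.pressureSpace kp,
        T.l2norm (T.pull q) ≤ C * T.l2norm (T.grad q) := by
  obtain ⟨C, hC⟩ := exists_lintegral_sub_const_le hΩ
  refine ⟨16 * c ^ 6 * Real.sqrt C, by positivity, ?_⟩
  intro kg kp T δ₀ h L H q hq
  have hh := H.h_pos
  obtain ⟨w, g, hwg, hw, hg⟩ := H.exists_hasUpperGradient hq.1
  obtain ⟨m, hm⟩ := hC w g hwg
  have hqL := scalarSpace_isL2 hq.1
  have hgL := grad_isL2 H.isInvertible_gram hq.1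
  have hqmL : IsL2 (T.pull q - fun _ _ => m) := hqL.sub (IsFine.isL2_const m)
  have hcm : Measurable fun y => ‖w y - m‖ₑ ^ 2 :=
    (hwg.continuous.measurable.sub_const m).enorm.pow_const 2
  set r : ℝ≥0 := (2 * c / h).toNNReal with hr
  set s : ℝ≥0 := (4 * c * h).toNNReal with hs
  set t : ℝ≥0 := (2 * c ^ 2).toNNReal with ht
  have hsum : ∑ K, ∫⁻ x in refTriangle, ‖g (T.lift Ω K x)‖ₑ ^ 2 =
      (t : ℝ≥0∞) ^ 2 * ∑ K, ∫⁻ x in refTriangle, ‖T.grad q K x‖ₑ ^ 2 := by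
    rw [Finset.mul_sum]
    refine Finset.sum_congr rfl fun K _ => ?_
    rw [← lintegral_const_mul' _ _ (by finiteness), ← restrict_interior_refTriangle]
    refine setLIntegral_congr_fun isOpen_interior.measurableSet fun x hx => ?_
    have ht0 : (0 : ℝ) ≤ 2 * c ^ 2 := by positivity
    have ht1 : ‖(2 * c ^ 2 : ℝ)‖ₑ = t := by
      rw [ht, ← ofReal_norm, Real.norm_of_nonneg ht0]
      rfl
    simp only [hg K x hx, enorm_mul _ ‖T.grad q K x‖, enorm_norm, mul_pow _ _ 2, ht1]
  have hmain : ENNReal.ofReal (refNormSq (T.pull q - fun _ _ => m)) ≤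
      ENNReal.ofReal ((r ^ 2 * C * s ^ 2 * t ^ 2 : ℝ≥0) * refNormSq (T.grad q)) := by
    rw [ENNReal.ofReal_mul (NNReal.coe_nonneg _), ENNReal.ofReal_coe_nnreal, hqmL.ofReal_refNormSq,
      hgL.ofReal_refNormSq]
    calc ∑ K, ∫⁻ x in refTriangle, ‖(T.pull q - fun _ _ => m : T.Field ℝ) K x‖ₑ ^ 2
        = ∫⁻ y, ‖w y - m‖ₑ ^ 2 ∂(T.meshMeasure Ω) := by
          rw [H.lintegral_meshMeasure hcm]
          refine Finset.sum_congr rfl fun K _ => ?_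
          refine setLIntegral_congr_fun measurableSet_refTriangle fun x hx => ?_
          simp only [hw K x hx, Pi.sub_apply, pull]
      _ ≤ r ^ 2 * ∫⁻ y, ‖w y - m‖ₑ ^ 2 ∂(surfaceMeasure Ω) := by
          refine (lintegral_mono' H.meshMeasure_le le_rfl).trans_eq ?_
          rw [lintegral_smul_measure, smul_eq_mul]
      _ ≤ r ^ 2 * (C * ∫⁻ y, ‖g y‖ₑ ^ 2 ∂(surfaceMeasure Ω)) := by gcongr
      _ ≤ r ^ 2 * (C * (s ^ 2 * ∫⁻ y, ‖g y‖ₑ ^ 2 ∂(T.meshMeasure Ω))) := by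
          gcongr
          refine (lintegral_mono' H.surfaceMeasure_le le_rfl).trans_eq ?_
          rw [lintegral_smul_measure, smul_eq_mul]
      _ = r ^ 2 * (C * (s ^ 2 * (t ^ 2 * ∑ K, ∫⁻ x in refTriangle, ‖T.grad q K x‖ₑ ^ 2))) := by
          rw [H.lintegral_meshMeasure (hwg.measurable.enorm.pow_const 2), hsum]
      _ = _ := by
          push_cast
          ring
  have hmain' : refNormSq (T.pull q - fun _ _ => m) ≤
      (2 * c / h) ^ 2 * C * (4 * c * h) ^ 2 * (2 * c ^ 2) ^ 2 * refNormSq (T.grad q) := by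
    have h1 := (ENNReal.ofReal_le_ofReal_iff
      (mul_nonneg (NNReal.coe_nonneg _) (refNormSq_nonneg _))).1 hmain
    have e1 : (r : ℝ) = 2 * c / h := Real.coe_toNNReal _ (by positivity)
    have e2 : (s : ℝ) = 4 * c * h := Real.coe_toNNReal _ (by positivity)
    have e3 : (t : ℝ) = 2 * c ^ 2 := Real.coe_toNNReal _ (by positivity)
    push_cast at h1
    rwa [e1, e2, e3] at h1
  refine (l2norm_le_l2norm_sub_const hqL hq.2 m).trans ?_
  refine le_of_sq_le_sq ?_ (mul_nonneg (by positivity) (l2norm_nonneg _))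
  have hb1 := (H.quasi.refNormSq_bounds hc hh hqmL).2
  have hb2 := (H.quasi.refNormSq_bounds hc hh hgL).1
  have hCs : Real.sqrt C ^ 2 = C := Real.sq_sqrt C.2
  calc T.l2norm (T.pull q - fun _ _ => m) ^ 2
      ≤ (c * h) ^ 2 * refNormSq (T.pull q - fun _ _ => m) := hb1
    _ ≤ (c * h) ^ 2 * ((2 * c / h) ^ 2 * C * (4 * c * h) ^ 2 * (2 * c ^ 2) ^ 2 *
          refNormSq (T.grad q)) := by gcongr
    _ = 256 * c ^ 12 * C * ((c⁻¹ * h) ^ 2 * refNormSq (T.grad q)) := by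
        field_simp
        ring
    _ ≤ 256 * c ^ 12 * C * T.l2norm (T.grad q) ^ 2 := by gcongr
    _ = (16 * c ^ 6 * Real.sqrt C * T.l2norm (T.grad q)) ^ 2 := by
        rw [mul_pow, mul_pow, hCs]
        ring

/-! ### Bernstein forms on the reference triangle -/

/-- Exponents of the monomials of degree `k` in three variables. -/
abbrev MultiIndex (k : ℕ) : Type :=
  {m : Fin 3 → ℕ // m ∈ Finset.piAntidiag (Finset.univ : Finset (Fin 3)) k}

namespace MultiIndex

variable {k : ℕ}

lemma sum_eq (m : MultiIndex k) : ∑ i, m.1 i = k := (Finset.mem_piAntidiag.1 m.2).1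

/-- The exponent `m`, of degree `∑ m i = k`. -/
def ofSum (m : Fin 3 → ℕ) (hm : ∑ i, m i = k) : MultiIndex k :=
  ⟨m, Finset.mem_piAntidiag.2 ⟨hm, fun _ _ => Finset.mem_univ _⟩⟩

end MultiIndex

/-- The form `∑ c_m β^m`, homogeneous of degree `k` in `β`. At barycentric coordinates, this is
(up to normalization) a polynomial of degree at most `k` in the Bernstein basis. -/
noncomputable def bernsteinForm {k : ℕ} (c : MultiIndex k → ℝ) (β : Fin 3 → ℝ) : ℝ :=
  ∑ m, c m * ∏ i, β i ^ m.1 i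

section Bernstein

variable {k : ℕ}

lemma bernsteinForm_mul (c : MultiIndex k → ℝ) (s : ℝ) (β : Fin 3 → ℝ) :
    bernsteinForm c (fun i => s * β i) = s ^ k * bernsteinForm c β := by
  rw [bernsteinForm, bernsteinForm, Finset.mul_sum]
  refine Finset.sum_congr rfl fun m _ => ?_
  simp only [mul_pow, Finset.prod_mul_distrib, Finset.prod_pow_eq_pow_sum, m.sum_eq]
  ring

lemma continuous_baryCoord : Continuous baryCoord := by
  refine continuous_pi fun i => ?_
  fin_cases i <;> simp only [baryCoord] <;> simp <;> fun_prop

lemma continuous_bernsteinForm (c : MultiIndex k → ℝ) :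
    Continuous fun x : E2 => bernsteinForm c (baryCoord x) := by
  have := continuous_baryCoord
  have hi : ∀ i, Continuous fun x => baryCoord x i := fun i => (continuous_apply i).comp this
  unfold bernsteinForm
  exact continuous_finsetSum _ fun m _ => continuous_const.mul
    (continuous_finsetProd _ fun i _ => (hi i).pow _)

/-- Polynomials of degree at most `k` are Bernstein forms of degree `k`: the degree of a monomial
is raised to `k` by multiplication with powers of `λ₀ + λ₁ + λ₂ = 1`. -/
lemma exists_eval_eq_bernsteinForm {P : MvPolynomial (Fin 2) ℝ} (hP : P.totalDegree ≤ k) :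
    ∃ c : MultiIndex k → ℝ, ∀ x : E2,
      MvPolynomial.eval (fun j => x j) P = bernsteinForm c (baryCoord x) := by
  set b : ∀ j, MultiIndex j → E2 → ℝ := fun j m x => ∏ i, baryCoord x i ^ m.1 i with hb
  set B : ℕ → Submodule ℝ (E2 → ℝ) := fun j => Submodule.span ℝ (range (b j)) with hB
  have hmono : Monotone B := by
    refine monotone_nat_of_le_succ fun j => Submodule.span_le.2 ?_
    rintro _ ⟨m, rfl⟩
    have h1 : b j m = ∑ i, b (j + 1) (.ofSum (m.1 + Pi.single i 1) (by
        simp [Finset.sum_add_distrib, m.sum_eq])) := by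
      funext x
      simp only [hb, Finset.sum_apply, MultiIndex.ofSum, Pi.add_apply, pow_add,
        Finset.prod_mul_distrib]
      rw [← Finset.mul_sum]
      have h2 : ∀ i : Fin 3, ∏ l, baryCoord x l ^ (Pi.single i 1 : Fin 3 → ℕ) l =
          baryCoord x i := by
        intro i
        rw [Finset.prod_eq_single i]
        · simp
        · intro l _ hl
          simp [Pi.single_eq_of_ne hl]
        · simp
      simp only [h2, sum_baryCoord, mul_one]
    rw [h1]
    exact Submodule.sum_mem _ fun i _ => Submodule.subset_span ⟨_, rfl⟩
  have hmem : (fun x : E2 => MvPolynomial.eval (fun j => x j) P) ∈ B k := by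
    have h1 : (fun x : E2 => MvPolynomial.eval (fun j => x j) P) =
        ∑ d ∈ P.support, P.coeff d • fun x : E2 => x 0 ^ d 0 * x 1 ^ d 1 := by
      funext x
      simp [MvPolynomial.eval_eq', Finset.sum_apply, Fin.prod_univ_two]
    rw [h1]
    refine Submodule.sum_mem _ fun d hd => Submodule.smul_mem _ _ ?_
    have hdk : d 0 + d 1 ≤ k := by
      refine le_trans (le_of_eq ?_) ((MvPolynomial.le_totalDegree hd).trans hP)
      simp [Finsupp.sum_fintype, Fin.sum_univ_two]
    refine hmono hdk (Submodule.subset_span ⟨.ofSum ![0, d 0, d 1] ?_, ?_⟩)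
    · simp [Fin.sum_univ_three]
    · funext x
      simp [hb, MultiIndex.ofSum, Fin.prod_univ_three, baryCoord]
  obtain ⟨c, hc⟩ := (Submodule.mem_span_range_iff_exists_fun ℝ).1 hmem
  refine ⟨c, fun x => ?_⟩
  have := congrFun hc x
  simp only [Finset.sum_apply, Pi.smul_apply, smul_eq_mul] at this
  rw [← this, bernsteinForm]

/-- Bernstein forms of degree `k` are polynomials of degree at most `k` in the parameters. -/
lemma exists_bernsteinForm_eq_eval (c : MultiIndex k → ℝ) :
    ∃ P : MvPolynomial (Fin 2) ℝ, P.totalDegree ≤ k ∧ ∀ x : E2,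
      bernsteinForm c (baryCoord x) = MvPolynomial.eval (fun j => x j) P := by
  set l : Fin 3 → MvPolynomial (Fin 2) ℝ :=
    ![1 - MvPolynomial.X 0 - MvPolynomial.X 1, MvPolynomial.X 0, MvPolynomial.X 1] with hl
  have hld : ∀ i, (l i).totalDegree ≤ 1 := by
    have h2 : ∀ j : Fin 2, (MvPolynomial.X j : MvPolynomial (Fin 2) ℝ).totalDegree ≤ 1 :=
      fun j => (MvPolynomial.totalDegree_X j).le
    intro i
    fin_cases i
    · refine (MvPolynomial.totalDegree_sub _ _).trans (max_le ?_ (h2 1))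
      exact (MvPolynomial.totalDegree_sub _ _).trans (max_le (by simp) (h2 0))
    · exact h2 0
    · exact h2 1
  have hle : ∀ x : E2, ∀ i, MvPolynomial.eval (fun j => x j) (l i) = baryCoord x i := by
    intro x i
    fin_cases i <;> simp [hl, baryCoord]
  refine ⟨∑ m, MvPolynomial.C (c m) * ∏ i, l i ^ m.1 i, ?_, fun x => ?_⟩
  · refine MvPolynomial.totalDegree_finsetSum_le fun m _ => ?_
    refine (MvPolynomial.totalDegree_mul _ _).trans ?_
    rw [MvPolynomial.totalDegree_C, zero_add]
    refine (MvPolynomial.totalDegree_finsetProd _ _).trans ?_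
    refine le_trans (Finset.sum_le_sum fun i _ => ?_) m.sum_eq.le
    calc _ ≤ m.1 i * (l i).totalDegree := MvPolynomial.totalDegree_pow _ _
      _ ≤ m.1 i * 1 := Nat.mul_le_mul_left _ (hld i)
      _ = m.1 i := mul_one _
  · simp [bernsteinForm, hle]

/-- The multiplier `∑ mᵢ aᵢ` on Bernstein coefficients is the derivative along the scaling
`βᵢ (1 + t aᵢ)`. -/
lemma hasDerivAt_bernsteinForm (c : MultiIndex k → ℝ) (a β : Fin 3 → ℝ) :
    HasDerivAt (fun t : ℝ => bernsteinForm c fun i => β i * (1 + t * a i))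
      (bernsteinForm (fun m => (∑ i, m.1 i * a i) * c m) β) 0 := by
  have h1 : ∀ m : MultiIndex k, HasDerivAt
      (fun t : ℝ => c m * ((∏ i, β i ^ m.1 i) * ∏ i, (1 + t * a i) ^ m.1 i))
      ((∑ i, m.1 i * a i) * c m * ∏ i, β i ^ m.1 i) 0 := by
    intro m
    have h2 : ∀ i, HasDerivAt (fun t : ℝ => (1 + t * a i) ^ m.1 i) (m.1 i * a i) 0 := by
      intro i
      have := (((hasDerivAt_id (0 : ℝ)).mul_const (a i)).const_add 1).fun_pow (m.1 i)
      simpa using this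
    have h3 := ((h2 0).mul (h2 1)).mul (h2 2)
    have h4 := (h3.const_mul (∏ i, β i ^ m.1 i)).const_mul (c m)
    refine (h4.congr_deriv ?_).congr_of_eventuallyEq (Eventually.of_forall fun t => ?_)
    · simp [Fin.sum_univ_three]
      ring
    · simp [Fin.prod_univ_three]
  have h5 := HasDerivAt.fun_sum fun m (_ : m ∈ Finset.univ) => h1 m
  unfold bernsteinForm
  refine h5.congr_of_eventuallyEq (Eventually.of_forall fun t => ?_)
  simp only [mul_pow, Finset.prod_mul_distrib]

lemma exists_baryCoord_eq {β : Fin 3 → ℝ} (hβ : ∀ i, 0 ≤ β i) (h1 : ∑ i, β i = 1) :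
    ∃ x ∈ refTriangle, baryCoord x = β := by
  rw [Fin.sum_univ_three] at h1
  have h0 := hβ 0
  refine ⟨!₂[β 1, β 2], ⟨by simpa using hβ 1, by simpa using hβ 2, ?_⟩, ?_⟩
  · simp
    linarith
  · funext i
    fin_cases i <;> simp [baryCoord]
    linarith

lemma mem_interior_refTriangle {x : E2} (hx : ∀ i, 0 < baryCoord x i) :
    x ∈ interior refTriangle := by
  have hopen : IsOpen {x : E2 | ∀ i, 0 < baryCoord x i} := by
    simp only [ofPred_forall]
    exact isOpen_iInter_of_finite fun i =>
      isOpen_lt continuous_const ((continuous_apply i).comp continuous_baryCoord)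
  refine interior_maximal (fun y hy => ?_) hopen hx
  have h0 := hy 0
  have h1 := hy 1
  have h2 := hy 2
  simp only [baryCoord, Matrix.cons_val_zero, Matrix.cons_val_one, Matrix.cons_val] at h0 h1 h2
  exact ⟨h1.le, h2.le, by linarith⟩

/-- The monomials of degree `k` in the barycentric coordinates are linearly independent. -/
lemma eq_zero_of_bernsteinForm_eq_zero {c : MultiIndex k → ℝ}
    (hc : ∀ x ∈ interior refTriangle, bernsteinForm c (baryCoord x) = 0) : c = 0 := by
  have h1 : ∀ β : Fin 3 → ℝ, (∀ i, 0 < β i) → bernsteinForm c β = 0 := by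
    intro β hβ
    have hs : 0 < ∑ i, β i := Finset.sum_pos (fun i _ => hβ i) Finset.univ_nonempty
    obtain ⟨x, -, hx⟩ := exists_baryCoord_eq (β := fun i => (∑ j, β j)⁻¹ * β i)
      (fun i => by have := hβ i; positivity) (by
        rw [← Finset.mul_sum, inv_mul_cancel₀ hs.ne'])
    have h2 := hc x (mem_interior_refTriangle fun i => by
      rw [hx]
      have := hβ i
      positivity)
    rw [hx, bernsteinForm_mul] at h2
    exact (mul_eq_zero.1 h2).resolve_left (by positivity)
  set e : MultiIndex k → Fin 3 →₀ ℕ := fun m => Finsupp.equivFunOnFinite.symm m.1 with he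
  have hinj : Function.Injective e := fun m m' h =>
    Subtype.ext (Finsupp.equivFunOnFinite.symm.injective h)
  have h2 : (∑ m, MvPolynomial.monomial (e m) (c m) : MvPolynomial (Fin 3) ℝ) = 0 := by
    refine MvPolynomial.funext_set (fun _ => Ioi 0) (fun _ => Ioi_infinite 0) fun β hβ => ?_
    rw [map_zero, map_sum, ← h1 β fun i => hβ i (mem_univ i)]
    refine Finset.sum_congr rfl fun m _ => ?_
    rw [MvPolynomial.eval_monomial, Finsupp.prod_fintype _ _ fun i => pow_zero _]
    rfl
  funext m
  have h3 := congrArg (MvPolynomial.coeff (e m)) h2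
  rw [MvPolynomial.coeff_sum, Finset.sum_eq_single m] at h3
  · simpa using h3
  · intro m' _ hne
    rw [MvPolynomial.coeff_monomial, if_neg (hinj.ne hne)]
  · simp

/-- Bernstein coefficients are bounded by the `L²` norm on the reference triangle. -/
lemma exists_sq_le_integral_bernsteinForm (k : ℕ) : ∃ C : ℝ, 0 ≤ C ∧ ∀ (c : MultiIndex k → ℝ) m,
    c m ^ 2 ≤ C * ∫ x in refTriangle, bernsteinForm c (baryCoord x) ^ 2 := by
  set I : (MultiIndex k → ℝ) → ℝ := fun c =>
    ∫ x in refTriangle, bernsteinForm c (baryCoord x) ^ 2 with hI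
  have hint : ∀ {f : E2 → ℝ}, Continuous f → IntegrableOn f refTriangle := fun hf =>
    hf.continuousOn.integrableOn_compact isCompact_refTriangle
  have hIc : Continuous I := by
    have hb : ∀ m : MultiIndex k, Continuous fun x => ∏ i, baryCoord x i ^ m.1 i := fun m =>
      continuous_finsetProd _ fun i _ =>
        ((continuous_apply i).comp continuous_baryCoord).pow _
    have h1 : I = fun c => ∑ m, ∑ m', c m * c m' *
        ∫ x in refTriangle, (∏ i, baryCoord x i ^ m.1 i) * ∏ i, baryCoord x i ^ m'.1 i := by
      funext c
      simp only [hI]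
      calc _ = ∫ x in refTriangle, ∑ m : MultiIndex k, ∑ m' : MultiIndex k, c m * c m' *
            ((∏ i, baryCoord x i ^ m.1 i) * ∏ i, baryCoord x i ^ m'.1 i) := by
            refine integral_congr_ae (Eventually.of_forall fun x => ?_)
            simp only [bernsteinForm, sq, Finset.sum_mul_sum]
            refine Finset.sum_congr rfl fun m _ => Finset.sum_congr rfl fun m' _ => ?_
            ring
        _ = _ := by
            rw [integral_finsetSum _ fun m _ => hint (by fun_prop)]
            refine Finset.sum_congr rfl fun m _ => ?_
            rw [integral_finsetSum _ fun m' _ => hint (by fun_prop)]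
            refine Finset.sum_congr rfl fun m' _ => ?_
            rw [integral_const_mul]
    rw [h1]
    fun_prop
  have hnn : ∀ c, 0 ≤ I c := fun c => integral_nonneg fun x => sq_nonneg _
  have hpos : ∀ c, c ≠ 0 → 0 < I c := by
    intro c hc0
    refine lt_of_le_of_ne (hnn c) fun h0 => hc0 (eq_zero_of_bernsteinForm_eq_zero fun x hx => ?_)
    have hcont := continuous_bernsteinForm c
    have h1 := (integral_eq_zero_iff_of_nonneg (fun x => sq_nonneg _)
      (hint (hcont.pow 2))).1 h0.symm
    rw [← restrict_interior_refTriangle] at h1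
    have h2 := Measure.eqOn_open_of_ae_eq h1 isOpen_interior (hcont.pow 2).continuousOn
      continuousOn_const hx
    exact pow_eq_zero_iff two_ne_zero |>.1 h2
  have hI2 : ∀ (t : ℝ) c, I (t • c) = t ^ 2 * I c := by
    intro t c
    simp only [hI]
    rw [← integral_const_mul]
    refine integral_congr_ae (Eventually.of_forall fun x => ?_)
    simp only [bernsteinForm, Pi.smul_apply, smul_eq_mul, mul_assoc, ← Finset.mul_sum, mul_pow]
  rcases isEmpty_or_nonempty (MultiIndex k) with hE | hE
  · exact ⟨0, le_rfl, fun c m => isEmptyElim m⟩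
  obtain ⟨c₀, hc₀, hmin⟩ := (isCompact_sphere (0 : MultiIndex k → ℝ) 1).exists_isMinOn
    (NormedSpace.sphere_nonempty.2 zero_le_one) hIc.continuousOn
  have hp := hpos c₀ fun h => by simp [h] at hc₀
  refine ⟨(I c₀)⁻¹, by positivity, fun c m => ?_⟩
  rcases eq_or_ne c 0 with rfl | hc
  · simpa using mul_nonneg (inv_nonneg.2 hp.le) (hnn 0)
  have hn : 0 < ‖c‖ := norm_pos_iff.2 hc
  have h1 : I c₀ ≤ I (‖c‖⁻¹ • c) := hmin (by simp [norm_smul, hn.ne'])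
  rw [hI2] at h1
  have h2 : c m ^ 2 ≤ ‖c‖ ^ 2 := by
    rw [← sq_abs]
    gcongr
    exact norm_le_pi_norm c m
  refine h2.trans ?_
  rw [inv_mul_eq_div, le_div_iff₀ hp]
  calc ‖c‖ ^ 2 * I c₀ ≤ ‖c‖ ^ 2 * (‖c‖⁻¹ ^ 2 * I c) := by gcongr
    _ = I c := by field_simp

end Bernstein

/-! ### Discrete products and superapproximation -/

lemma realize_apply_eq_sum (a : Fin 3 → ℕ) (x : E2) (m : ℕ) :
    realize a x m = ∑ i, if a i = m then baryCoord x i else 0 := by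
  simp only [realize, Finset.sum_apply, Pi.single_apply, eq_comm]

/-- Sums over the vertices, weighted by barycentric coordinates, depend only on the point in the
geometric realization. -/
lemma sum_baryCoord_mul_eq {a b : Fin 3 → ℕ} {x y : E2} (h : realize a x = realize b y)
    (θ : ℕ → ℝ) : ∑ i, baryCoord x i * θ (a i) = ∑ i, baryCoord y i * θ (b i) := by
  have key : ∀ (a : Fin 3 → ℕ) (x : E2) (S : Finset ℕ), (∀ i, a i ∈ S) →
      ∑ i, baryCoord x i * θ (a i) = ∑ m ∈ S, realize a x m * θ m := by
    intro a x S hS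
    simp only [realize_apply_eq_sum, Finset.sum_mul, ite_mul, zero_mul]
    rw [Finset.sum_comm]
    refine Finset.sum_congr rfl fun i _ => ?_
    rw [Finset.sum_ite_eq, if_pos (hS i)]
  have hS : ∀ i, a i ∈ Finset.univ.image a ∪ Finset.univ.image b := fun i => by simp
  have hS' : ∀ i, b i ∈ Finset.univ.image a ∪ Finset.univ.image b := fun i => by simp
  rw [key a x _ hS, key b y _ hS', h]

/-- Rescaling the barycentric coordinates by factors attached to the labels rescales the point
in the geometric realization. -/
lemma realize_of_baryCoord_eq {a : Fin 3 → ℕ} {x x' : E2} {θ : ℕ → ℝ} {s : ℝ}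
    (h : ∀ i, baryCoord x' i = s * (baryCoord x i * θ (a i))) (m : ℕ) :
    realize a x' m = s * (realize a x m * θ m) := by
  simp only [realize_apply_eq_sum, Finset.sum_mul, Finset.mul_sum]
  refine Finset.sum_congr rfl fun i _ => ?_
  split_ifs with him
  · rw [h, him]
  · simp

namespace Triangulation

variable {kg : ℕ} {T : Triangulation kg} {k : ℕ}

/-- The derivative of a finite element function along a scaling of the barycentric coordinates by
factors attached to the vertices of the mesh does not depend on the element. -/
lemma bernsteinForm_weighted_eq {v : E3 → ℝ} {K K' : Fin T.card} {c c' : MultiIndex k → ℝ}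
    (hc : ∀ x ∈ refTriangle, v (T.F K x) = bernsteinForm c (baryCoord x))
    (hc' : ∀ x ∈ refTriangle, v (T.F K' x) = bernsteinForm c' (baryCoord x)) (θ : ℕ → ℝ)
    {x y : E2} (hx : x ∈ refTriangle) (hy : y ∈ refTriangle) (hxy : T.F K x = T.F K' y) :
    bernsteinForm (fun m => (∑ i, m.1 i * θ (T.vert K i)) * c m) (baryCoord x) =
      bernsteinForm (fun m => (∑ i, m.1 i * θ (T.vert K' i)) * c' m) (baryCoord y) := by
  have hr : realize (T.vert K) x = realize (T.vert K') y := (T.glue K K' x hx y hy).1 hxy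
  have hd := hasDerivAt_bernsteinForm c (fun i => θ (T.vert K i)) (baryCoord x)
  have hd' := hasDerivAt_bernsteinForm c' (fun i => θ (T.vert K' i)) (baryCoord y)
  refine hd.unique (hd'.congr_of_eventuallyEq ?_)
  have hpos : ∀ r : ℝ, ∀ᶠ t in 𝓝 (0 : ℝ), 0 < 1 + t * r := fun r => by
    have hcont : Continuous fun t : ℝ => 1 + t * r := by fun_prop
    exact hcont.continuousAt.eventually_const_lt (by simp)
  have hpK : ∀ K, ∀ᶠ t in 𝓝 (0 : ℝ), ∀ i, 0 < 1 + t * θ (T.vert K i) := fun K =>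
    eventually_all.2 fun i => hpos _
  filter_upwards [hpK K, hpK K'] with t ht ht'
  -- the scaled points, normalized
  set s : ℝ := ∑ i, baryCoord x i * (1 + t * θ (T.vert K i)) with hs
  have hss : s = ∑ i, baryCoord y i * (1 + t * θ (T.vert K' i)) :=
    sum_baryCoord_mul_eq hr fun m => 1 + t * θ m
  have hs0 : 0 < s := by
    refine lt_of_le_of_ne (Finset.sum_nonneg fun i _ =>
      mul_nonneg (baryCoord_nonneg hx i) (ht i).le) fun h0 => ?_
    have h1 := (Finset.sum_eq_zero_iff_of_nonneg fun i _ =>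
      mul_nonneg (baryCoord_nonneg hx i) (ht i).le).1 h0.symm
    have h2 : ∀ i, baryCoord x i = 0 := fun i =>
      (mul_eq_zero.1 (h1 i (Finset.mem_univ i))).resolve_right (ht i).ne'
    have h3 := sum_baryCoord x
    simp [h2] at h3
  have key : ∀ {K : Fin T.card} {x : E2}, x ∈ refTriangle → (∀ i, 0 < 1 + t * θ (T.vert K i)) →
      s = ∑ i, baryCoord x i * (1 + t * θ (T.vert K i)) → ∃ x' ∈ refTriangle,
        ∀ i, baryCoord x' i = s⁻¹ * (baryCoord x i * (1 + t * θ (T.vert K i))) := by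
    intro K x hx ht hs
    obtain ⟨x', hx', h⟩ := exists_baryCoord_eq
      (β := fun i => s⁻¹ * (baryCoord x i * (1 + t * θ (T.vert K i))))
      (fun i => mul_nonneg (inv_nonneg.2 hs0.le) (mul_nonneg (baryCoord_nonneg hx i) (ht i).le))
      (by rw [← Finset.mul_sum, ← hs, inv_mul_cancel₀ hs0.ne'])
    exact ⟨x', hx', fun i => congrFun h i⟩
  obtain ⟨x', hx', hxb⟩ := key hx ht hs
  obtain ⟨y', hy', hyb⟩ := key hy ht' hss
  have hr' : realize (T.vert K) x' = realize (T.vert K') y' := by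
    funext m
    rw [realize_of_baryCoord_eq (θ := fun m => 1 + t * θ m) hxb,
      realize_of_baryCoord_eq (θ := fun m => 1 + t * θ m) hyb, hr]
  have hv := congrArg v ((T.glue K K' x' hx' y' hy').2 hr')
  have hv' : v (T.F K x') = v (T.F K' y') := hv
  rw [hc x' hx', hc' y' hy', funext hxb, funext hyb, bernsteinForm_mul, bernsteinForm_mul] at hv'
  exact mul_left_cancel₀ (by positivity) hv'

/-- The point of the reference triangle at the vertex `i`. -/
lemma exists_baryCoord_eq_single (i : Fin 3) :
    ∃ x ∈ refTriangle, baryCoord x = Pi.single i 1 := by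
  refine exists_baryCoord_eq (fun j => ?_) (by simp)
  rcases eq_or_ne j i with rfl | h
  · simp
  · simp [Pi.single_eq_of_ne h]

lemma realize_of_baryCoord_eq_single {a : Fin 3 → ℕ} {x : E2} {i : Fin 3}
    (hx : baryCoord x = Pi.single i 1) : realize a x = Pi.single (a i) 1 := by
  rw [realize, Finset.sum_eq_single i]
  · simp [hx]
  · intro j _ hj
    rw [hx, Pi.single_eq_of_ne hj, Pi.single_zero]
  · simp

/-- A function on the mesh has well defined values at the vertices. -/
lemma exists_vertex_values (T : Triangulation kg) (a : E3 → ℝ) :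
    ∃ θ : ℕ → ℝ, ∀ K i, ∃ x ∈ refTriangle, θ (T.vert K i) = a (T.F K x) := by
  choose e he heb using exists_baryCoord_eq_single
  classical
  refine ⟨fun m => if h : ∃ p : Fin T.card × Fin 3, T.vert p.1 p.2 = m then
    a (T.F h.choose.1 (e h.choose.2)) else 0, fun K i => ⟨e i, he i, ?_⟩⟩
  have h : ∃ p : Fin T.card × Fin 3, T.vert p.1 p.2 = T.vert K i := ⟨(K, i), rfl⟩
  refine (dif_pos h).trans ?_
  have h1 := (T.glue h.choose.1 K _ (he h.choose.2) _ (he i)).2 (by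
    rw [realize_of_baryCoord_eq_single (heb _), realize_of_baryCoord_eq_single (heb _),
      h.choose_spec])
  exact congrArg a h1

/-- If `a` varies by at most `δ` on each element, then its product with a finite element function
`v` of degree `k` differs from a finite element function of the same degree by `C δ ‖v‖`. -/
def HasSuperapproximation (T : Triangulation kg) (k : ℕ) (C : ℝ) : Prop :=
  ∀ (a : E3 → ℝ) (δ : ℝ), 0 ≤ δ → (∀ K, ContinuousOn (T.pull a K) refTriangle) →
      (∀ K, ∀ x ∈ refTriangle, ∀ y ∈ refTriangle, |a (T.F K x) - a (T.F K y)| ≤ δ) →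
      ∀ v ∈ T.scalarSpace k, ∃ w ∈ T.scalarSpace k,
        T.l2norm (T.pull w - T.pull fun z => a z * v z) ≤ C * δ * T.l2norm (T.pull v)

/-- **Superapproximation**, with a constant independent of the mesh. On each element, the Bernstein
coefficient of `v` with exponent `m` is multiplied by the mean `(∑ mᵢ aᵢ) / k` of the vertex values
of `a`. -/
theorem exists_superapproximation {k : ℕ} (hk : 1 ≤ k) {c : ℝ} (hc : 0 < c) :
    ∃ C : ℝ, 0 ≤ C ∧ ∀ (kg : ℕ) (T : Triangulation kg) (h : ℝ), 0 < h → T.QuasiUniform c h →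
      T.HasSuperapproximation k C := by
  obtain ⟨B, hB0, hB⟩ := exists_sq_le_integral_bernsteinForm k
  set N : ℝ := (Fintype.card (MultiIndex k) : ℝ) with hN
  set A : ℝ := volume.real refTriangle with hA
  refine ⟨c ^ 2 * N * Real.sqrt (A * B), by positivity, ?_⟩
  intro kg T h hh hQ a δ hδ hac haδ v hv
  have hk0 : (0 : ℝ) < k := by exact_mod_cast hk
  have hrep : ∀ K, ∃ d : MultiIndex k → ℝ,
      ∀ x ∈ refTriangle, v (T.F K x) = bernsteinForm d (baryCoord x) := by
    intro K
    obtain ⟨P, hPd, hP⟩ := hv.2 K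
    obtain ⟨d, hd⟩ := exists_eval_eq_bernsteinForm hPd
    exact ⟨d, fun x hx => by rw [hP x hx, hd]⟩
  choose d hd using hrep
  obtain ⟨θ, hθ⟩ := T.exists_vertex_values a
  set D : Fin T.card → MultiIndex k → ℝ := fun K m =>
    (k : ℝ)⁻¹ * ((∑ i, m.1 i * θ (T.vert K i)) * d K m) with hD
  have hDeq : ∀ K β, bernsteinForm (D K) β =
      (k : ℝ)⁻¹ * bernsteinForm (fun m => (∑ i, m.1 i * θ (T.vert K i)) * d K m) β := by
    intro K β
    simp only [bernsteinForm, hD, Finset.mul_sum, mul_assoc]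
  classical
  set w : E3 → ℝ := fun z => if hz : ∃ p : Fin T.card × E2, p.2 ∈ refTriangle ∧ T.F p.1 p.2 = z then
    bernsteinForm (D hz.choose.1) (baryCoord hz.choose.2) else 0 with hw
  have hwF : ∀ K, ∀ x ∈ refTriangle, w (T.F K x) = bernsteinForm (D K) (baryCoord x) := by
    intro K x hx
    have hz : ∃ p : Fin T.card × E2, p.2 ∈ refTriangle ∧ T.F p.1 p.2 = T.F K x := ⟨(K, x), hx, rfl⟩
    simp only [hw]
    rw [dif_pos hz, hDeq, hDeq, bernsteinForm_weighted_eq (hd _) (hd K) θ hz.choose_spec.1 hx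
      hz.choose_spec.2]
  have hwmem : w ∈ T.scalarSpace k := by
    refine ⟨continuousOn_iUnion_image (fun K => (T.continuous_F K).continuousOn) fun K =>
      (continuous_bernsteinForm (D K)).continuousOn.congr (hwF K), fun K => ?_⟩
    obtain ⟨P, hPd, hP⟩ := exists_bernsteinForm_eq_eval (D K)
    exact ⟨P, hPd, fun x hx => by rw [hwF K x hx, hP]⟩
  refine ⟨w, hwmem, ?_⟩
  have hvL := scalarSpace_isL2 hv
  have hL : IsL2 (T.pull w - T.pull fun z => a z * v z) := IsL2.of_continuousOn fun K =>
    (scalarSpace_continuousOn_pull hwmem K).sub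
      ((hac K).mul (scalarSpace_continuousOn_pull hv K))
  -- pointwise bound on an element
  have hpt : ∀ K, ∀ x ∈ refTriangle, ‖(T.pull w - T.pull fun z => a z * v z) K x‖ ^ 2 ≤
      δ ^ 2 * N ^ 2 * B * ∫ y in refTriangle, ‖T.pull v K y‖ ^ 2 := by
    intro K x hx
    set S : ℝ := Real.sqrt (B * ∫ y in refTriangle, ‖T.pull v K y‖ ^ 2) with hS
    have hI : ∫ y in refTriangle, ‖T.pull v K y‖ ^ 2 =
        ∫ y in refTriangle, bernsteinForm (d K) (baryCoord y) ^ 2 := by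
      refine setIntegral_congr_fun measurableSet_refTriangle fun y hy => ?_
      simp only [pull, hd K y hy, Real.norm_eq_abs, sq_abs]
    have hI0 : 0 ≤ B * ∫ y in refTriangle, ‖T.pull v K y‖ ^ 2 :=
      mul_nonneg hB0 (MeasureTheory.integral_nonneg fun y => by positivity)
    have hdm : ∀ m, |d K m| ≤ S := fun m => Real.abs_le_sqrt (by rw [hI]; exact hB (d K) m)
    have hdiff : (T.pull w - T.pull fun z => a z * v z) K x = ∑ m : MultiIndex k,
        ((k : ℝ)⁻¹ * ∑ i, m.1 i * (θ (T.vert K i) - a (T.F K x))) *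
          (d K m * ∏ i, baryCoord x i ^ m.1 i) := by
      simp only [Pi.sub_apply, pull, hwF K x hx, hd K x hx]
      simp only [bernsteinForm, Finset.mul_sum, hD]
      rw [← Finset.sum_sub_distrib]
      refine Finset.sum_congr rfl fun m _ => ?_
      have hm : ∑ i, (m.1 i : ℝ) = k := by exact_mod_cast m.sum_eq
      simp only [mul_sub, Finset.sum_sub_distrib, ← Finset.sum_mul, ← Finset.mul_sum, hm]
      field_simp
    have hθδ : ∀ m : MultiIndex k,
        |(k : ℝ)⁻¹ * ∑ i, m.1 i * (θ (T.vert K i) - a (T.F K x))| ≤ δ := by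
      intro m
      have hm : ∑ i, (m.1 i : ℝ) = k := by exact_mod_cast m.sum_eq
      rw [abs_mul, abs_of_pos (inv_pos.2 hk0), inv_mul_le_iff₀ hk0, ← hm, Finset.sum_mul]
      refine (Finset.abs_sum_le_sum_abs _ _).trans (Finset.sum_le_sum fun i _ => ?_)
      rw [abs_mul, Nat.abs_cast]
      obtain ⟨y, hy, hθy⟩ := hθ K i
      rw [hθy]
      gcongr
      exact haδ K y hy x hx
    have hprod : ∀ m : MultiIndex k, |∏ i, baryCoord x i ^ m.1 i| ≤ 1 := by
      intro m
      rw [Finset.abs_prod]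
      refine Finset.prod_le_one (fun i _ => abs_nonneg _) fun i _ => ?_
      have h0 := baryCoord_nonneg hx
      rw [abs_of_nonneg (pow_nonneg (h0 i) _)]
      refine pow_le_one₀ (h0 i) ?_
      rw [← sum_baryCoord x]
      exact Finset.single_le_sum (fun j _ => h0 j) (Finset.mem_univ i)
    have habs : |(T.pull w - T.pull fun z => a z * v z) K x| ≤ δ * N * S := by
      rw [hdiff]
      refine (Finset.abs_sum_le_sum_abs _ _).trans ?_
      calc _ ≤ ∑ _m : MultiIndex k, δ * (S * 1) := by
            refine Finset.sum_le_sum fun m _ => ?_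
            rw [abs_mul, abs_mul (d K m)]
            gcongr
            · exact hθδ m
            · exact hdm m
            · exact hprod m
        _ = δ * N * S := by
            rw [Finset.sum_const, Finset.card_univ, nsmul_eq_mul]
            ring
    calc _ ≤ (δ * N * S) ^ 2 := by
          rw [Real.norm_eq_abs]
          gcongr
      _ = _ := by
          rw [mul_pow, mul_pow, hS, Real.sq_sqrt hI0]
          ring
  have href : refNormSq (T.pull w - T.pull fun z => a z * v z) ≤
      δ ^ 2 * N ^ 2 * (A * B) * refNormSq (T.pull v) := by
    rw [refNormSq, refNormSq, Finset.mul_sum]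
    refine Finset.sum_le_sum fun K _ => ?_
    calc _ ≤ ∫ _ in refTriangle, δ ^ 2 * N ^ 2 * B * ∫ y in refTriangle, ‖T.pull v K y‖ ^ 2 :=
          setIntegral_mono_on (hL.integrableOn_norm_sq K)
            (integrableOn_const isCompact_refTriangle.measure_lt_top.ne) measurableSet_refTriangle
            (hpt K)
      _ = _ := by
          rw [setIntegral_const, smul_eq_mul, ← hA]
          ring
  refine le_of_sq_le_sq ?_ (mul_nonneg (by positivity) (l2norm_nonneg _))
  calc _ ≤ (c * h) ^ 2 * refNormSq (T.pull w - T.pull fun z => a z * v z) :=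
        (hQ.refNormSq_bounds hc hh hL).2
    _ ≤ (c * h) ^ 2 * (δ ^ 2 * N ^ 2 * (A * B) * refNormSq (T.pull v)) := by gcongr
    _ = c ^ 4 * δ ^ 2 * N ^ 2 * (A * B) * ((c⁻¹ * h) ^ 2 * refNormSq (T.pull v)) := by
        field_simp
    _ ≤ c ^ 4 * δ ^ 2 * N ^ 2 * (A * B) * T.l2norm (T.pull v) ^ 2 := by
        gcongr
        exact (hQ.refNormSq_bounds hc hh hvL).1
    _ = _ := by
        have hAB : Real.sqrt (A * B) ^ 2 = A * B := Real.sq_sqrt (by positivity)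
        rw [mul_pow, mul_pow, mul_pow _ (Real.sqrt _), hAB]
        ring

end Triangulation

/-! ### Stability of the discrete solution -/

namespace Triangulation

variable {kg : ℕ} {T : Triangulation kg} {Ω : Set E3} {δ₀ c h : ℝ} {L : ℝ≥0} {k : ℕ}

lemma l2norm_le_sum_components {V : T.Field E3} (hV : ∀ i, IsL2 fun K x => V K x i) :
    T.l2norm V ≤ ∑ i, T.l2norm fun K x => V K x i := by
  have h1 : T.l2norm V ^ 2 = ∑ i, T.l2norm (fun K x => V K x i) ^ 2 := by
    have hi := fun i K => (hV i).integrableOn_norm_sq K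
    simp only [l2norm_sq, EuclideanSpace.norm_sq_eq, Fin.sum_univ_three]
    rw [integral_add (v := fun K x => ‖V K x 0‖ ^ 2 + ‖V K x 1‖ ^ 2)
      (fun K => (hi 0 K).add (hi 1 K)) (hi 2), integral_add (hi 0) (hi 1)]
  refine le_of_sq_le_sq ?_ (Finset.sum_nonneg fun i _ => l2norm_nonneg _)
  have h0 := fun i => l2norm_nonneg (T := T) fun K x => V K x i
  rw [h1, Fin.sum_univ_three, Fin.sum_univ_three]
  nlinarith [mul_nonneg (h0 0) (h0 1), mul_nonneg (h0 0) (h0 2), mul_nonneg (h0 1) (h0 2)]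

lemma ip_zero_right {α : Type*} [NormedAddCommGroup α] [InnerProductSpace ℝ α] (v : T.Field α) :
    T.ip v 0 = 0 := by
  simp [ip, integral]

namespace IsFine

lemma normal_continuousOn_pull (H : T.IsFine Ω δ₀ c h L) (K : Fin T.card) :
    ContinuousOn (T.pull (extension Ω (normal Ω)) K) refTriangle :=
  H.lipschitz.continuousOn.comp (H.continuousOn_lift K) fun _ hx => H.lift_mem K hx

lemma normal_component_continuousOn_pull (H : T.IsFine Ω δ₀ c h L) (i : Fin 3) (K : Fin T.card) :
    ContinuousOn (T.pull (fun z => extension Ω (normal Ω) z i) K) refTriangle :=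
  (EuclideanSpace.proj (𝕜 := ℝ) i).continuous.comp_continuousOn (H.normal_continuousOn_pull K)

lemma abs_normal_component_sub_le (H : T.IsFine Ω δ₀ c h L) (i : Fin 3) (K : Fin T.card) {x y : E2}
    (hx : x ∈ refTriangle) (hy : y ∈ refTriangle) :
    |extension Ω (normal Ω) (T.F K x) i - extension Ω (normal Ω) (T.F K y) i| ≤
      8 * c * L * h := by
  refine le_trans ?_ (H.norm_normal_lift_sub_le K hx hy)
  have h1 := PiLp.norm_apply_le (normal Ω (T.lift Ω K x) - normal Ω (T.lift Ω K y)) i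
  exact h1

/-- The exact normal is almost orthogonal to the discrete tangential gradient. -/
lemma l2norm_inner_normal_grad_le (H : T.IsFine Ω δ₀ c h L) {q : E3 → ℝ}
    (hq : q ∈ T.scalarSpace k) :
    T.l2norm (fun K x => ⟪T.pull (extension Ω (normal Ω)) K x, T.grad q K x⟫) ≤
      c * h * T.l2norm (T.grad q) := by
  have hc := H.c_pos
  have hh := H.h_pos
  have hgc := grad_continuousOn H.isInvertible_gram hq
  refine l2norm_le (IsL2.of_continuousOn fun K => (H.normal_continuousOn_pull K).inner (hgc K))
    (IsL2.of_continuousOn hgc) (by positivity) fun K x hx => ?_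
  obtain ⟨ν, hν, hle⟩ := H.approx.normal_le K x hx
  have h1 : ⟪ν, T.grad q K x⟫ = 0 := hν.2 _
  have h2 : ⟪T.pull (extension Ω (normal Ω)) K x, T.grad q K x⟫ =
      ⟪extension Ω (normal Ω) (T.F K x) - ν, T.grad q K x⟫ := by
    rw [inner_sub_left, h1, sub_zero]
    rfl
  rw [h2]
  refine (norm_inner_le_norm _ _).trans ?_
  gcongr
  refine hle.trans ?_
  gcongr
  exact H.pow_le

lemma ip_smul_normal {V : T.Field E3} (χ : E3 → ℝ) :
    T.ip V (T.pull fun z => χ z • extension Ω (normal Ω) z) =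
      T.ip (fun K x => ⟪T.pull (extension Ω (normal Ω)) K x, V K x⟫) (T.pull χ) := by
  simp only [ip, pull, real_inner_smul_right]
  congr 1
  funext K x
  rw [real_inner_comm]
  simp

/-- Testing with a vanishing pressure. -/
lemma ip_residual_eq_zero (H : T.IsFine Ω δ₀ c h L) {ku kp : ℕ} {f : E3 → ℝ} {g : E3 → E3}
    (hg : MemLp g 2 (surfaceMeasure Ω)) {u : E3 → E3} {p : E3 → ℝ}
    (hs : T.IsDiscreteSolution Ω ku kp f g u p) {v : E3 → E3} (hv : v ∈ T.velocitySpace ku) :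
    T.ip (T.pull u + T.grad p - T.pull (extension Ω g)) (T.pull v) = 0 := by
  have huL := velocitySpace_isL2 hs.velocity_mem
  have hpL := grad_isL2 H.isInvertible_gram hs.pressure_mem.1
  have hgL := H.isL2_extension hg
  have hvL := velocitySpace_isL2 hv
  have h1 := hs.eq v hv _ zero_mem_pressureSpace
  have h0 : T.pull (fun _ : E3 => (0 : ℝ)) = 0 := rfl
  rw [formA, formL, grad_zero, h0, ip_zero_right, ip_zero_right, add_zero, ip_neg_right,
    ip_neg_right, ip_add_left huL hpL hvL] at h1
  rw [ip_sub_left (huL.add hpL) hgL hvL, ip_add_left huL hpL hvL]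
  linarith

/-- Testing with the discrete solution itself: half the square of the energy norm is the value of
the right hand side. -/
lemma l2norm_sq_add_eq (H : T.IsFine Ω δ₀ c h L) {ku kp : ℕ} {f : E3 → ℝ} {g : E3 → E3}
    (hg : MemLp g 2 (surfaceMeasure Ω)) {u : E3 → E3} {p : E3 → ℝ}
    (hs : T.IsDiscreteSolution Ω ku kp f g u p) :
    T.l2norm (T.pull u) ^ 2 + T.l2norm (T.grad p) ^ 2 =
      2 * T.ip (T.pull (extension Ω f)) (T.pull p) + T.ip (T.pull (extension Ω g)) (T.pull u) +
        T.ip (T.pull (extension Ω g)) (T.grad p) := by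
  have huL := velocitySpace_isL2 hs.velocity_mem
  have hpL := grad_isL2 H.isInvertible_gram hs.pressure_mem.1
  have hgL := H.isL2_extension hg
  have h1 := hs.eq u hs.velocity_mem p hs.pressure_mem
  rw [formA, formL, ip_add_right huL.neg hpL hgL, ip_add_right huL.neg hpL (huL.add hpL),
    ip_neg_right, ip_neg_right, ip_add_left huL hpL huL, ip_add_left huL hpL hpL,
    ip_comm (T.grad p) (T.pull u), ip_self, ip_self] at h1
  linarith

lemma energyNorm_le (H : T.IsFine Ω δ₀ c h L) {ku kp : ℕ} {f : E3 → ℝ} {g : E3 → E3}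
    (hf : MemLp f 2 (surfaceMeasure Ω)) (hg : MemLp g 2 (surfaceMeasure Ω)) {u : E3 → E3}
    {p : E3 → ℝ} (hs : T.IsDiscreteSolution Ω ku kp f g u p) {C : ℝ} (hC : 0 ≤ C)
    (hP : T.l2norm (T.pull p) ≤ C * T.l2norm (T.grad p)) :
    T.energyNorm u p ≤
      2 * (C * T.l2norm (T.pull (extension Ω f)) + T.l2norm (T.pull (extension Ω g))) := by
  have huL := velocitySpace_isL2 hs.velocity_mem
  have hpL := grad_isL2 H.isInvertible_gram hs.pressure_mem.1
  have hfL := H.isL2_extension hf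
  have hgL := H.isL2_extension hg
  set E := T.energyNorm u p with hE
  set F := T.l2norm (T.pull (extension Ω f))
  set G := T.l2norm (T.pull (extension Ω g))
  have hF0 : 0 ≤ F := l2norm_nonneg _
  have hG0 : 0 ≤ G := l2norm_nonneg _
  have hE0 : 0 ≤ E := Real.sqrt_nonneg _
  have hEsq : E ^ 2 = T.l2norm (T.pull u) ^ 2 + T.l2norm (T.grad p) ^ 2 :=
    Real.sq_sqrt (by positivity)
  have hUE : T.l2norm (T.pull u) ≤ E := Real.le_sqrt_of_sq_le (le_add_of_nonneg_right (sq_nonneg _))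
  have hPE : T.l2norm (T.grad p) ≤ E := Real.le_sqrt_of_sq_le (le_add_of_nonneg_left (sq_nonneg _))
  have h1 := (le_abs_self _).trans (abs_ip_le hfL (scalarSpace_isL2 hs.pressure_mem.1))
  have h2 := (le_abs_self _).trans (abs_ip_le hgL huL)
  have h3 := (le_abs_self _).trans (abs_ip_le hgL hpL)
  have h4 : F * T.l2norm (T.pull p) ≤ F * (C * E) := by
    gcongr
    exact hP.trans (by gcongr)
  have h5 : G * T.l2norm (T.pull u) ≤ G * E := by gcongr
  have h6 : G * T.l2norm (T.grad p) ≤ G * E := by gcongr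
  have h7 : E * E ≤ 2 * (C * F + G) * E := by
    rw [← sq, hEsq, H.l2norm_sq_add_eq hg hs]
    linarith
  rcases hE0.eq_or_lt with h0 | h0
  · rw [← h0]
    positivity
  · exact le_of_mul_le_mul_right h7 h0

/-- The discrete product of the normal with a scalar finite element function. -/
lemma exists_velocity_approx (H : T.IsFine Ω δ₀ c h L) {C : ℝ}
    (hC : T.HasSuperapproximation k C)
    {χ : E3 → ℝ} (hχ : χ ∈ T.scalarSpace k) : ∃ v ∈ T.velocitySpace k,
      T.l2norm (T.pull v - T.pull fun z => χ z • extension Ω (normal Ω) z) ≤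
        24 * C * c * L * h * T.l2norm (T.pull χ) := by
  have hc := H.c_pos
  have hh := H.h_pos
  have h1 := fun i => hC (fun z => extension Ω (normal Ω) z i) (8 * c * L * h) (by positivity)
    (H.normal_component_continuousOn_pull i)
    (fun K x hx y hy => H.abs_normal_component_sub_le i K hx hy) χ hχ
  choose w hw hwle using h1
  refine ⟨fun z => WithLp.toLp 2 fun i => w i z, fun i => hw i, ?_⟩
  set V : T.Field E3 := T.pull (fun z => WithLp.toLp 2 fun i => w i z) -
    T.pull fun z => χ z • extension Ω (normal Ω) z with hV
  have hVi : ∀ i, (fun K x => V K x i) =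
      T.pull (w i) - T.pull fun z => extension Ω (normal Ω) z i * χ z := by
    intro i
    funext K x
    simp [hV, pull, mul_comm]
  have hVL : ∀ i, IsL2 fun K x => V K x i := fun i => by
    rw [hVi]
    exact IsL2.of_continuousOn fun K => (scalarSpace_continuousOn_pull (hw i) K).sub
      ((H.normal_component_continuousOn_pull i K).mul (scalarSpace_continuousOn_pull hχ K))
  refine (l2norm_le_sum_components hVL).trans ?_
  calc _ ≤ ∑ _i : Fin 3, C * (8 * c * L * h) * T.l2norm (T.pull χ) :=
        Finset.sum_le_sum fun i _ => (congrArg T.l2norm (hVi i)).trans_le (hwle i)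
    _ = _ := by
        simp
        ring

/-- The discrete normal component of a finite element vector field. -/
lemma exists_normal_component_approx (H : T.IsFine Ω δ₀ c h L) {C : ℝ} (hC0 : 0 ≤ C)
    (hC : T.HasSuperapproximation k C)
    {u : E3 → E3} (hu : u ∈ T.velocitySpace k) : ∃ χ ∈ T.scalarSpace k,
      T.l2norm (T.pull χ - T.pull fun z => ⟪extension Ω (normal Ω) z, u z⟫) ≤
        24 * C * c * L * h * T.l2norm (T.pull u) := by
  have hc := H.c_pos
  have hh := H.h_pos
  have h1 := fun i => hC (fun z => extension Ω (normal Ω) z i) (8 * c * L * h) (by positivity)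
    (H.normal_component_continuousOn_pull i)
    (fun K x hx y hy => H.abs_normal_component_sub_le i K hx hy) (fun z => u z i) (hu i)
  choose w hw hwle using h1
  refine ⟨_, scalarSpace_add (scalarSpace_add (hw 0) (hw 1)) (hw 2), ?_⟩
  set e : Fin 3 → T.Field ℝ := fun i =>
    T.pull (w i) - T.pull fun z => extension Ω (normal Ω) z i * u z i with he
  have heL : ∀ i, IsL2 (e i) := fun i =>
    IsL2.of_continuousOn fun K => (scalarSpace_continuousOn_pull (hw i) K).sub
      ((H.normal_component_continuousOn_pull i K).mul (scalarSpace_continuousOn_pull (hu i) K))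
  have hele : ∀ i, T.l2norm (e i) ≤ 8 * C * c * L * h * T.l2norm (T.pull u) := by
    intro i
    have hui : T.l2norm (T.pull fun z => u z i) ≤ 1 * T.l2norm (T.pull u) :=
      l2norm_le (scalarSpace_isL2 (hu i)) (velocitySpace_isL2 hu) zero_le_one fun K x _ => by
        rw [one_mul]
        exact PiLp.norm_apply_le (u (T.F K x)) i
    refine (hwle i).trans ?_
    calc _ ≤ C * (8 * c * L * h) * (1 * T.l2norm (T.pull u)) := by gcongr
      _ = _ := by ring
  have heq : (T.pull (fun z => w 0 z + w 1 z + w 2 z) -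
      T.pull fun z => ⟪extension Ω (normal Ω) z, u z⟫) = e 0 + e 1 + e 2 := by
    funext K x
    simp only [he, pull, Pi.sub_apply, Pi.add_apply, PiLp.inner_apply, Fin.sum_univ_three]
    simp
    ring
  rw [heq]
  refine (l2norm_add_le ((heL 0).add (heL 1)) (heL 2)).trans ?_
  have h2 := l2norm_add_le (heL 0) (heL 1)
  linarith [hele 0, hele 1, hele 2]

/-- The normal component of the discrete velocity is of the order of the mesh size: the residual
`u + ∇p - g` is orthogonal to a finite element field close to `χ n`, where `χ` is a finite element
function close to `n · u`, while `∇p` and `g` are almost tangential. -/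
lemma l2norm_normal_component_le (H : T.IsFine Ω δ₀ c h L) {C : ℝ} (hC0 : 0 ≤ C) {ku kp : ℕ}
    (hC : T.HasSuperapproximation ku C)
    {f : E3 → ℝ} {g : E3 → E3} (hd : IsDarcyData Ω f g) {u : E3 → E3} {p : E3 → ℝ}
    (hs : T.IsDiscreteSolution Ω ku kp f g u p) :
    T.l2norm (T.pull fun z => ⟪extension Ω (normal Ω) z, u z⟫) ≤
      (24 * C * c * L * (3 * T.l2norm (T.pull u) + T.l2norm (T.grad p) +
        T.l2norm (T.pull (extension Ω g))) + c * T.l2norm (T.grad p)) * h := by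
  have hc := H.c_pos
  have hh := H.h_pos
  have huL := velocitySpace_isL2 hs.velocity_mem
  have hpL := grad_isL2 H.isInvertible_gram hs.pressure_mem.1
  have hgL := H.isL2_extension hd.memLp_g
  obtain ⟨χ, hχ, hχu⟩ := H.exists_normal_component_approx hC0 hC hs.velocity_mem
  obtain ⟨v, hv, hvχ⟩ := H.exists_velocity_approx hC hχ
  set n : E3 → E3 := extension Ω (normal Ω) with hn
  have hnc : ∀ K, ContinuousOn (T.pull n K) refTriangle := H.normal_continuousOn_pull
  have hχc := scalarSpace_continuousOn_pull hχ
  have hχL := scalarSpace_isL2 hχ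
  have hvL := velocitySpace_isL2 hv
  have hnuL : IsL2 (T.pull fun z => ⟪n z, u z⟫) := IsL2.of_continuousOn fun K =>
    (hnc K).inner (velocitySpace_continuousOn_pull hs.velocity_mem K)
  have hnpL : IsL2 (T := T) fun K x => ⟪T.pull n K x, T.grad p K x⟫ := IsL2.of_continuousOn fun K =>
    (hnc K).inner (grad_continuousOn H.isInvertible_gram hs.pressure_mem.1 K)
  have hχnL : IsL2 (T.pull fun z => χ z • n z) := IsL2.of_continuousOn fun K =>
    (hχc K).smul (hnc K)
  set R : T.Field E3 := T.pull u + T.grad p - T.pull (extension Ω g) with hR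
  have hRL : IsL2 R := (huL.add hpL).sub hgL
  set U := T.l2norm (T.pull u)
  set P := T.l2norm (T.grad p)
  set G := T.l2norm (T.pull (extension Ω g))
  set X := T.l2norm (T.pull χ) with hX
  have hX0 : 0 ≤ X := l2norm_nonneg _
  have hRle : T.l2norm R ≤ U + P + G :=
    (l2norm_sub_le (huL.add hpL) hgL).trans (add_le_add (l2norm_add_le huL hpL) le_rfl)
  -- the data are tangential
  have hgn : T.ip (T.pull (extension Ω g)) (T.pull fun z => χ z • n z) = 0 := by
    rw [ip_smul_normal]
    have h1 : T.ip (fun K x => ⟪T.pull n K x, T.pull (extension Ω g) K x⟫) (T.pull χ) =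
        T.integral fun _ _ => 0 := by
      refine integral_congr_ae fun K => ?_
      filter_upwards [H.ae_lift hd.tangential_g K] with x hx
      have hx' : ⟪T.pull n K x, T.pull (extension Ω g) K x⟫ = 0 := hx
      rw [hx', inner_zero_left]
    rw [h1]
    simp [integral]
  have hsplit : X * X = T.ip (T.pull χ - T.pull fun z => ⟪n z, u z⟫) (T.pull χ) -
      T.ip R (T.pull v - T.pull fun z => χ z • n z) -
      T.ip (fun K x => ⟪T.pull n K x, T.grad p K x⟫) (T.pull χ) := by
    have h1 : T.ip (T.pull u) (T.pull fun z => χ z • n z) =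
        T.ip (T.pull fun z => ⟪n z, u z⟫) (T.pull χ) := ip_smul_normal χ
    have h2 : T.ip (T.grad p) (T.pull fun z => χ z • n z) =
        T.ip (fun K x => ⟪T.pull n K x, T.grad p K x⟫) (T.pull χ) := ip_smul_normal χ
    have h3 : T.ip R (T.pull fun z => χ z • n z) =
        T.ip (T.pull u) (T.pull fun z => χ z • n z) +
          T.ip (T.grad p) (T.pull fun z => χ z • n z) := by
      rw [hR, ip_sub_left (huL.add hpL) hgL hχnL, ip_add_left huL hpL hχnL, hgn, sub_zero]
    rw [ip_sub_left hχL hnuL hχL, ip_sub_right hvL hχnL hRL, H.ip_residual_eq_zero hd.memLp_g hs hv,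
      h3, h1, h2, ip_self, ← hX]
    ring
  have hb1 := (le_abs_self _).trans (abs_ip_le (hχL.sub hnuL) hχL)
  have hb2 := (neg_le_abs _).trans (abs_ip_le hRL (hvL.sub hχnL))
  have hb3 := (neg_le_abs _).trans (abs_ip_le hnpL hχL)
  have hb1' : T.l2norm (T.pull χ - T.pull fun z => ⟪n z, u z⟫) * X ≤
      24 * C * c * L * h * U * X := by gcongr
  have hb2' : T.l2norm R * T.l2norm (T.pull v - T.pull fun z => χ z • n z) ≤
      (U + P + G) * (24 * C * c * L * h * X) :=
    mul_le_mul hRle hvχ (l2norm_nonneg _) ((l2norm_nonneg _).trans hRle)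
  have hb3' : T.l2norm (fun K x => ⟪T.pull n K x, T.grad p K x⟫) * X ≤ c * h * P * X := by
    gcongr
    exact H.l2norm_inner_normal_grad_le hs.pressure_mem.1
  have hXX : X * X ≤ ((24 * C * c * L * (2 * U + P + G) + c * P) * h) * X := by linarith
  have hXle : X ≤ (24 * C * c * L * (2 * U + P + G) + c * P) * h := by
    rcases hX0.eq_or_lt with h0 | h0
    · have hU : 0 ≤ U := l2norm_nonneg _
      have hP : 0 ≤ P := l2norm_nonneg _
      have hG : 0 ≤ G := l2norm_nonneg _
      rw [← h0]
      positivity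
    · exact le_of_mul_le_mul_right hXX h0
  have hfin : T.l2norm (T.pull fun z => ⟪n z, u z⟫) ≤
      X + T.l2norm (T.pull χ - T.pull fun z => ⟪n z, u z⟫) := by
    have := l2norm_sub_le hχL (hχL.sub hnuL)
    rwa [sub_sub_cancel] at this
  linarith

end IsFine

end Triangulation

end SurfaceDarcy

open SurfaceDarcy
theorem lemma5p2 (Ω : Set E3) (hΩ : BoundsSmoothSurface Ω)
    (δ₀ : ℝ) (hδ₀ : 0 < δ₀)
    (htube : ∀ x ∈ tube Ω δ₀, ∃! y, IsClosestPoint (frontier Ω) x y)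
    (kg ku kp : ℕ) (hkg : 1 ≤ kg) (hku : 1 ≤ ku) (c : ℝ) (hc : 0 < c) :
    ∃ h₀ > 0, ∃ C > 0, ∀ h : ℝ, 0 < h → h ≤ h₀ →
      ∀ T : Triangulation kg, T.QuasiUniform c h → T.Approximates Ω δ₀ c h →
      ∀ (f : E3 → ℝ) (g : E3 → E3), IsDarcyData Ω f g →
      ∀ (u : E3 → E3) (p : E3 → ℝ), T.IsDiscreteSolution Ω ku kp f g u p →
        T.energyNorm u p
            + h⁻¹ * T.l2norm (T.pull fun x => inner ℝ (extension Ω (normal Ω) x) (u x))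
          ≤ C * (normGamma Ω f + normGamma Ω g) := by
  obtain ⟨L, hL⟩ := exists_lipschitzOnWith_normal hΩ
  obtain ⟨C₁, hC₁, hpoincare⟩ := exists_l2norm_le_l2norm_grad hΩ hc
  obtain ⟨C₂, hC₂, hsuper⟩ := Triangulation.exists_superapproximation hku hc
  set D : ℝ := 24 * C₂ * c * L with hD
  have hD0 : 0 ≤ D := by positivity
  refine ⟨min 1 (1 / 8 / (4 * c * L + c)), by positivity,
    ((1 + 4 * D + c) * (2 * (C₁ + 1)) + D) * (2 * c ^ 2), by positivity, ?_⟩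
  intro h hh hh₀ T hQ hA f g hd u p hs
  have H : T.IsFine Ω δ₀ c h L :=
    { surf := hΩ
      unique := htube
      lipschitz := hL
      c_pos := hc
      h_pos := hh
      h_le_one := hh₀.trans (min_le_left _ _)
      small := by
        have h1 := hh₀.trans (min_le_right _ _)
        rwa [le_div_iff₀' (by positivity)] at h1
      one_le := hkg
      quasi := hQ
      approx := hA }
  have hE := H.energyNorm_le hd.memLp_f hd.memLp_g hs hC₁
    (hpoincare kg kp T δ₀ h L H p hs.pressure_mem)
  have hN := H.l2norm_normal_component_le hC₂ (hsuper kg T h hh hQ) hd hs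
  have hF := H.l2norm_extension_le hd.memLp_f
  have hG := H.l2norm_extension_le hd.memLp_g
  set E := T.energyNorm u p with hEdef
  set F := T.l2norm (T.pull (extension Ω f))
  set G := T.l2norm (T.pull (extension Ω g))
  have hF0 : 0 ≤ F := Triangulation.l2norm_nonneg _
  have hG0 : 0 ≤ G := Triangulation.l2norm_nonneg _
  have hUE : T.l2norm (T.pull u) ≤ E := Real.le_sqrt_of_sq_le (le_add_of_nonneg_right (sq_nonneg _))
  have hPE : T.l2norm (T.grad p) ≤ E := Real.le_sqrt_of_sq_le (le_add_of_nonneg_left (sq_nonneg _))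
  have hN' : h⁻¹ * T.l2norm (T.pull fun x => inner ℝ (extension Ω (normal Ω) x) (u x)) ≤
      D * (4 * E + G) + c * E := by
    rw [inv_mul_le_iff₀ hh, mul_comm h]
    refine hN.trans ?_
    gcongr
    linarith
  have hE' : E ≤ 2 * (C₁ + 1) * (F + G) := by
    nlinarith
  calc _ ≤ (1 + 4 * D + c) * E + D * G := by linarith
    _ ≤ (1 + 4 * D + c) * (2 * (C₁ + 1) * (F + G)) + D * (F + G) := by
        gcongr
        linarith
    _ = ((1 + 4 * D + c) * (2 * (C₁ + 1)) + D) * (F + G) := by ring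
    _ ≤ ((1 + 4 * D + c) * (2 * (C₁ + 1)) + D) *
        (2 * c ^ 2 * normGamma Ω f + 2 * c ^ 2 * normGamma Ω g) := by gcongr
    _ = _ := by ring
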